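/- **Setting.** An instance consists of a finite set $C$ of clients and a finite non-empty set $L$ of feasible facility locations in a metric space (distinct points may be co-located, i.e. $d$ may be a pseudometric), an integer $k\ge 1$, and additional problem-specific data; $n=|C\cup L|$. A *$k$-center-set* is a family $F=(f_1,\dots,f_k)$ of elements of $L$ (soft assignment: repetitions are allowed). A *clustering* is a partitioning $\mathbb O=\{O_1,\dots,O_k\}$ of $C$ into $k$ labelled, possibly empty clusters. For real $z>0$ put $$\Psi_z(F,\mathbb O)=\max_{i}\ \min_{f\in F}\ \max_{x\in O_i} d(x,f)^z,\qquad \Psi_z^*(\mathbb O)=\min_{F}\Psi_z(F,\mathbb O),$$ where the cost of an empty cluster is $0$. Each of the following constrained $k$-supplier problems, except the fault-tolerant one, asks for a clustering $\mathbb O$ of minimum $\Psi_z^*(\mathbb O)$ among the feasible ones: 1. *$r$-gather*: given integers $r_1,\dots,r_k\ge 0$; feasible means $|O_i|\ge r_i$ for all $i$. 2. *$r$-capacity*: given integers $r_1,\dots,r_k\ge 0$; feasible means $|O_i|\le r_i$ for all $i$. 3. *Balanced*: given integers $\ell_i,r_i\ge 0$ $(1\le i\le k)$; feasible means $\ell_i\le|O_i|\le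 r_i$ for all $i$. 4. *Chromatic*: given a colour for every client; feasible means that no $O_i$ contains two clients of the same colour. 5. *Fault-tolerant*: given an integer $1\le \ell_x\le k$ for every client $x$; find a $k$-center-set $F$ that minimises $\max_{x\in C} d'(F,x)^z$, where $d'(F,x)$ is the distance from $x$ to its $\ell_x$-th closest facility in $F$ (counted with multiplicity). 6. *Strongly private*: given a partitioning of $C$ into non-empty classes $C_1,\dots,C_\omega$ and integers $\ell_1,\dots,\ell_\omega\ge 0$; feasible means $|C_j\cap O_i|\ge\ell_j$ for all $i,j$. Algorithms are programs of a deterministic random access machine with natural-number variables and arrays, in which addition, truncated subtraction, copying, array access, comparison of two numbers, and comparison of two of the distances $d(x,y)$, $d(u,v)$ each cost one step. The distances are accessible only through such comparisons, and $z$ is not part of the input. **Theorem 1.** For each of the six problems there are a program and a constant $c$ such that on every instance the program halts after at most $c\cdot k^{ck}\cdot n^{c}$ steps, i.e. in time $k^{O(k)}\cdot n^{O(1)}$, and has the following output. * For problems 1, 2, 3, 4 and 6: if no feasible clustering exists, it reports this; otherwise it outputs a $k$-center-set $F$ and a feasible clustering $\mathbb O$ such that, for every $z>0$ and every feasible clustering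 $\mathbb O'$, $\Psi_z(F,\mathbb O)\le 3^z\,\Psi_z^*(\mathbb O')$. * For problem 5: it outputs a $k$-center-set $F$ such that, for every $z>0$ and every $k$-center-set $F'$, $\max_{x\in C} d'(F,x)^z\le 3^z\max_{x\in C} d'(F',x)^z$. Moreover, on $k$-center instances, i.e. when $L=C$, both inequalities hold with $2^z$ in place of $3^z$. -/

import Mathlib

open scoped NNReal

/-! ### Machine model: a random access machine with a step count -/

/-- The store of the machine: natural-number variables and unbounded arrays of natural numbers,
both named by natural numbers. A program mentions only finitely many of them. -/
structure Store where
  var : ℕ → ℕ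
  arr : ℕ → ℕ → ℕ

/-- `var x := v`. -/
def Store.setVar (s : Store) (x v : ℕ) : Store :=
  { s with var := Function.update s.var x v }

/-- `arr A [i] := v`. -/
def Store.setArr (s : Store) (A i v : ℕ) : Store :=
  { s with arr := Function.update s.arr A (Function.update (s.arr A) i v) }

/-- The tests a program can make: comparing the contents of two variables, and comparing two entries
of the distance table. The latter is the only access to the (real) distances. -/
inductive Test where
  /-- `var x ≤ var y` -/
  | le (x y : ℕ)
  /-- `dist (var x) (var y) ≤ dist (var u) (var v)` -/
  | distLe (x y u v : ℕ)

/-- Outcome of a test, for the distance table `D`. -/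
def Test.holds (D : ℕ → ℕ → ℝ≥0) (s : Store) : Test → Prop
  | .le x y => s.var x ≤ s.var y
  | .distLe x y u v => D (s.var x) (s.var y) ≤ D (s.var u) (s.var v)

/-- Programs. The only arithmetic is addition and truncated subtraction, so that unit cost per
instruction is realistic. -/
inductive Prog where
  | skip
  /-- `var x := c` -/
  | const (x c : ℕ)
  /-- `var x := var y` -/
  | copy (x y : ℕ)
  /-- `var x := var y + var w` -/
  | add (x y w : ℕ)
  /-- `var x := var y - var w` (truncated at zero) -/
  | sub (x y w : ℕ)
  /-- `var x := arr A [var y]` -/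
  | load (x A y : ℕ)
  /-- `arr A [var y] := var x` -/
  | store (A y x : ℕ)
  | seq (p q : Prog)
  | ite (b : Test) (p q : Prog)
  | while (b : Test) (p : Prog)

/-- `Exec D p s t s'`: with distance table `D`, the program `p` started in the store `s` halts in
the store `s'` after exactly `t` steps. Every elementary instruction and every evaluation of a test
is one step. -/
inductive Exec (D : ℕ → ℕ → ℝ≥0) : Prog → Store → ℕ → Store → Prop where
  | skip (s : Store) : Exec D .skip s 1 s
  | const (s : Store) (x c : ℕ) : Exec D (.const x c) s 1 (s.setVar x c)
  | copy (s : Store) (x y : ℕ) : Exec D (.copy x y) s 1 (s.setVar x (s.var y))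
  | add (s : Store) (x y w : ℕ) : Exec D (.add x y w) s 1 (s.setVar x (s.var y + s.var w))
  | sub (s : Store) (x y w : ℕ) : Exec D (.sub x y w) s 1 (s.setVar x (s.var y - s.var w))
  | load (s : Store) (x A y : ℕ) : Exec D (.load x A y) s 1 (s.setVar x (s.arr A (s.var y)))
  | store (s : Store) (A y x : ℕ) : Exec D (.store A y x) s 1 (s.setArr A (s.var y) (s.var x))
  | seq {p q : Prog} {s₀ s₁ s₂ : Store} {t₁ t₂ : ℕ} :
      Exec D p s₀ t₁ s₁ → Exec D q s₁ t₂ s₂ → Exec D (.seq p q) s₀ (t₁ + t₂) s₂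
  | ite_true {b : Test} {p q : Prog} {s s' : Store} {t : ℕ} :
      b.holds D s → Exec D p s t s' → Exec D (.ite b p q) s (t + 1) s'
  | ite_false {b : Test} {p q : Prog} {s s' : Store} {t : ℕ} :
      ¬ b.holds D s → Exec D q s t s' → Exec D (.ite b p q) s (t + 1) s'
  | while_true {b : Test} {p : Prog} {s₀ s₁ s₂ : Store} {t₁ t₂ : ℕ} :
      b.holds D s₀ → Exec D p s₀ t₁ s₁ → Exec D (.while b p) s₁ t₂ s₂ →
      Exec D (.while b p) s₀ (t₁ + t₂ + 1) s₂
  | while_false {b : Test} {p : Prog} {s : Store} :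
      ¬ b.holds D s → Exec D (.while b p) s 1 s

/-- The machine is deterministic: final store and number of steps are unique. -/
theorem Exec.unique {D : ℕ → ℕ → ℝ≥0} {p : Prog} {s s' : Store} {t : ℕ}
    (h : Exec D p s t s') : ∀ {t₁ : ℕ} {s₁ : Store}, Exec D p s t₁ s₁ → t = t₁ ∧ s' = s₁ := by
  induction h with
  | skip | const | copy | add | sub | load | store => intro _ _ h; cases h; exact ⟨rfl, rfl⟩
  | seq _ _ ih₁ ih₂ =>
    intro _ _ h
    cases h with
    | seq a b =>
      obtain ⟨rfl, rfl⟩ := ih₁ a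
      obtain ⟨rfl, rfl⟩ := ih₂ b
      exact ⟨rfl, rfl⟩
  | ite_true hb _ ih =>
    intro _ _ h
    cases h with
    | ite_true _ a => obtain ⟨rfl, rfl⟩ := ih a; exact ⟨rfl, rfl⟩
    | ite_false hn _ => exact absurd hb hn
  | ite_false hb _ ih =>
    intro _ _ h
    cases h with
    | ite_true hp _ => exact absurd hp hb
    | ite_false _ a => obtain ⟨rfl, rfl⟩ := ih a; exact ⟨rfl, rfl⟩
  | while_true hb _ _ ih₁ ih₂ =>
    intro _ _ h
    cases h with
    | while_true _ a b =>
      obtain ⟨rfl, rfl⟩ := ih₁ a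
      obtain ⟨rfl, rfl⟩ := ih₂ b
      exact ⟨rfl, rfl⟩
    | while_false hn => exact absurd hb hn
  | while_false hb =>
    intro _ _ h
    cases h with
    | while_true hp _ _ => exact absurd hp hb
    | while_false _ => exact ⟨rfl, rfl⟩

/-! ### Instances of the `k`-supplier problem -/

/-- An instance of the `k`-supplier problem: clients `C` and feasible facility locations `L` in a
metric space. Only the points of `C ∪ L` matter; they are numbered `0, …, n - 1`, so that
`n = |C ∪ L|`. Distinct points may be co-located (distance `0`). The exponent `z` of the cost
function is kept apart. -/
structure Instance where
  n : ℕ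
  k : ℕ
  metric : PseudoMetricSpace (Fin n)
  C : Finset (Fin n)
  L : Finset (Fin n)
  k_pos : 0 < k
  L_nonempty : L.Nonempty
  union_eq : C ∪ L = Finset.univ

namespace Instance

/-- The distance between two points. -/
def d (I : Instance) (x y : Fin I.n) : ℝ≥0 :=
  letI := I.metric
  nndist x y

/-- Choices of `k` open facilities in `L`; several facilities may be opened at one location
(soft assignment). -/
abbrev CenterSet (I : Instance) : Type := Fin I.k → {f // f ∈ I.L}

/-- Partitionings of the client set into `k` (labelled, possibly empty) clusters: every client is
given the label of its cluster. -/
abbrev Clustering (I : Instance) : Type := {x // x ∈ I.C} → Fin I.k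

/-- The `i`-th cluster `O_i`. -/
def cluster (I : Instance) (O : I.Clustering) (i : Fin I.k) : Finset {x // x ∈ I.C} :=
  Finset.univ.filter fun x => O x = i

/-- `Ψ(F, O) = max_i min_{f ∈ F} max_{x ∈ O_i} d(x, f) ^ z`; an empty cluster costs `0`. -/
noncomputable def psi (I : Instance) (z : ℝ) (F : I.CenterSet) (O : I.Clustering) : ℝ≥0 :=
  Finset.univ.sup fun i : Fin I.k =>
    ⨅ j : Fin I.k, (I.cluster O i).sup fun x => I.d x.1 (F j).1 ^ z

/-- `Ψ*(O) = min_F Ψ(F, O)`. -/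
noncomputable def psiStar (I : Instance) (z : ℝ) (O : I.Clustering) : ℝ≥0 :=
  ⨅ F : I.CenterSet, I.psi z F O

/-- The distance from `x` to its `l`-th closest facility among the `k` open ones: the smallest
radius within which at least `l` of them lie (meaningful for `l ≤ k`). -/
noncomputable def lthDist (I : Instance) (F : I.CenterSet) (x : Fin I.n) (l : ℕ) : ℝ≥0 :=
  sInf {ρ : ℝ≥0 | l ≤ (Finset.univ.filter fun i : Fin I.k => I.d x (F i).1 ≤ ρ).card}

/-- The fault-tolerant cost `max_{x ∈ C} d'(F, x) ^ z`, where `d'(F, x)` is the distance from `x`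
to its `ℓ_x`-th closest facility. -/
noncomputable def ftCost (I : Instance) (l : {x // x ∈ I.C} → ℕ) (z : ℝ) (F : I.CenterSet) :
    ℝ≥0 :=
  Finset.univ.sup fun x : {x // x ∈ I.C} => I.lthDist F x.1 (l x) ^ z

/-! ### Input and output conventions -/

/-- The distance table as the machine sees it (`0` outside the range of the points). -/
noncomputable def table (I : Instance) (i j : ℕ) : ℝ≥0 :=
  if h : i < I.n ∧ j < I.n then I.d ⟨i, h.1⟩ ⟨j, h.2⟩ else 0

/-- A list of `k` (or `ω`) numbers as the contents of an array. -/
def listArr {m : ℕ} (v : Fin m → ℕ) (i : ℕ) : ℕ :=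
  if h : i < m then v ⟨i, h⟩ else 0

/-- One number per client as the contents of an array, indexed by the points. -/
def clientArr (I : Instance) (v : {x // x ∈ I.C} → ℕ) (i : ℕ) : ℕ :=
  if h : ∃ hi : i < I.n, (⟨i, hi⟩ : Fin I.n) ∈ I.C then v ⟨⟨i, h.1⟩, h.2⟩ else 0

/-- The initial store: `n`, `k` and a further parameter `w` in the variables `0`, `1`, `2`; the
characteristic functions of `C` and `L` in the arrays `0` and `1`; further data `a`, `b` in the
arrays `2` and `3`; everything else is zero. -/
def start (I : Instance) (w : ℕ) (a b : ℕ → ℕ) : Store where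
  var x := match x with
    | 0 => I.n
    | 1 => I.k
    | 2 => w
    | _ => 0
  arr A := match A with
    | 0 => I.clientArr fun _ => 1
    | 1 => listArr fun f : Fin I.n => if f ∈ I.L then 1 else 0
    | 2 => a
    | 3 => b
    | _ => fun _ => 0

/-- The output centers are in array `4`. -/
def WritesCenters (I : Instance) (s : Store) (F : I.CenterSet) : Prop :=
  ∀ i : Fin I.k, s.arr 4 i = ((F i).1 : ℕ)

/-- The output clustering is in array `5`. -/
def WritesClustering (I : Instance) (s : Store) (O : I.Clustering) : Prop :=
  ∀ x : {x // x ∈ I.C}, s.arr 5 x.1 = (O x : ℕ)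

end Instance

/-! ### Constrained problems -/

/-- A constrained `k`-supplier problem: additional input data, how it is presented to the machine
(one number and two arrays), and the set of feasible partitionings that it describes. -/
structure ConstrainedProblem where
  Data : Instance → Type
  num : (I : Instance) → Data I → ℕ
  arr₁ : (I : Instance) → Data I → ℕ → ℕ
  arr₂ : (I : Instance) → Data I → ℕ → ℕ
  Feasible : (I : Instance) → Data I → I.Clustering → Prop

/-- `r`-gather: `|O_i| ≥ r_i`. -/
def rGather : ConstrainedProblem where
  Data I := Fin I.k → ℕ
  num _ _ := 0
  arr₁ _ r := Instance.listArr r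
  arr₂ _ _ _ := 0
  Feasible I r O := ∀ i, r i ≤ (I.cluster O i).card

/-- `r`-capacity: `|O_i| ≤ r_i`. -/
def rCapacity : ConstrainedProblem where
  Data I := Fin I.k → ℕ
  num _ _ := 0
  arr₁ _ r := Instance.listArr r
  arr₂ _ _ _ := 0
  Feasible I r O := ∀ i, (I.cluster O i).card ≤ r i

/-- Balanced: `ℓ_i ≤ |O_i| ≤ r_i`; the data is the pair `(ℓ, r)`. -/
def balanced : ConstrainedProblem where
  Data I := (Fin I.k → ℕ) × (Fin I.k → ℕ)
  num _ _ := 0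
  arr₁ _ D := Instance.listArr D.1
  arr₂ _ D := Instance.listArr D.2
  Feasible I D O := ∀ i, D.1 i ≤ (I.cluster O i).card ∧ (I.cluster O i).card ≤ D.2 i

/-- Chromatic: every client has a colour (colours are numbered), and no cluster contains two
clients of the same colour. -/
def chromatic : ConstrainedProblem where
  Data I := {x // x ∈ I.C} → ℕ
  num _ _ := 0
  arr₁ I col := I.clientArr col
  arr₂ _ _ _ := 0
  Feasible I col O :=
    ∀ i, ∀ x ∈ I.cluster O i, ∀ y ∈ I.cluster O i, col x = col y → x = y

/-- Data of the strongly private problem: a partitioning of the clients into `ω` (non-empty)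
classes, and a lower bound for each class. -/
structure PrivateData (I : Instance) where
  ω : ℕ
  cls : {x // x ∈ I.C} → Fin ω
  cls_surjective : Function.Surjective cls
  l : Fin ω → ℕ

/-- Strongly private: `|C_j ∩ O_i| ≥ ℓ_j`. -/
def stronglyPrivate : ConstrainedProblem where
  Data := PrivateData
  num _ D := D.ω
  arr₁ I D := I.clientArr fun x => (D.cls x : ℕ)
  arr₂ _ D := Instance.listArr D.l
  Feasible I D O :=
    ∀ (i : Fin I.k) (j : Fin D.ω), D.l j ≤ ((I.cluster O i).filter fun x => D.cls x = j).card

/-- The problem has an approximation algorithm with running time `k ^ O(k) * n ^ O(1)` and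
approximation ratio `3 ^ z`, which is `2 ^ z` on instances with `L = C`. The algorithm sets
variable `3` to `1` and outputs centers and a feasible partitioning if there is one; otherwise it
sets variable `3` to `0`. -/
def ConstrainedProblem.HasFPTApprox (P : ConstrainedProblem) : Prop :=
  ∃ (p : Prog) (c : ℕ), ∀ (I : Instance) (D : P.Data I), ∃ (t : ℕ) (s : Store),
    Exec I.table p (I.start (P.num I D) (P.arr₁ I D) (P.arr₂ I D)) t s ∧
    t ≤ c * I.k ^ (c * I.k) * I.n ^ c ∧
    ((s.var 3 = 0 ∧ ∀ O : I.Clustering, ¬ P.Feasible I D O) ∨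
      (s.var 3 = 1 ∧ ∃ (F : I.CenterSet) (O : I.Clustering),
        I.WritesCenters s F ∧ I.WritesClustering s O ∧ P.Feasible I D O ∧
        ∀ z : ℝ, 0 < z → ∀ O' : I.Clustering, P.Feasible I D O' →
          I.psi z F O ≤ 3 ^ z * I.psiStar z O' ∧
          (I.L = I.C → I.psi z F O ≤ 2 ^ z * I.psiStar z O')))

/-- The fault-tolerant problem (`1 ≤ ℓ_x ≤ k` for every client `x`; minimise the fault-tolerant
cost over all choices of `k` facilities) has an approximation algorithm with running time
`k ^ O(k) * n ^ O(1)` and approximation ratio `3 ^ z`, which is `2 ^ z` on instances with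
`L = C`. -/
def FaultTolerantHasFPTApprox : Prop :=
  ∃ (p : Prog) (c : ℕ), ∀ (I : Instance) (l : {x // x ∈ I.C} → ℕ),
    (∀ x, 1 ≤ l x ∧ l x ≤ I.k) → ∃ (t : ℕ) (s : Store),
      Exec I.table p (I.start 0 (I.clientArr l) fun _ => 0) t s ∧
      t ≤ c * I.k ^ (c * I.k) * I.n ^ c ∧
      ∃ F : I.CenterSet, I.WritesCenters s F ∧
        ∀ z : ℝ, 0 < z → ∀ F' : I.CenterSet,
          I.ftCost l z F ≤ 3 ^ z * I.ftCost l z F' ∧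
          (I.L = I.C → I.ftCost l z F ≤ 2 ^ z * I.ftCost l z F')

/-! ### Bounded-loop programs -/

/-- The variable that holds the constant one in compiled programs. -/
abbrev oneVar : ℕ := 4

/-- Programs whose only loops are counting loops: `loop i N p` runs `p` for
`i = N - 1, …, 0`, where `N` is the value of the variable `N` on entry. -/
inductive Cmd where
  | skip
  | const (x c : ℕ)
  | copy (x y : ℕ)
  | add (x y w : ℕ)
  | sub (x y w : ℕ)
  | load (x A y : ℕ)
  | store (A y x : ℕ)
  | seq (p q : Cmd)
  | ite (b : Test) (p q : Cmd)
  | loop (i N : ℕ) (p : Cmd)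

infixr:60 " ;; " => Cmd.seq

namespace Cmd

/-- Whether the program may write the variable `v`. -/
def writesVar : Cmd → ℕ → Bool
  | skip, _ => false
  | const x _, v => v == x
  | copy x _, v => v == x
  | add x _ _, v => v == x
  | sub x _ _, v => v == x
  | load x _ _, v => v == x
  | store _ _ _, _ => false
  | seq p q, v => p.writesVar v || q.writesVar v
  | ite _ p q, v => p.writesVar v || q.writesVar v
  | loop i _ p, v => v == i || p.writesVar v

/-- Whether the program may write the array `B`. -/
def writesArr : Cmd → ℕ → Bool
  | store A _ _, B => B == A
  | seq p q, B => p.writesArr B || q.writesArr B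
  | ite _ p q, B => p.writesArr B || q.writesArr B
  | loop _ _ p, B => p.writesArr B
  | _, _ => false

/-- No variable in `V` is written, all loop bounds are in `V`, and no loop body writes the counter
of its loop. -/
def wellFormed (V : List ℕ) : Cmd → Bool
  | skip => true
  | const x _ => !V.contains x
  | copy x _ => !V.contains x
  | add x _ _ => !V.contains x
  | sub x _ _ => !V.contains x
  | load x _ _ => !V.contains x
  | store _ _ _ => true
  | seq p q => p.wellFormed V && q.wellFormed V
  | ite _ p q => p.wellFormed V && q.wellFormed V
  | loop i N p => !V.contains i && V.contains N && p.wellFormed V && !p.writesVar i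

/-- Translation into machine programs. -/
def compile : Cmd → Prog
  | skip => .skip
  | const x c => .const x c
  | copy x y => .copy x y
  | add x y w => .add x y w
  | sub x y w => .sub x y w
  | load x A y => .load x A y
  | store A y x => .store A y x
  | seq p q => .seq p.compile q.compile
  | ite b p q => .ite b p.compile q.compile
  | loop i N p => .seq (.copy i N) (.while (.le oneVar i) (.seq (.sub i i oneVar) p.compile))

/-- Iterate `f` with the variable `i` counting down from `m - 1` to `0`. -/
def iterDown (f : Store → Store) (i : ℕ) : ℕ → Store → Store
  | 0, s => s
  | m + 1, s => iterDown f i m (f (s.setVar i m))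

open Classical in
/-- The final store. -/
noncomputable def eval (D : ℕ → ℕ → ℝ≥0) : Cmd → Store → Store
  | skip => fun s => s
  | const x c => fun s => s.setVar x c
  | copy x y => fun s => s.setVar x (s.var y)
  | add x y w => fun s => s.setVar x (s.var y + s.var w)
  | sub x y w => fun s => s.setVar x (s.var y - s.var w)
  | load x A y => fun s => s.setVar x (s.arr A (s.var y))
  | store A y x => fun s => s.setArr A (s.var y) (s.var x)
  | seq p q => fun s => q.eval D (p.eval D s)
  | ite b p q => fun s => if b.holds D s then p.eval D s else q.eval D s
  | loop i N p => fun s => iterDown (p.eval D) i (s.var N) (s.setVar i (s.var N))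

/-- An upper bound for the number of steps when all loop bounds are at most `B`. -/
def cost (B : ℕ) : Cmd → ℕ
  | seq p q => p.cost B + q.cost B
  | ite _ p q => p.cost B + q.cost B + 1
  | loop _ _ p => B * (p.cost B + 2) + 2
  | _ => 1

end Cmd

@[simp] theorem Store.setVar_var (s : Store) (x v y : ℕ) :
    (s.setVar x v).var y = if y = x then v else s.var y := by
  simp [Store.setVar, Function.update_apply]

@[simp] theorem Store.setVar_arr (s : Store) (x v : ℕ) : (s.setVar x v).arr = s.arr := rfl

@[simp] theorem Store.setArr_var (s : Store) (A i v : ℕ) : (s.setArr A i v).var = s.var := rfl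

@[simp] theorem Store.setArr_arr (s : Store) (A i v B : ℕ) :
    (s.setArr A i v).arr B = if B = A then Function.update (s.arr A) i v else s.arr B := by
  simp [Store.setArr, Function.update_apply]

namespace Cmd

variable {D : ℕ → ℕ → ℝ≥0}

@[simp] theorem eval_skip (s : Store) : eval D skip s = s := rfl
@[simp] theorem eval_const (s : Store) (x c : ℕ) : eval D (const x c) s = s.setVar x c := rfl
@[simp] theorem eval_copy (s : Store) (x y : ℕ) :
    eval D (copy x y) s = s.setVar x (s.var y) := rfl
@[simp] theorem eval_add (s : Store) (x y w : ℕ) :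
    eval D (add x y w) s = s.setVar x (s.var y + s.var w) := rfl
@[simp] theorem eval_sub (s : Store) (x y w : ℕ) :
    eval D (sub x y w) s = s.setVar x (s.var y - s.var w) := rfl
@[simp] theorem eval_load (s : Store) (x A y : ℕ) :
    eval D (load x A y) s = s.setVar x (s.arr A (s.var y)) := rfl
@[simp] theorem eval_store (s : Store) (A y x : ℕ) :
    eval D (store A y x) s = s.setArr A (s.var y) (s.var x) := rfl
@[simp] theorem eval_seq (s : Store) (p q : Cmd) :
    eval D (p ;; q) s = eval D q (eval D p s) := rfl

@[simp] theorem eval_ite_le (s : Store) (x y : ℕ) (p q : Cmd) :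
    eval D (ite (.le x y) p q) s = if s.var x ≤ s.var y then eval D p s else eval D q s := by
  by_cases h : s.var x ≤ s.var y <;> simp [eval, Test.holds, h]

@[simp] theorem eval_ite_distLe (s : Store) (x y u v : ℕ) (p q : Cmd) :
    eval D (ite (.distLe x y u v) p q) s =
      if D (s.var x) (s.var y) ≤ D (s.var u) (s.var v) then eval D p s else eval D q s := by
  by_cases h : D (s.var x) (s.var y) ≤ D (s.var u) (s.var v) <;> simp [eval, Test.holds, h]

/-- Run `p` if the variables `x` and `y` are equal. -/
def ifEq (x y : ℕ) (p : Cmd) : Cmd := ite (.le x y) (ite (.le y x) p skip) skip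

@[simp] theorem eval_ifEq (s : Store) (x y : ℕ) (p : Cmd) :
    eval D (ifEq x y p) s = if s.var x = s.var y then eval D p s else s := by
  simp only [ifEq, eval_ite_le, eval_skip]
  split_ifs <;> first | rfl | omega

/-- Write sets are computed from the syntax, so for concrete programs the frame conditions used
below close by `rfl` or `decide`. -/
theorem eval_frame (p : Cmd) (s : Store) :
    (∀ x, p.writesVar x = false → (eval D p s).var x = s.var x) ∧
      ∀ A, p.writesArr A = false → (eval D p s).arr A = s.arr A := by
  induction p generalizing s with
  | skip => simp
  | const | copy | add | sub | load =>
    refine ⟨fun x hx => ?_, fun A _ => rfl⟩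
    simp only [writesVar, beq_eq_false_iff_ne] at hx
    simp [hx]
  | store A y x =>
    refine ⟨fun x _ => rfl, fun B hB => ?_⟩
    simp only [writesArr, beq_eq_false_iff_ne] at hB
    simp [hB]
  | seq p q ihp ihq =>
    simp only [writesVar, writesArr, Bool.or_eq_false_iff, eval_seq]
    exact ⟨fun x hx => ((ihq _).1 x hx.2).trans ((ihp _).1 x hx.1),
      fun x hx => ((ihq _).2 x hx.2).trans ((ihp _).2 x hx.1)⟩
  | ite b p q ihp ihq =>
    simp only [writesVar, writesArr, Bool.or_eq_false_iff, eval]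
    split_ifs
    · exact ⟨fun x hx => (ihp _).1 x hx.1, fun x hx => (ihp _).2 x hx.1⟩
    · exact ⟨fun x hx => (ihq _).1 x hx.2, fun x hx => (ihq _).2 x hx.2⟩
  | loop i N p ih =>
    have key : ∀ m s, (∀ x, (loop i N p).writesVar x = false →
        (iterDown (eval D p) i m s).var x = s.var x) ∧
        ∀ A, p.writesArr A = false → (iterDown (eval D p) i m s).arr A = s.arr A := by
      intro m
      induction m with
      | zero => intro s; simp [iterDown]
      | succ m ihm =>
        intro s
        refine ⟨fun x hx => ?_, fun A hA => ?_⟩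
        · rw [iterDown, (ihm _).1 x hx]
          simp only [writesVar, Bool.or_eq_false_iff, beq_eq_false_iff_ne] at hx
          rw [(ih _).1 x hx.2]
          simp [hx.1]
        · rw [iterDown, (ihm _).2 A hA, (ih _).2 A hA, Store.setVar_arr]
    refine ⟨fun x hx => ?_, fun A hA => (key _ _).2 A hA⟩
    simp only [eval]
    rw [(key _ _).1 x hx]
    simp only [writesVar, Bool.or_eq_false_iff, beq_eq_false_iff_ne] at hx
    simp [hx.1]

theorem eval_var {p : Cmd} {s : Store} {x : ℕ} (h : p.writesVar x = false) :
    (eval D p s).var x = s.var x := (eval_frame p s).1 x h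

theorem eval_arr {p : Cmd} {s : Store} {A : ℕ} (h : p.writesArr A = false) :
    (eval D p s).arr A = s.arr A := (eval_frame p s).2 A h

/-- The stores agree on everything that `p` does not write. -/
def Agree (p : Cmd) (s s' : Store) : Prop :=
  (∀ x, p.writesVar x = false → s'.var x = s.var x) ∧
    ∀ A, p.writesArr A = false → s'.arr A = s.arr A

/-- Invariants of counting loops. -/
theorem loop_induction {i N : ℕ} {p : Cmd} {s : Store} (P : ℕ → Store → Prop)
    (h0 : P (s.var N) (s.setVar i (s.var N)))
    (hstep : ∀ m < s.var N, ∀ s', Agree (loop i N p) s s' → P (m + 1) s' →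
      P m (eval D p (s'.setVar i m))) :
    P 0 (eval D (loop i N p) s) := by
  have key : ∀ m ≤ s.var N, ∀ s', Agree (loop i N p) s s' → P m s' →
      P 0 (iterDown (eval D p) i m s') := by
    intro m
    induction m with
    | zero => intro _ s' _ h; exact h
    | succ m ih =>
      intro hm s' ha h
      refine ih (by omega) _ ?_ (hstep m (by omega) s' ha h)
      refine ⟨fun x hx => ?_, fun A hA => ?_⟩
      · have hx' := hx
        simp only [writesVar, Bool.or_eq_false_iff, beq_eq_false_iff_ne] at hx'
        rw [eval_var hx'.2, ← ha.1 x hx]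
        simp [hx'.1]
      · rw [eval_arr (p := p) hA, ← ha.2 A hA, Store.setVar_arr]
  refine key _ le_rfl _ ⟨fun x hx => ?_, fun A _ => rfl⟩ h0
  simp only [writesVar, Bool.or_eq_false_iff, beq_eq_false_iff_ne] at hx
  simp [hx.1]

/-- If every round preserves `J`, and `Q` as well once it holds, and some round establishes `Q`,
then `Q` holds after the loop. -/
theorem loop_reaches {i N : ℕ} {p : Cmd} {s : Store} (J Q : Store → Prop)
    (hJi : ∀ s v, J s → J (s.setVar i v)) (hs : J s)
    (hJ : ∀ m < s.var N, ∀ s', Agree (loop i N p) s s' → J s' →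
      J (eval D p (s'.setVar i m)))
    (hQ : ∀ m < s.var N, ∀ s', Agree (loop i N p) s s' → J s' → Q s' →
      Q (eval D p (s'.setVar i m)))
    {r : ℕ} (hr : r < s.var N) (hhit : ∀ s', Agree (loop i N p) s s' → J s' →
      Q (eval D p (s'.setVar i r))) :
    Q (eval D (loop i N p) s) := by
  refine (loop_induction (P := fun m s' => J s' ∧ (m ≤ r → Q s')) ⟨hJi _ _ hs, fun h => by omega⟩
    fun m hm s' ha h => ⟨hJ m hm s' ha h.1, fun hmr => ?_⟩).2 (Nat.zero_le _)
  rcases hmr.eq_or_lt with rfl | hlt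
  · exact hhit s' ha h.1
  · exact hQ m hm s' ha h.1 (h.2 hlt)

/-- A loop whose rounds preserve `J`. -/
theorem loop_preserves {i N : ℕ} {p : Cmd} {s : Store} (J : Store → Prop)
    (hJi : ∀ s v, J s → J (s.setVar i v)) (hs : J s)
    (hJ : ∀ m < s.var N, ∀ s', Agree (loop i N p) s s' → J s' → J (eval D p (s'.setVar i m))) :
    J (eval D (loop i N p) s) :=
  loop_induction (P := fun _ s' => J s') (hJi _ _ hs) hJ

theorem Agree.setVar {i N : ℕ} {p : Cmd} {s s' : Store} (h : Agree (loop i N p) s s') (v : ℕ) :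
    Agree (loop i N p) s (s'.setVar i v) := by
  refine ⟨fun x hx => ?_, h.2⟩
  rw [← h.1 x hx]
  simp only [writesVar, Bool.or_eq_false_iff, beq_eq_false_iff_ne] at hx
  simp [hx.1]

/-- Invariants of counting loops, for predicates that do not depend on the counter. -/
theorem loop_induction' {i N : ℕ} {p : Cmd} {s : Store} (P : ℕ → Store → Prop)
    (hP : ∀ m s' v, P m s' → P m (s'.setVar i v)) (h0 : P (s.var N) s)
    (hstep : ∀ m < s.var N, ∀ s', Agree (loop i N p) s s' → s'.var i = m → P (m + 1) s' →
      P m (eval D p s')) :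
    P 0 (eval D (loop i N p) s) :=
  loop_induction P (hP _ _ _ h0) fun m hm s' ha h =>
    hstep m hm _ (ha.setVar m) (by simp) (hP _ _ _ h)

/-- A loop whose body adds one to a counter for every index in `Q`. -/
theorem count_loop {i N c : ℕ} {p : Cmd} {s : Store} (Q : ℕ → Prop) [DecidablePred Q]
    (hc : c ≠ i) (hbody : ∀ m < s.var N, ∀ s', Agree (loop i N p) s s' → s'.var i = m →
      (eval D p s').var c = s'.var c + if Q m then 1 else 0) :
    (eval D (loop i N p) s).var c = s.var c + ((Finset.range (s.var N)).filter Q).card := by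
  have := loop_induction' (D := D) (i := i) (N := N) (p := p) (s := s)
    (P := fun m s' => s'.var c + ((Finset.range m).filter Q).card =
      s.var c + ((Finset.range (s.var N)).filter Q).card)
    (fun m s' v h => by simpa [hc] using h) rfl fun m hm s' ha hi h => by
      rw [Finset.range_add_one, Finset.filter_insert] at h
      rw [hbody m hm s' ha hi, ← h]
      split_ifs
      · rw [Finset.card_insert_of_notMem (by simp)]
        omega
      · omega
  simpa using this

/-- A loop that searches an index in `Q`, raises a flag when it finds one, and records witnesses,
as expressed by `W`. -/
theorem search_loop {i N flag : ℕ} {p : Cmd} {s : Store} (Q : ℕ → Prop) (W : Store → Prop)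
    (hflag : flag ≠ i) (hW : ∀ s' v, W s' → W (s'.setVar i v))
    (hpos : ∀ m < s.var N, ∀ s', Agree (loop i N p) s s' → s'.var i = m → Q m →
      (eval D p s').var flag = 1 ∧ W (eval D p s'))
    (hneg : ∀ m < s.var N, ∀ s', Agree (loop i N p) s s' → s'.var i = m → ¬ Q m →
      (eval D p s').var flag = s'.var flag ∧ (W s' → W (eval D p s'))) :
    ((∃ m < s.var N, Q m) → (eval D (loop i N p) s).var flag = 1 ∧ W (eval D (loop i N p) s)) ∧
      ((∀ m < s.var N, ¬ Q m) → (eval D (loop i N p) s).var flag = s.var flag ∧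
        (W s → W (eval D (loop i N p) s))) := by
  have := loop_induction' (D := D) (i := i) (N := N) (p := p) (s := s)
    (P := fun m s' => ((∃ l < s.var N, m ≤ l ∧ Q l) → s'.var flag = 1 ∧ W s') ∧
      ((∀ l < s.var N, m ≤ l → ¬ Q l) → s'.var flag = s.var flag ∧ (W s → W s')))
    (fun m s' v h => by
      simp only [Store.setVar_var, if_neg hflag]
      exact ⟨fun h' => ⟨(h.1 h').1, hW _ _ (h.1 h').2⟩,
        fun h' => ⟨(h.2 h').1, fun w => hW _ _ ((h.2 h').2 w)⟩⟩)
    ⟨fun ⟨l, h1, h2, _⟩ => by omega, fun _ => ⟨rfl, id⟩⟩ fun m hm s' ha hi h => by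
      by_cases hQ : Q m
      · exact ⟨fun _ => hpos m hm s' ha hi hQ, fun h' => absurd hQ (h' m hm le_rfl)⟩
      · obtain ⟨h1, h2⟩ := hneg m hm s' ha hi hQ
        refine ⟨fun ⟨l, hl, hml, hQl⟩ => ?_, fun h' => ?_⟩
        · have hne : m ≠ l := by rintro rfl; exact hQ hQl
          obtain ⟨h3, h4⟩ := h.1 ⟨l, hl, by omega, hQl⟩
          exact ⟨h1.trans h3, h2 h4⟩
        · obtain ⟨h3, h4⟩ := h.2 fun l hl hml => h' l hl (by omega)
          exact ⟨h1.trans h3, fun w => h2 (h4 w)⟩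
  refine ⟨fun ⟨m, hm, hQ⟩ => this.1 ⟨m, hm, Nat.zero_le _, hQ⟩,
    fun h => this.2 fun l hl _ => h l hl⟩

/-- A loop that fills the array `A` with the values of `g`. -/
theorem fill_loop {i N A : ℕ} {p : Cmd} {s : Store} (g : ℕ → ℕ)
    (hbody : ∀ m < s.var N, ∀ s', Agree (loop i N p) s s' → s'.var i = m →
      (∀ l, m < l → l < s.var N → s'.arr A l = g l) →
      (eval D p s').arr A = Function.update (s'.arr A) m (g m)) :
    ∀ l < s.var N, (eval D (loop i N p) s).arr A l = g l := by
  have := loop_induction' (D := D) (i := i) (N := N) (p := p) (s := s)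
    (P := fun m s' => ∀ l, m ≤ l → l < s.var N → s'.arr A l = g l)
    (fun _ _ _ h => h) (fun l h1 h2 => by omega) fun m hm s' ha hi h l hl hlN => by
      rw [hbody m hm s' ha hi fun l hl => h l hl]
      by_cases hlm : l = m
      · subst hlm; simp
      · rw [Function.update_of_ne hlm]
        exact h l (by omega) hlN
  exact fun l hl => this l (Nat.zero_le _) hl

theorem writesVar_of_wellFormed {V : List ℕ} {p : Cmd} (h : p.wellFormed V = true) {x : ℕ}
    (hx : x ∈ V) : p.writesVar x = false := by
  induction p with
  | skip | store => rfl
  | const | copy | add | sub | load =>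
    simp only [wellFormed, Bool.not_eq_true', List.contains_eq_mem, decide_eq_false_iff_not] at h
    simp only [Cmd.writesVar, beq_eq_false_iff_ne]
    rintro rfl
    exact h hx
  | seq p q ihp ihq | ite b p q ihp ihq =>
    simp only [wellFormed, Bool.and_eq_true] at h
    simp [Cmd.writesVar, ihp h.1, ihq h.2]
  | loop i N p ih =>
    simp only [wellFormed, Bool.and_eq_true, Bool.not_eq_true', List.contains_eq_mem,
      decide_eq_false_iff_not] at h
    simp only [Cmd.writesVar, ih h.1.2, Bool.or_false, beq_eq_false_iff_ne]
    rintro rfl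
    exact h.1.1.1 hx

/-- Compiled programs compute `eval`, within `cost` steps. -/
theorem exec_compile {V : List ℕ} (hV : oneVar ∈ V) {B : ℕ} (p : Cmd) (s : Store)
    (hp : p.wellFormed V = true) (hs : s.var oneVar = 1) (hB : ∀ x ∈ V, s.var x ≤ B) :
    ∃ t, Exec D p.compile s t (eval D p s) ∧ t ≤ p.cost B := by
  induction p generalizing s with
  | skip => exact ⟨1, .skip s, le_rfl⟩
  | const x c => exact ⟨1, .const s x c, le_rfl⟩
  | copy x y => exact ⟨1, .copy s x y, le_rfl⟩
  | add x y w => exact ⟨1, .add s x y w, le_rfl⟩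
  | sub x y w => exact ⟨1, .sub s x y w, le_rfl⟩
  | load x A y => exact ⟨1, .load s x A y, le_rfl⟩
  | store A y x => exact ⟨1, .store s A y x, le_rfl⟩
  | seq p q ihp ihq =>
    simp only [wellFormed, Bool.and_eq_true] at hp
    have hf : ∀ x ∈ V, (eval D p s).var x = s.var x := fun x hx =>
      eval_var (writesVar_of_wellFormed hp.1 hx)
    obtain ⟨t, ht, hle⟩ := ihp s hp.1 hs hB
    obtain ⟨t', ht', hle'⟩ := ihq (eval D p s) hp.2 (by rw [hf _ hV, hs])
      fun x hx => by rw [hf x hx]; exact hB x hx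
    exact ⟨t + t', .seq ht ht', Nat.add_le_add hle hle'⟩
  | ite b p q ihp ihq =>
    simp only [wellFormed, Bool.and_eq_true] at hp
    simp only [eval, cost]
    split_ifs with hb
    · obtain ⟨t, ht, hle⟩ := ihp s hp.1 hs hB
      exact ⟨t + 1, .ite_true hb ht, by omega⟩
    · obtain ⟨t, ht, hle⟩ := ihq s hp.2 hs hB
      exact ⟨t + 1, .ite_false hb ht, by omega⟩
  | loop i N p ih =>
    simp only [wellFormed, Bool.and_eq_true, Bool.not_eq_true', List.contains_eq_mem,
      decide_eq_false_iff_not, decide_eq_true_eq] at hp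
    obtain ⟨⟨⟨hi, hN⟩, hp⟩, hpi⟩ := hp
    have hne : ∀ x ∈ V, x ≠ i := fun x hx h => hi (h ▸ hx)
    -- The machine decrements before the body, so the body sees `m` when the test saw `m + 1`. A
    -- round costs the body, one test and one subtraction.
    have key : ∀ m s, s.var oneVar = 1 → (∀ x ∈ V, s.var x ≤ B) → s.var i = m →
        ∃ t, Exec D (.while (.le oneVar i) (.seq (.sub i i oneVar) p.compile)) s t
          (iterDown (eval D p) i m s) ∧ t ≤ m * (p.cost B + 2) + 1 := by
      intro m
      induction m with
      | zero => exact fun s h1 _ h0 => ⟨1, .while_false (by simp [Test.holds, h1, h0]), by omega⟩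
      | succ m ihm =>
        intro s h1 hB h0
        have hv : ∀ x ∈ V, (s.setVar i m).var x = s.var x := fun x hx => by simp [hne x hx]
        obtain ⟨t, ht, hle⟩ := ih (s.setVar i m) hp (by rw [hv _ hV, h1])
          fun x hx => by rw [hv x hx]; exact hB x hx
        have hw : ∀ x ∈ V, (eval D p (s.setVar i m)).var x = s.var x := fun x hx => by
          rw [eval_var (writesVar_of_wellFormed hp hx), hv x hx]
        obtain ⟨t', ht', hle'⟩ := ihm (eval D p (s.setVar i m)) (by rw [hw _ hV, h1])
          (fun x hx => by rw [hw x hx]; exact hB x hx) (by rw [eval_var hpi]; simp)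
        have hsub : Exec D (.sub i i oneVar) s 1 (s.setVar i m) := by
          simpa [h1, h0] using Exec.sub (D := D) s i i oneVar
        exact ⟨_, .while_true (by simp [Test.holds, h1, h0]) (.seq hsub ht) ht', by grind⟩
    obtain ⟨t, ht, hle⟩ := key (s.var N) (s.setVar i (s.var N))
      (by simpa [hne _ hV] using hs) (fun x hx => by simpa [hne x hx] using hB x hx) (by simp)
    refine ⟨1 + t, .seq (.copy s i N) ht, ?_⟩
    have := Nat.mul_le_mul_right (p.cost B + 2) (hB N hN)
    simp only [cost]
    omega

/-- Each loop multiplies the cost by about `B`, so the nesting depth controls the degree. One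
constant serves as coefficient and exponent, and monotonicity in the exponent combines the cases. -/
theorem exists_cost_le (p : Cmd) : ∃ c, ∀ B, p.cost B ≤ c * (B + 1) ^ c := by
  have mono : ∀ {a b : ℕ} (B : ℕ), a ≤ b → (B + 1) ^ a ≤ (B + 1) ^ b :=
    fun B h => Nat.pow_le_pow_right (Nat.succ_pos B) h
  induction p with
  | skip | const | copy | add | sub | load | store =>
    exact ⟨1, fun B => by simp [cost]⟩
  | seq p q ihp ihq =>
    obtain ⟨a, ha⟩ := ihp
    obtain ⟨b, hb⟩ := ihq
    refine ⟨a + b, fun B => ?_⟩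
    have h1 := (ha B).trans (Nat.mul_le_mul_left a (mono B (Nat.le_add_right a b)))
    have h2 := (hb B).trans (Nat.mul_le_mul_left b (mono B (Nat.le_add_left b a)))
    simp only [cost, add_mul]
    omega
  | ite _ p q ihp ihq =>
    obtain ⟨a, ha⟩ := ihp
    obtain ⟨b, hb⟩ := ihq
    refine ⟨a + b + 1, fun B => ?_⟩
    have h1 := (ha B).trans (Nat.mul_le_mul_left a (mono B (show a ≤ a + b + 1 by omega)))
    have h2 := (hb B).trans (Nat.mul_le_mul_left b (mono B (show b ≤ a + b + 1 by omega)))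
    have h3 : 1 ≤ (B + 1) ^ (a + b + 1) := Nat.one_le_pow _ _ (Nat.succ_pos B)
    simp only [cost, add_mul]
    omega
  | loop _ _ p ih =>
    obtain ⟨a, ha⟩ := ih
    refine ⟨a + 4, fun B => ?_⟩
    have h1 : (B + 1) * p.cost B ≤ a * (B + 1) ^ (a + 4) :=
      calc (B + 1) * p.cost B ≤ (B + 1) * (a * (B + 1) ^ a) := Nat.mul_le_mul_left _ (ha B)
        _ = a * (B + 1) ^ (a + 1) := by ring
        _ ≤ _ := Nat.mul_le_mul_left a (mono B (by omega))
    have h2 : B + 1 ≤ (B + 1) ^ (a + 4) := Nat.le_self_pow (by omega) _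
    simp only [cost]
    nlinarith

end Cmd

/-! ### Assignments with bounds on the number of clients per label -/

/-- The number of elements of `X` with label `i`. -/
def labelCount (X : Finset ℕ) (O : ℕ → ℕ) (i : ℕ) : ℕ := (X.filter fun x => O x = i).card

/-- Relabelling one element changes one summand. The additive form avoids truncated subtraction;
counts and potentials are both instances. -/
theorem sum_comp_update {X : Finset ℕ} (g O : ℕ → ℕ) {x : ℕ} (hx : x ∈ X) (b : ℕ) :
    ∑ y ∈ X, g (Function.update O x b y) + g (O x) = ∑ y ∈ X, g (O y) + g b := by
  rw [← Finset.add_sum_erase _ _ hx, ← Finset.add_sum_erase X (fun y => g (O y)) hx]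
  have : ∑ y ∈ X.erase x, g (Function.update O x b y) = ∑ y ∈ X.erase x, g (O y) :=
    Finset.sum_congr rfl fun y hy => by rw [Function.update_of_ne (Finset.ne_of_mem_erase hy)]
  simp only [Function.update_self, this]
  omega

theorem labelCount_update {X : Finset ℕ} (O : ℕ → ℕ) {x : ℕ} (hx : x ∈ X) (b j : ℕ) :
    labelCount X (Function.update O x b) j + (if O x = j then 1 else 0) =
      labelCount X O j + if b = j then 1 else 0 := by
  have := sum_comp_update (fun a => if a = j then 1 else 0) O hx b
  simp only [labelCount, Finset.card_filter]
  exact this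

theorem labelCount_congr {X : Finset ℕ} {O O' : ℕ → ℕ} (h : ∀ x ∈ X, O x = O' x) (i : ℕ) :
    labelCount X O i = labelCount X O' i := by
  unfold labelCount
  rw [Finset.filter_congr fun x hx => by rw [h x hx]]

theorem sum_labelCount (X R : Finset ℕ) (O : ℕ → ℕ) :
    ∑ j ∈ R, labelCount X O j = (X.filter fun x => O x ∈ R).card := by
  rw [Finset.card_eq_sum_card_fiberwise (f := O) (t := R) (by intro x hx; simp_all)]
  refine Finset.sum_congr rfl fun j hj => ?_
  rw [Finset.filter_filter, labelCount]
  congr 1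
  ext x
  simp only [Finset.mem_filter]
  constructor
  · rintro ⟨a, rfl⟩; exact ⟨a, hj, rfl⟩
  · rintro ⟨a, _, b⟩; exact ⟨a, b⟩

/-- Pigeonhole: the label `i` occupies none of the `k` levels below `k`, and only `k - 1` labels
remain for them. -/
theorem exists_missing_level {k i : ℕ} {h : ℕ → ℕ} (hi : i < k) (hk : k ≤ h i) :
    ∃ l < k, ∀ j < k, h j ≠ l := by
  by_contra! hcon
  have hsub : Finset.range k ⊆ ((Finset.range k).erase i).image h := fun l hl => by
    obtain ⟨j, hj, hjl⟩ := hcon l (Finset.mem_range.1 hl)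
    refine Finset.mem_image.2 ⟨j, Finset.mem_erase.2 ⟨?_, Finset.mem_range.2 hj⟩, hjl⟩
    rintro rfl
    have := Finset.mem_range.1 hl
    omega
  have h1 := (Finset.card_le_card hsub).trans Finset.card_image_le
  rw [Finset.card_erase_of_mem (Finset.mem_range.2 hi), Finset.card_range] at h1
  omega

/-- All elements of `X` have an admissible label below `k`. -/
def Assigned (X : Finset ℕ) (k : ℕ) (A : ℕ → ℕ → Prop) (O : ℕ → ℕ) : Prop :=
  ∀ x ∈ X, O x < k ∧ A x (O x)

theorem Assigned.update {X : Finset ℕ} {k : ℕ} {A : ℕ → ℕ → Prop} {O : ℕ → ℕ}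
    (hO : Assigned X k A O) {x j : ℕ} (hj : j < k) (hA : A x j) :
    Assigned X k A (Function.update O x j) := fun y hy => by
  by_cases hyx : y = x
  · subst hyx; simp [hj, hA]
  · simp [Function.update_of_ne hyx, hO y hy]

/-- Invariant of the phase that moves clients away from overfull labels, along heights `h`. -/
structure PushInv (X : Finset ℕ) (k : ℕ) (A : ℕ → ℕ → Prop) (lo hi O h : ℕ → ℕ) : Prop where
  assigned : Assigned X k A O
  drop : ∀ x ∈ X, ∀ j < k, A x j → h (O x) ≤ h j + 1
  height_le : ∀ j < k, h j ≤ k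
  full : ∀ j < k, 0 < h j → hi j ≤ labelCount X O j
  lower : ∀ j < k, lo j ≤ labelCount X O j

/-- The potential of the phase that empties overfull labels. -/
def pushMeasure (X : Finset ℕ) (k : ℕ) (O h : ℕ → ℕ) : ℕ :=
  (∑ j ∈ Finset.range k, (k - h j)) * (X.card + 1) + ∑ x ∈ X, h (O x)

/-- Invariant of the phase that moves clients to underfull labels, along heights `h`. -/
structure PullInv (X : Finset ℕ) (k : ℕ) (A : ℕ → ℕ → Prop) (lo O h : ℕ → ℕ) : Prop where
  assigned : Assigned X k A O
  drop : ∀ x ∈ X, ∀ j < k, A x j → h j ≤ h (O x) + 1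
  height_le : ∀ j < k, h j ≤ k
  scarce : ∀ j < k, 0 < h j → labelCount X O j ≤ lo j

/-- The potential of the phase that fills underfull labels. -/
def pullMeasure (X : Finset ℕ) (k : ℕ) (O h : ℕ → ℕ) : ℕ :=
  ∑ j ∈ Finset.range k, (k - h j) + ∑ x ∈ X, (k - h (O x))

section

variable {X : Finset ℕ} {k : ℕ} {A : ℕ → ℕ → Prop} {lo hi O O' h : ℕ → ℕ} {i j x : ℕ}

theorem sum_height_update (hi : i < k) (hk : h i < k) :
    ∑ j ∈ Finset.range k, (k - Function.update h i (h i + 1) j) + 1 =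
      ∑ j ∈ Finset.range k, (k - h j) := by
  have := sum_comp_update (fun a => k - a) h (Finset.mem_range.2 hi) (h i + 1)
  omega

theorem le_update_succ (j : ℕ) : h j ≤ Function.update h i (h i + 1) j := by
  by_cases hj : j = i
  · subst hj; simp
  · simp [hj]

theorem update_succ_le (j : ℕ) : Function.update h i (h i + 1) j ≤ h j + 1 := by
  by_cases hj : j = i
  · subst hj; simp
  · simp [hj]

/-- The overfull label loses one client, so it still has at least `hi` of them, and `lo ≤ hi`
protects its lower bound. The client descends one level, which decreases the second summand of the
potential. -/
theorem PushInv.move (inv : PushInv X k A lo hi O h) (hlo : ∀ j < k, lo j ≤ hi j) (hx : x ∈ X)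
    (hbad : hi (O x) < labelCount X O (O x)) (hj : j < k) (hA : A x j)
    (hh : h j + 1 = h (O x)) :
    PushInv X k A lo hi (Function.update O x j) h ∧
      pushMeasure X k (Function.update O x j) h < pushMeasure X k O h := by
  have hcnt : ∀ l, l ≠ O x → labelCount X O l ≤ labelCount X (Function.update O x j) l :=
    fun l hl => by
      have := labelCount_update O hx j l
      rw [if_neg hl.symm] at this
      omega
  have hcnt' : labelCount X O (O x) ≤ labelCount X (Function.update O x j) (O x) + 1 := by
    have := labelCount_update O hx j (O x)
    rw [if_pos rfl] at this
    omega
  refine ⟨⟨inv.assigned.update hj hA, fun y hy l hl hAl => ?_, inv.height_le,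
    fun l hl h0 => ?_, fun l hl => ?_⟩, ?_⟩
  · by_cases hyx : y = x
    · subst hyx
      have := inv.drop y hy l hl hAl
      simp only [Function.update_self]
      omega
    · simpa [Function.update_of_ne hyx] using inv.drop y hy l hl hAl
  · by_cases hlx : l = O x
    · subst hlx; omega
    · exact (inv.full l hl h0).trans (hcnt l hlx)
  · by_cases hlx : l = O x
    · subst hlx
      have := hlo _ hl
      omega
    · exact (inv.lower l hl).trans (hcnt l hlx)
  · have := sum_comp_update h O hx j
    simp only [pushMeasure]
    omega

/-- If no client of `i` can descend, the inequality `drop` has slack one for all of them, and `i`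
may rise. The sum of client heights grows by at most `X.card`, which the weight `X.card + 1` of the
height deficits outweighs. -/
theorem PushInv.relabel (inv : PushInv X k A lo hi O h) (hik : i < k)
    (hbad : hi i < labelCount X O i) (hk : h i < k)
    (hno : ∀ x ∈ X, O x = i → ∀ j < k, A x j → h j + 1 ≠ h i) :
    PushInv X k A lo hi O (Function.update h i (h i + 1)) ∧
      pushMeasure X k O (Function.update h i (h i + 1)) < pushMeasure X k O h := by
  refine ⟨⟨inv.assigned, fun y hy l hl hAl => ?_, fun l hl => ?_, fun l hl h0 => ?_,
    inv.lower⟩, ?_⟩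
  · have h1 := inv.drop y hy l hl hAl
    have h2 := le_update_succ (h := h) (i := i) l
    by_cases hyi : O y = i
    · have h3 := hno y hy hyi l hl hAl
      rw [hyi] at h1 ⊢
      simp only [Function.update_self]
      omega
    · rw [Function.update_of_ne hyi]
      omega
  · by_cases hli : l = i
    · subst hli; simpa using hk
    · simpa [hli] using inv.height_le l hl
  · by_cases hli : l = i
    · subst hli; exact hbad.le
    · rw [Function.update_of_ne hli] at h0
      exact inv.full l hl h0
  · have h1 := sum_height_update hik hk
    have h2 : ∑ x ∈ X, Function.update h i (h i + 1) (O x) ≤ ∑ x ∈ X, h (O x) + X.card := by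
      rw [Finset.card_eq_sum_ones, ← Finset.sum_add_distrib]
      exact Finset.sum_le_sum fun x _ => update_succ_le _
    simp only [pushMeasure, ← h1, add_mul]
    omega

/-- A cut argument. The labels above the missing level are all full and one is overfull, so together
they hold more than their capacity; but their clients have to stay above the gap in every admissible
assignment, in particular in `O'`. -/
theorem PushInv.final (inv : PushInv X k A lo hi O h)
    (hfull : ∀ i < k, hi i < labelCount X O i → k ≤ h i) (hO' : Assigned X k A O')
    (hle : ∀ i < k, labelCount X O' i ≤ hi i) : ∀ i < k, labelCount X O i ≤ hi i := by
  intro i hik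
  by_contra! hlt
  obtain ⟨l, hl, hmiss⟩ := exists_missing_level hik (hfull i hik hlt)
  have hli : l < h i := lt_of_lt_of_le hl (hfull i hik hlt)
  set R := (Finset.range k).filter fun j => l < h j with hR
  have h1 : ∑ j ∈ R, hi j < ∑ j ∈ R, labelCount X O j := by
    refine Finset.sum_lt_sum (fun j hj => ?_) ⟨i, by simp [hR, hik, hli], hlt⟩
    simp only [hR, Finset.mem_filter, Finset.mem_range] at hj
    exact inv.full j hj.1 (by omega)
  have h2 : ∑ j ∈ R, labelCount X O j ≤ ∑ j ∈ R, labelCount X O' j := by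
    rw [sum_labelCount, sum_labelCount]
    refine Finset.card_le_card fun x hx => ?_
    simp only [hR, Finset.mem_filter, Finset.mem_range] at hx ⊢
    refine ⟨hx.1, (hO' x hx.1).1, ?_⟩
    -- A change of label descends at most one level, and level `l` is empty, so the client cannot
    -- get below the gap.
    have := inv.drop x hx.1 _ (hO' x hx.1).1 (hO' x hx.1).2
    have := hmiss _ (hO' x hx.1).1
    omega
  have h3 : ∑ j ∈ R, labelCount X O' j ≤ ∑ j ∈ R, hi j :=
    Finset.sum_le_sum fun j hj => hle j (Finset.mem_range.1 (Finset.mem_of_mem_filter j hj))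
  omega

/-- The receiving label was strictly below its bound, so `scarce` survives there, and the donor only
shrinks. The donor may itself become underfull, which the invariant allows. -/
theorem PullInv.move (inv : PullInv X k A lo O h) (hx : x ∈ X) (hik : i < k)
    (hbad : labelCount X O i < lo i) (hA : A x i) (hh : h (O x) + 1 = h i) :
    PullInv X k A lo (Function.update O x i) h ∧
      pullMeasure X k (Function.update O x i) h < pullMeasure X k O h := by
  refine ⟨⟨inv.assigned.update hik hA, fun y hy l hl hAl => ?_, inv.height_le,
    fun l hl h0 => ?_⟩, ?_⟩
  · by_cases hyx : y = x
    · subst hyx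
      have := inv.drop y hy l hl hAl
      simp only [Function.update_self]
      omega
    · simpa [Function.update_of_ne hyx] using inv.drop y hy l hl hAl
  · have h1 := labelCount_update O hx i l
    have h2 := inv.scarce l hl h0
    by_cases hli : i = l
    · subst hli
      rw [if_pos rfl] at h1
      omega
    · rw [if_neg hli] at h1
      omega
  · have h1 := sum_comp_update (fun a => k - h a) O hx i
    have h2 := inv.height_le i hik
    simp only [pullMeasure] at h1 ⊢
    omega

/-- If no client admissible for `i` sits exactly one level below, `drop` places all of them at the
level of `i` or higher, and `i` may rise. Moves and relabellings both raise heights here, so the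
potential needs no weights. -/
theorem PullInv.relabel (inv : PullInv X k A lo O h) (hik : i < k)
    (hbad : labelCount X O i < lo i) (hk : h i < k)
    (hno : ∀ x ∈ X, A x i → h (O x) + 1 ≠ h i) :
    PullInv X k A lo O (Function.update h i (h i + 1)) ∧
      pullMeasure X k O (Function.update h i (h i + 1)) < pullMeasure X k O h := by
  refine ⟨⟨inv.assigned, fun y hy l hl hAl => ?_, fun l hl => ?_, fun l hl h0 => ?_⟩, ?_⟩
  · have h1 := inv.drop y hy l hl hAl
    have h2 := le_update_succ (h := h) (i := i) (O y)
    by_cases hli : l = i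
    · subst hli
      have h3 := hno y hy hAl
      simp only [Function.update_self]
      omega
    · rw [Function.update_of_ne hli]
      omega
  · by_cases hli : l = i
    · subst hli; simpa using hk
    · simpa [hli] using inv.height_le l hl
  · by_cases hli : l = i
    · subst hli; exact hbad.le
    · rw [Function.update_of_ne hli] at h0
      exact inv.scarce l hl h0
  · have h1 := sum_height_update hik hk
    have h2 : ∑ x ∈ X, (k - Function.update h i (h i + 1) (O x)) ≤ ∑ x ∈ X, (k - h (O x)) :=
      Finset.sum_le_sum fun x _ => Nat.sub_le_sub_left (le_update_succ _) _
    simp only [pullMeasure]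
    omega

/-- The mirror image of `PushInv.final`: the clients that `O'` places above the gap are already
there under `O`, although under `O` these labels reach at most their lower bounds and one of them
stays below. -/
theorem PullInv.final (inv : PullInv X k A lo O h)
    (hfull : ∀ i < k, labelCount X O i < lo i → k ≤ h i) (hO' : Assigned X k A O')
    (hle : ∀ i < k, lo i ≤ labelCount X O' i) : ∀ i < k, lo i ≤ labelCount X O i := by
  intro i hik
  by_contra! hlt
  obtain ⟨l, hl, hmiss⟩ := exists_missing_level hik (hfull i hik hlt)
  have hli : l < h i := lt_of_lt_of_le hl (hfull i hik hlt)
  set R := (Finset.range k).filter fun j => l < h j with hR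
  have h1 : ∑ j ∈ R, labelCount X O j < ∑ j ∈ R, lo j := by
    refine Finset.sum_lt_sum (fun j hj => ?_) ⟨i, by simp [hR, hik, hli], hlt⟩
    simp only [hR, Finset.mem_filter, Finset.mem_range] at hj
    exact inv.scarce j hj.1 (by omega)
  have h2 : ∑ j ∈ R, labelCount X O' j ≤ ∑ j ∈ R, labelCount X O j := by
    rw [sum_labelCount, sum_labelCount]
    refine Finset.card_le_card fun x hx => ?_
    simp only [hR, Finset.mem_filter, Finset.mem_range] at hx ⊢
    refine ⟨hx.1, (inv.assigned x hx.1).1, ?_⟩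
    have := inv.drop x hx.1 _ (hO' x hx.1).1 (hO' x hx.1).2
    have := hmiss _ (inv.assigned x hx.1).1
    omega
  have h3 : ∑ j ∈ R, lo j ≤ ∑ j ∈ R, labelCount X O' j :=
    Finset.sum_le_sum fun j hj => hle j (Finset.mem_range.1 (Finset.mem_of_mem_filter j hj))
  omega

theorem PullInv.init (hO : Assigned X k A O) (hh : ∀ j < k, h j = 0) : PullInv X k A lo O h :=
  ⟨hO, fun x _ j hj _ => by simp [hh j hj], fun j hj => by simp [hh j hj],
    fun j hj h0 => by simp [hh j hj] at h0⟩

theorem PushInv.init (hO : Assigned X k A O) (hh : ∀ j < k, h j = 0)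
    (hlo : ∀ j < k, lo j ≤ labelCount X O j) : PushInv X k A lo hi O h :=
  ⟨hO, fun x hx j hj _ => by simp [hh _ (hO x hx).1], fun j hj => by simp [hh j hj],
    fun j hj h0 => by simp [hh j hj] at h0, hlo⟩

theorem pullMeasure_pos (hik : i < k) (hk : h i < k) : 0 < pullMeasure X k O h := by
  have := Finset.single_le_sum (f := fun j => k - h j) (fun _ _ => Nat.zero_le _)
    (Finset.mem_range.2 hik)
  simp only [pullMeasure] at this ⊢
  omega

theorem pushMeasure_pos (hik : i < k) (hk : h i < k) : 0 < pushMeasure X k O h := by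
  have := Finset.single_le_sum (f := fun j => k - h j) (fun _ _ => Nat.zero_le _)
    (Finset.mem_range.2 hik)
  refine Nat.add_pos_left (Nat.mul_pos (by omega) (Nat.succ_pos _)) _

/-- The same bound holds for both potentials, so one precomputed number of rounds serves both
phases. -/
theorem pullMeasure_init_le {n : ℕ} (hX : X.card ≤ n) (hk : 0 < k) :
    pullMeasure X k O h ≤ k * (k * (n + 1)) := by
  have h1 : ∑ j ∈ Finset.range k, (k - h j) ≤ k * k := by
    simpa using Finset.sum_le_card_nsmul (Finset.range k) _ k fun j _ => Nat.sub_le k (h j)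
  have h2 : ∑ x ∈ X, (k - h (O x)) ≤ n * k := by
    refine (Finset.sum_le_card_nsmul X _ k fun j _ => Nat.sub_le k _).trans ?_
    exact Nat.mul_le_mul_right k hX
  simp only [pullMeasure]
  nlinarith [Nat.mul_le_mul_left (n * k) hk]

theorem pushMeasure_init_le {n : ℕ} (hX : X.card ≤ n) (hO : Assigned X k A O)
    (hh : ∀ j < k, h j = 0) : pushMeasure X k O h ≤ k * (k * (n + 1)) := by
  have h1 : ∑ j ∈ Finset.range k, (k - h j) ≤ k * k := by
    simpa using Finset.sum_le_card_nsmul (Finset.range k) _ k fun j _ => Nat.sub_le k (h j)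
  have h2 : ∑ x ∈ X, h (O x) = 0 := Finset.sum_eq_zero fun x hx => hh _ (hO x hx).1
  rw [pushMeasure, h2, add_zero, ← mul_assoc]
  gcongr

end

/-! ### The assignment subroutine for one group of clients -/

/-- The parameters of the assignment subroutine: numbers of points and labels, number of rounds, the
pair of points whose distance is the radius, the key of the current group, the client indicator, the
centers, and the keys of the points. -/
structure GroupData where
  n : ℕ
  k : ℕ
  R : ℕ
  u : ℕ
  v : ℕ
  g : ℕ
  c : ℕ → ℕ
  F : ℕ → ℕ
  key : ℕ → ℕ

namespace GroupData

/-- The clients of the current group. -/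
def X (G : GroupData) : Finset ℕ := (Finset.range G.n).filter fun x => 1 ≤ G.c x ∧ G.key x = G.g

/-- Point `x` may be assigned to the center with label `j`. -/
def Adm (G : GroupData) (D : ℕ → ℕ → ℝ≥0) (x j : ℕ) : Prop := D x (G.F j) ≤ D G.u G.v

/-- The store contains the given parameters. -/
structure Holds (G : GroupData) (s : Store) : Prop where
  hn : s.var 0 = G.n
  hk : s.var 1 = G.k
  one : s.var 4 = 1
  zero : s.var 5 = 0
  hR : s.var 9 = G.R
  hu : s.var 14 = G.u
  hv : s.var 15 = G.v
  hg : s.var 42 = G.g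
  hc : s.arr 0 = G.c
  hF : s.arr 9 = G.F
  hkey : s.arr 14 = G.key

variable {G : GroupData} {D : ℕ → ℕ → ℝ≥0} {s s' : Store}

theorem mem_X {x : ℕ} : x ∈ G.X ↔ x < G.n ∧ 1 ≤ G.c x ∧ G.key x = G.g := by simp [X]

theorem card_X_le : G.X.card ≤ G.n := (Finset.card_filter_le _ _).trans (by simp)

theorem labelCount_X (O : ℕ → ℕ) (i : ℕ) : labelCount G.X O i =
    ((Finset.range G.n).filter fun x => (1 ≤ G.c x ∧ G.key x = G.g) ∧ O x = i).card := by
  rw [labelCount, X, Finset.filter_filter]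

/-- The program does not write the parameters. -/
def keeps (p : Cmd) : Bool :=
  [0, 1, 4, 5, 9, 14, 15, 42].all (fun x => !p.writesVar x) &&
    [0, 9, 14].all fun A => !p.writesArr A

theorem Holds.agree {p : Cmd} (h : G.Holds s) (hp : keeps p = true) (ha : p.Agree s s') :
    G.Holds s' := by
  simp only [keeps, List.all_cons, List.all_nil, Bool.and_true, Bool.and_eq_true,
    Bool.not_eq_true'] at hp
  obtain ⟨⟨h0, h1, h4, h5, h9, h14, h15, h42⟩, ha0, ha9, ha14⟩ := hp
  exact ⟨(ha.1 _ h0).trans h.hn, (ha.1 _ h1).trans h.hk, (ha.1 _ h4).trans h.one,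
    (ha.1 _ h5).trans h.zero, (ha.1 _ h9).trans h.hR, (ha.1 _ h14).trans h.hu,
    (ha.1 _ h15).trans h.hv, (ha.1 _ h42).trans h.hg, (ha.2 _ ha0).trans h.hc,
    (ha.2 _ ha9).trans h.hF, (ha.2 _ ha14).trans h.hkey⟩

theorem Holds.eval {p : Cmd} (h : G.Holds s) (hp : keeps p = true) : G.Holds (p.eval D s) :=
  h.agree hp (Cmd.eval_frame p s)

end GroupData

namespace Cmd

variable {G : GroupData} {D : ℕ → ℕ → ℝ≥0} {s : Store}

/-- Run `p` if the point in variable `44` is a client of the current group. -/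
def ifMember (p : Cmd) : Cmd :=
  load 50 0 44 ;; ite (.le 4 50) (load 51 14 44 ;; ifEq 51 42 p) skip

/-- Count the clients of the current group with the label in variable `43`. -/
def countLabel : Cmd :=
  const 46 0 ;; loop 44 0 (ifMember (load 52 10 44 ;; ifEq 52 43 (add 46 46 4)))

theorem eval_countLabel (h : G.Holds s) :
    (eval D countLabel s).var 46 = labelCount G.X (s.arr 10) (s.var 43) := by
  rw [countLabel, eval_seq, G.labelCount_X, count_loop (D := D)
    (fun x => (1 ≤ G.c x ∧ G.key x = G.g) ∧ s.arr 10 x = s.var 43) (by decide)]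
  · simp [h.hn]
  · intro m hm s' ha hi
    have hs' : G.Holds s' := (h.eval (p := const 46 0) rfl).agree rfl ha
    have h10 : s'.arr 10 = s.arr 10 := ha.2 10 rfl
    have h43 : s'.var 43 = s.var 43 := ha.1 43 rfl
    simp only [ifMember, eval_seq, eval_load, eval_ite_le, eval_ifEq, eval_add, eval_skip,
      Store.setVar_var, Store.setVar_arr, ↓reduceIte, Nat.reduceEqDiff, hi, hs'.hc,
      hs'.one, hs'.hkey, hs'.hg, h10, h43]
    split_ifs <;> simp_all

/-- Set all heights to zero. -/
def resetHeights : Cmd := loop 43 1 (store 13 43 5)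

/-- Set variable `54` to one and find in variable `57` an overfull label that is not at full
height, if there is one. -/
def findOverfull : Cmd :=
  const 54 0 ;; loop 43 1 (countLabel ;; load 55 12 43 ;; ite (.le 46 55) skip
    (load 56 13 43 ;; ite (.le 1 56) skip (const 54 1 ;; copy 57 43)))

/-- Set variable `54` to one and find in variable `57` an underfull label that is not at full
height, if there is one. -/
def findUnderfull : Cmd :=
  const 54 0 ;; loop 43 1 (countLabel ;; load 55 11 43 ;; ite (.le 55 46) skip
    (load 56 13 43 ;; ite (.le 1 56) skip (const 54 1 ;; copy 57 43)))

/-- Find a label in variable `62` of height one less than the number in variable `58` to which the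
client in variable `44` can move. -/
def findTarget : Cmd :=
  loop 45 1 (load 53 9 45 ;; ite (.distLe 44 53 14 15)
    (load 60 13 45 ;; add 60 60 4 ;; ifEq 60 58 (const 59 1 ;; copy 61 44 ;; copy 62 45)) skip)

/-- Find a client in variable `61` that can move one level down from the label in variable `57`
to the label in variable `62`. -/
def findPush : Cmd :=
  load 58 13 57 ;; const 59 0 ;;
    loop 44 0 (ifMember (load 52 10 44 ;; ifEq 52 57 findTarget))

/-- Find a client in variable `61` that can move one level up to the label in variable `57`. -/
def findPull : Cmd :=
  load 53 9 57 ;; load 58 13 57 ;; const 59 0 ;; loop 44 0 (ifMember (ite (.distLe 44 53 14 15)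
    (load 52 10 44 ;; load 60 13 52 ;; add 60 60 4 ;; ifEq 60 58 (const 59 1 ;; copy 61 44))
    skip))

/-- One move away from an overfull label, or one relabelling. -/
def pushStep : Cmd :=
  findOverfull ;; ite (.le 4 54) (findPush ;; ite (.le 4 59) (store 10 61 62)
    (add 58 58 4 ;; store 13 57 58)) skip

/-- One move to an underfull label, or one relabelling. -/
def pullStep : Cmd :=
  findUnderfull ;; ite (.le 4 54) (findPull ;; ite (.le 4 59) (store 10 61 57)
    (add 58 58 4 ;; store 13 57 58)) skip

theorem eval_resetHeights (h : G.Holds s) :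
    ∀ j < G.k, (eval D resetHeights s).arr 13 j = 0 := by
  rw [← h.hk]
  refine fill_loop (fun _ => 0) fun m hm s' ha hi _ => ?_
  have hs' : G.Holds s' := h.agree rfl ha
  simp [hi, hs'.zero]

/-- The second alternative is exactly the stopping condition that `PushInv.final` needs. -/
theorem findOverfull_spec (h : G.Holds s) : let s' := eval D findOverfull s
    (s'.var 54 = 1 ∧ s'.var 57 < G.k ∧
      s.arr 12 (s'.var 57) < labelCount G.X (s.arr 10) (s'.var 57) ∧
      s.arr 13 (s'.var 57) < G.k) ∨
    (s'.var 54 = 0 ∧ ∀ i < G.k, s.arr 12 i < labelCount G.X (s.arr 10) i → G.k ≤ s.arr 13 i) := by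
  intro s'
  have h1 : G.Holds (eval D (const 54 0) s) := h.eval rfl
  have key := search_loop (D := D) (s := eval D (const 54 0) s) (i := 43) (N := 1) (flag := 54)
    (p := countLabel ;; load 55 12 43 ;; ite (.le 46 55) skip
      (load 56 13 43 ;; ite (.le 1 56) skip (const 54 1 ;; copy 57 43)))
    (fun i => s.arr 12 i < labelCount G.X (s.arr 10) i ∧ s.arr 13 i < G.k)
    (fun σ => σ.var 57 < G.k ∧ s.arr 12 (σ.var 57) < labelCount G.X (s.arr 10) (σ.var 57) ∧
      s.arr 13 (σ.var 57) < G.k) (by decide) (fun _ _ h => h) ?_ ?_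
  · rw [h1.hk] at key
    by_cases hex : ∃ m < G.k, s.arr 12 m < labelCount G.X (s.arr 10) m ∧ s.arr 13 m < G.k
    · exact .inl (key.1 hex)
    · push Not at hex
      exact .inr ⟨(key.2 fun m hm h => (hex m hm h.1).not_gt h.2).1, hex⟩
  all_goals
    intro m hm σ ha hi hQ
    have hσ : G.Holds σ := h1.agree rfl ha
    have hc := eval_countLabel (D := D) hσ
    have e43 : (eval D countLabel σ).var 43 = m := (eval_var rfl).trans hi
    have e1 : (eval D countLabel σ).var 1 = G.k := (hσ.eval rfl).hk
    have e54 : (eval D countLabel σ).var 54 = σ.var 54 := eval_var rfl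
    have e57 : (eval D countLabel σ).var 57 = σ.var 57 := eval_var rfl
    have e12 : (eval D countLabel σ).arr 12 = s.arr 12 := (eval_arr rfl).trans (ha.2 12 rfl)
    have e13 : (eval D countLabel σ).arr 13 = s.arr 13 := (eval_arr rfl).trans (ha.2 13 rfl)
    have e10 : σ.arr 10 = s.arr 10 := ha.2 10 rfl
    rw [hi, e10] at hc
    rw [h1.hk] at hm
  · simp [hc, e43, e1, e12, e13, hQ.1.not_ge, hQ.2.not_ge, hQ, hm]
  · rw [not_and_or, not_lt, not_lt] at hQ
    simp only [eval_seq, eval_load, eval_ite_le, Store.setVar_var, Store.setVar_arr, hc, e43, e1,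
      e12, e13, eval_skip, eval_const, eval_copy, ↓reduceIte, Nat.reduceEqDiff]
    split_ifs <;> simp [e54, e57]
    omega

theorem findUnderfull_spec (h : G.Holds s) : let s' := eval D findUnderfull s
    (s'.var 54 = 1 ∧ s'.var 57 < G.k ∧
      labelCount G.X (s.arr 10) (s'.var 57) < s.arr 11 (s'.var 57) ∧
      s.arr 13 (s'.var 57) < G.k) ∨
    (s'.var 54 = 0 ∧ ∀ i < G.k, labelCount G.X (s.arr 10) i < s.arr 11 i → G.k ≤ s.arr 13 i) := by
  intro s'
  have h1 : G.Holds (eval D (const 54 0) s) := h.eval rfl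
  have key := search_loop (D := D) (s := eval D (const 54 0) s) (i := 43) (N := 1) (flag := 54)
    (p := countLabel ;; load 55 11 43 ;; ite (.le 55 46) skip
      (load 56 13 43 ;; ite (.le 1 56) skip (const 54 1 ;; copy 57 43)))
    (fun i => labelCount G.X (s.arr 10) i < s.arr 11 i ∧ s.arr 13 i < G.k)
    (fun σ => σ.var 57 < G.k ∧ labelCount G.X (s.arr 10) (σ.var 57) < s.arr 11 (σ.var 57) ∧
      s.arr 13 (σ.var 57) < G.k) (by decide) (fun _ _ h => h) ?_ ?_
  · rw [h1.hk] at key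
    by_cases hex : ∃ m < G.k, labelCount G.X (s.arr 10) m < s.arr 11 m ∧ s.arr 13 m < G.k
    · exact .inl (key.1 hex)
    · push Not at hex
      exact .inr ⟨(key.2 fun m hm h => (hex m hm h.1).not_gt h.2).1, hex⟩
  all_goals
    intro m hm σ ha hi hQ
    have hσ : G.Holds σ := h1.agree rfl ha
    have hc := eval_countLabel (D := D) hσ
    have e43 : (eval D countLabel σ).var 43 = m := (eval_var rfl).trans hi
    have e1 : (eval D countLabel σ).var 1 = G.k := (hσ.eval rfl).hk
    have e54 : (eval D countLabel σ).var 54 = σ.var 54 := eval_var rfl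
    have e57 : (eval D countLabel σ).var 57 = σ.var 57 := eval_var rfl
    have e11 : (eval D countLabel σ).arr 11 = s.arr 11 := (eval_arr rfl).trans (ha.2 11 rfl)
    have e13 : (eval D countLabel σ).arr 13 = s.arr 13 := (eval_arr rfl).trans (ha.2 13 rfl)
    have e10 : σ.arr 10 = s.arr 10 := ha.2 10 rfl
    rw [hi, e10] at hc
    rw [h1.hk] at hm
  · simp [hc, e43, e1, e11, e13, hQ.1.not_ge, hQ.2.not_ge, hQ, hm]
  · rw [not_and_or, not_lt, not_lt] at hQ
    simp only [eval_seq, eval_load, eval_ite_le, Store.setVar_var, Store.setVar_arr, hc, e43, e1,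
      e11, e13, eval_skip, eval_const, eval_copy, ↓reduceIte, Nat.reduceEqDiff]
    split_ifs <;> simp [e54, e57]
    omega

/-- The witness predicate `W` is arbitrary because this search runs inside a loop over clients: a
failing search must preserve the witness recorded for another client. -/
theorem findTarget_spec (h : G.Holds s) (W : ℕ → ℕ → Prop)
    (hW : ∀ j < G.k, G.Adm D (s.var 44) j → s.arr 13 j + 1 = s.var 58 → W (s.var 44) j) :
    let s' := eval D findTarget s
    ((∃ j < G.k, G.Adm D (s.var 44) j ∧ s.arr 13 j + 1 = s.var 58) →
      s'.var 59 = 1 ∧ W (s'.var 61) (s'.var 62)) ∧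
    ((∀ j < G.k, ¬ (G.Adm D (s.var 44) j ∧ s.arr 13 j + 1 = s.var 58)) →
      s'.var 59 = s.var 59 ∧ (W (s.var 61) (s.var 62) → W (s'.var 61) (s'.var 62))) := by
  rw [← h.hk]
  refine search_loop (fun j => G.Adm D (s.var 44) j ∧ s.arr 13 j + 1 = s.var 58)
    (fun σ => W (σ.var 61) (σ.var 62)) (by decide) (fun _ _ h => h) ?_ ?_
  all_goals
    intro m hm σ ha hi hQ
    have hσ : G.Holds σ := h.agree rfl ha
    have e44 : σ.var 44 = s.var 44 := ha.1 44 rfl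
    have e58 : σ.var 58 = s.var 58 := ha.1 58 rfl
    have e13 : σ.arr 13 = s.arr 13 := ha.2 13 rfl
    rw [h.hk] at hm
    simp only [GroupData.Adm] at hQ hW
  · simp [hi, hσ.hF, hσ.hu, hσ.hv, hσ.one, e44, e58, e13, hQ, hW m hm hQ.1 hQ.2]
  · simp only [eval_seq, eval_load, eval_ite_distLe, eval_ifEq, Store.setVar_var,
      Store.setVar_arr, hi, hσ.hF, hσ.hu, hσ.hv, hσ.one, e44, e58, e13, eval_skip, eval_const,
      eval_copy, eval_add, ↓reduceIte, Nat.reduceEqDiff]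
    split_ifs with h1 h2
    · exact absurd ⟨h1, h2⟩ hQ
    all_goals simp

theorem findPush_spec (h : G.Holds s) : let s' := eval D findPush s
    s'.var 58 = s.arr 13 (s.var 57) ∧
    ((s'.var 59 = 1 ∧ s'.var 61 ∈ G.X ∧ s.arr 10 (s'.var 61) = s.var 57 ∧ s'.var 62 < G.k ∧
        G.Adm D (s'.var 61) (s'.var 62) ∧ s.arr 13 (s'.var 62) + 1 = s.arr 13 (s.var 57)) ∨
      (s'.var 59 = 0 ∧ ∀ x ∈ G.X, s.arr 10 x = s.var 57 → ∀ j < G.k, G.Adm D x j →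
        s.arr 13 j + 1 ≠ s.arr 13 (s.var 57))) := by
  intro s'
  set s₁ := eval D (load 58 13 57 ;; const 59 0) s with hs₁
  have h1 : G.Holds s₁ := h.eval rfl
  have e58' : s₁.var 58 = s.arr 13 (s.var 57) := by simp [hs₁]
  refine ⟨(eval_var (p := loop 44 0 (ifMember (load 52 10 44 ;; ifEq 52 57 findTarget)))
    (s := s₁) rfl).trans e58', ?_⟩
  set W : ℕ → ℕ → Prop := fun x j => x ∈ G.X ∧ s.arr 10 x = s.var 57 ∧ j < G.k ∧
    G.Adm D x j ∧ s.arr 13 j + 1 = s.arr 13 (s.var 57) with hW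
  have key := search_loop (D := D) (s := s₁) (i := 44) (N := 0) (flag := 59)
    (p := ifMember (load 52 10 44 ;; ifEq 52 57 findTarget))
    (fun x => x ∈ G.X ∧ s.arr 10 x = s.var 57 ∧
      ∃ j < G.k, G.Adm D x j ∧ s.arr 13 j + 1 = s.arr 13 (s.var 57))
    (fun σ => W (σ.var 61) (σ.var 62)) (by decide) (fun _ _ h => h) ?_ ?_
  · rw [h1.hn] at key
    by_cases hex : ∃ m < G.n, m ∈ G.X ∧ s.arr 10 m = s.var 57 ∧
      ∃ j < G.k, G.Adm D m j ∧ s.arr 13 j + 1 = s.arr 13 (s.var 57)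
    · exact .inl (key.1 hex)
    · push Not at hex
      refine .inr ⟨(key.2 fun m hm h => ?_).1.trans (by simp [hs₁]), fun x hx hO j hj hA =>
        hex x (GroupData.mem_X.1 hx).1 hx hO j hj hA⟩
      obtain ⟨h2, h3, j, hj, hA, hh⟩ := h
      exact hex m hm h2 h3 j hj hA hh
  all_goals
    intro m hm σ ha hi hQ
    have hσ : G.Holds σ := h1.agree rfl ha
    have e57 : σ.var 57 = s.var 57 := ha.1 57 rfl
    have e58 : σ.var 58 = s.arr 13 (s.var 57) := (ha.1 58 rfl).trans e58'
    have e13 : σ.arr 13 = s.arr 13 := ha.2 13 rfl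
    have e10 : σ.arr 10 = s.arr 10 := ha.2 10 rfl
    rw [h1.hn] at hm
    -- These loads touch scratch variables only, so for a client of the right label the body amounts
    -- to `findTarget` started from `τ`.
    set τ := eval D (load 50 0 44 ;; load 51 14 44 ;; load 52 10 44) σ with hτ
    have hτG : G.Holds τ := hσ.eval rfl
    have τ44 : τ.var 44 = m := (eval_var (p := load 50 0 44 ;; load 51 14 44 ;; load 52 10 44)
      (s := σ) rfl).trans hi
    have τ58 : τ.var 58 = s.arr 13 (s.var 57) :=
      (eval_var (p := load 50 0 44 ;; load 51 14 44 ;; load 52 10 44) (s := σ) rfl).trans e58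
    have τ13 : τ.arr 13 = s.arr 13 := e13
    have hrun : m ∈ G.X → s.arr 10 m = s.var 57 →
        eval D (ifMember (load 52 10 44 ;; ifEq 52 57 findTarget)) σ = eval D findTarget τ := by
      intro hm1 hm2
      rw [GroupData.mem_X] at hm1
      simp [ifMember, hi, hσ.hc, hσ.one, hσ.hkey, hσ.hg, e10, e57, hm1, hm2, hτ]
  · have := findTarget_spec (D := D) hτG W
    rw [τ44, τ58, τ13] at this
    rw [hrun hQ.1 hQ.2.1]
    exact (this fun j hj hA hh => ⟨hQ.1, hQ.2.1, hj, hA, hh⟩).1 hQ.2.2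
  · by_cases hm' : m ∈ G.X ∧ s.arr 10 m = s.var 57
    · have := findTarget_spec (D := D) hτG W
      rw [τ44, τ58, τ13] at this
      rw [hrun hm'.1 hm'.2]
      have h3 := (this fun j hj hA hh => ⟨hm'.1, hm'.2, hj, hA, hh⟩).2 fun j hj hA =>
        hQ ⟨hm'.1, hm'.2, j, hj, hA⟩
      exact h3
    · simp only [GroupData.mem_X] at hm'
      simp only [ifMember, eval_seq, eval_load, eval_ite_le, eval_ifEq, Store.setVar_var,
        Store.setVar_arr, hi, hσ.hc, hσ.one, hσ.hkey, hσ.hg, e10, e57, eval_skip, ↓reduceIte,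
        Nat.reduceEqDiff]
      split_ifs with h2 h3 h4
      · exact absurd ⟨⟨hm, h2, h3⟩, h4⟩ hm'
      all_goals simp

theorem findPull_spec (h : G.Holds s) : let s' := eval D findPull s
    s'.var 58 = s.arr 13 (s.var 57) ∧
    ((s'.var 59 = 1 ∧ s'.var 61 ∈ G.X ∧ G.Adm D (s'.var 61) (s.var 57) ∧
        s.arr 13 (s.arr 10 (s'.var 61)) + 1 = s.arr 13 (s.var 57)) ∨
      (s'.var 59 = 0 ∧ ∀ x ∈ G.X, G.Adm D x (s.var 57) →
        s.arr 13 (s.arr 10 x) + 1 ≠ s.arr 13 (s.var 57))) := by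
  intro s'
  set s₁ := eval D (load 53 9 57 ;; load 58 13 57 ;; const 59 0) s with hs₁
  have h1 : G.Holds s₁ := h.eval rfl
  have e58' : s₁.var 58 = s.arr 13 (s.var 57) := by simp [hs₁]
  have e53' : s₁.var 53 = G.F (s.var 57) := by simp [hs₁, h.hF]
  set p := ifMember (ite (.distLe 44 53 14 15)
    (load 52 10 44 ;; load 60 13 52 ;; add 60 60 4 ;; ifEq 60 58 (const 59 1 ;; copy 61 44))
    skip) with hp
  refine ⟨(eval_var (p := loop 44 0 p) (s := s₁) rfl).trans e58', ?_⟩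
  set Q : ℕ → Prop := fun x => x ∈ G.X ∧ G.Adm D x (s.var 57) ∧
    s.arr 13 (s.arr 10 x) + 1 = s.arr 13 (s.var 57) with hQdef
  have key := search_loop (D := D) (s := s₁) (i := 44) (N := 0) (flag := 59) (p := p) Q
    (fun σ => Q (σ.var 61)) (by decide) (fun _ _ h => h) ?_ ?_
  · rw [h1.hn] at key
    by_cases hex : ∃ m < G.n, Q m
    · exact .inl (key.1 hex)
    · push Not at hex
      exact .inr ⟨(key.2 hex).1.trans (by simp [hs₁]), fun x hx hA hh =>
        hex x (GroupData.mem_X.1 hx).1 ⟨hx, hA, hh⟩⟩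
  all_goals
    intro m hm σ ha hi hQ
    have hσ : G.Holds σ := h1.agree rfl ha
    have e53 : σ.var 53 = G.F (s.var 57) := (ha.1 53 rfl).trans e53'
    have e58 : σ.var 58 = s.arr 13 (s.var 57) := (ha.1 58 rfl).trans e58'
    have e13 : σ.arr 13 = s.arr 13 := ha.2 13 rfl
    have e10 : σ.arr 10 = s.arr 10 := ha.2 10 rfl
    rw [h1.hn] at hm
  · have hQ' := hQ
    simp only [hQdef, GroupData.mem_X, GroupData.Adm] at hQ'
    simp [hp, ifMember, hi, hσ.hc, hσ.one, hσ.hkey, hσ.hg, hσ.hu, hσ.hv, e10, e13, e53, e58, hQ',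
      hQ]
  · simp only [hQdef, GroupData.mem_X, GroupData.Adm] at hQ
    simp only [hp, ifMember, eval_seq, eval_load, eval_ite_le, eval_ite_distLe, eval_ifEq,
      eval_add, eval_const, eval_copy, Store.setVar_var, Store.setVar_arr, hi, hσ.hc, hσ.one,
      hσ.hkey, hσ.hg, hσ.hu, hσ.hv, e10, e13, e53, e58, eval_skip, ↓reduceIte, Nat.reduceEqDiff]
    split_ifs with h2 h3 h4 h5
    · exact absurd ⟨⟨hm, h2, h3⟩, h4, h5⟩ hQ
    all_goals simp

end Cmd

/-! ### Correctness of the push and pull phases -/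

namespace Cmd

variable {G : GroupData} {D : ℕ → ℕ → ℝ≥0} {s : Store}

/-- Either nothing is left to do, or the potential drops. The last conjunct of the second case shows
that progress is impossible once the stopping condition holds. -/
theorem pushStep_spec {lo hi : ℕ → ℕ} (h : G.Holds s) (hhi : s.arr 12 = hi)
    (hlo : ∀ j < G.k, lo j ≤ hi j)
    (inv : PushInv G.X G.k (G.Adm D) lo hi (s.arr 10) (s.arr 13)) :
    let s' := eval D pushStep s
    (∀ x ∉ G.X, s'.arr 10 x = s.arr 10 x) ∧
    ((s'.arr 10 = s.arr 10 ∧ s'.arr 13 = s.arr 13 ∧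
        ∀ i < G.k, hi i < labelCount G.X (s.arr 10) i → G.k ≤ s.arr 13 i) ∨
      PushInv G.X G.k (G.Adm D) lo hi (s'.arr 10) (s'.arr 13) ∧
        pushMeasure G.X G.k (s'.arr 10) (s'.arr 13) <
          pushMeasure G.X G.k (s.arr 10) (s.arr 13) ∧
        ∃ i < G.k, hi i < labelCount G.X (s.arr 10) i ∧ s.arr 13 i < G.k) := by
  intro s'
  have h1 : G.Holds (eval D findOverfull s) := h.eval rfl
  have h2 : G.Holds (eval D findPush (eval D findOverfull s)) := h1.eval rfl
  have f10 : (eval D findOverfull s).arr 10 = s.arr 10 := eval_arr rfl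
  have f13 : (eval D findOverfull s).arr 13 = s.arr 13 := eval_arr rfl
  have g10 : (eval D findPush (eval D findOverfull s)).arr 10 = s.arr 10 :=
    (eval_arr rfl).trans f10
  have g13 : (eval D findPush (eval D findOverfull s)).arr 13 = s.arr 13 :=
    (eval_arr rfl).trans f13
  have g57 : (eval D findPush (eval D findOverfull s)).var 57 =
    (eval D findOverfull s).var 57 := eval_var rfl
  rcases findOverfull_spec (D := D) h with ⟨a54, ak, abad, ah⟩ | ⟨a54, hfull⟩
  · obtain ⟨b58, hfind⟩ := findPush_spec (D := D) h1
    rw [f13] at b58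
    rw [hhi] at abad
    rcases hfind with ⟨b59, hx, hO, hj, hA, hh⟩ | ⟨b59, hno⟩
    · rw [f10] at hO
      rw [f13] at hh
      have e : s' = (eval D findPush (eval D findOverfull s)).setArr 10
          ((eval D findPush (eval D findOverfull s)).var 61)
          ((eval D findPush (eval D findOverfull s)).var 62) := by
        simp [s', pushStep, h1.one, a54, h2.one, b59]
      have e10 : s'.arr 10 = Function.update (s.arr 10)
          ((eval D findPush (eval D findOverfull s)).var 61)
          ((eval D findPush (eval D findOverfull s)).var 62) := by
        rw [e]; simp [g10]
      have e13 : s'.arr 13 = s.arr 13 := by rw [e]; simp [g13]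
      rw [e10, e13]
      have abad' := abad
      rw [← hO] at abad' hh
      have hmove := inv.move hlo hx abad' hj hA hh
      exact ⟨fun x hxX => Function.update_of_ne (by rintro rfl; exact hxX hx) _ _,
        .inr ⟨hmove.1, hmove.2, _, ak, abad, ah⟩⟩
    · rw [f10, f13] at hno
      have e : s' = (((eval D findPush (eval D findOverfull s)).setVar 58
          (s.arr 13 ((eval D findOverfull s).var 57) + 1)).setArr 13
            ((eval D findOverfull s).var 57) (s.arr 13 ((eval D findOverfull s).var 57) + 1)) := by
        simp [s', pushStep, h1.one, a54, h2.one, b59, b58, g57]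
      have e10 : s'.arr 10 = s.arr 10 := by rw [e]; simp [g10]
      have e13 : s'.arr 13 = Function.update (s.arr 13) ((eval D findOverfull s).var 57)
          (s.arr 13 ((eval D findOverfull s).var 57) + 1) := by
        rw [e]; simp [g13]
      rw [e10, e13]
      have hup := inv.relabel ak abad ah hno
      exact ⟨fun _ _ => rfl, .inr ⟨hup.1, hup.2, _, ak, abad, ah⟩⟩
  · have e : s' = eval D findOverfull s := by simp [s', pushStep, h1.one, a54]
    rw [hhi] at hfull
    rw [e, f10, f13]
    exact ⟨fun _ _ => rfl, .inl ⟨rfl, rfl, hfull⟩⟩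

theorem pullStep_spec {lo : ℕ → ℕ} (h : G.Holds s) (hlo : s.arr 11 = lo)
    (inv : PullInv G.X G.k (G.Adm D) lo (s.arr 10) (s.arr 13)) :
    let s' := eval D pullStep s
    (∀ x ∉ G.X, s'.arr 10 x = s.arr 10 x) ∧
    ((s'.arr 10 = s.arr 10 ∧ s'.arr 13 = s.arr 13 ∧
        ∀ i < G.k, labelCount G.X (s.arr 10) i < lo i → G.k ≤ s.arr 13 i) ∨
      PullInv G.X G.k (G.Adm D) lo (s'.arr 10) (s'.arr 13) ∧
        pullMeasure G.X G.k (s'.arr 10) (s'.arr 13) <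
          pullMeasure G.X G.k (s.arr 10) (s.arr 13) ∧
        ∃ i < G.k, labelCount G.X (s.arr 10) i < lo i ∧ s.arr 13 i < G.k) := by
  intro s'
  have h1 : G.Holds (eval D findUnderfull s) := h.eval rfl
  have h2 : G.Holds (eval D findPull (eval D findUnderfull s)) := h1.eval rfl
  have f10 : (eval D findUnderfull s).arr 10 = s.arr 10 := eval_arr rfl
  have f13 : (eval D findUnderfull s).arr 13 = s.arr 13 := eval_arr rfl
  have g10 : (eval D findPull (eval D findUnderfull s)).arr 10 = s.arr 10 :=
    (eval_arr rfl).trans f10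
  have g13 : (eval D findPull (eval D findUnderfull s)).arr 13 = s.arr 13 :=
    (eval_arr rfl).trans f13
  have g57 : (eval D findPull (eval D findUnderfull s)).var 57 =
    (eval D findUnderfull s).var 57 := eval_var rfl
  rcases findUnderfull_spec (D := D) h with ⟨a54, ak, abad, ah⟩ | ⟨a54, hfull⟩
  · obtain ⟨b58, hfind⟩ := findPull_spec (D := D) h1
    rw [f13] at b58
    rw [hlo] at abad
    rw [f10, f13] at hfind
    rcases hfind with ⟨b59, hx, hA, hh⟩ | ⟨b59, hno⟩
    · have e : s' = (eval D findPull (eval D findUnderfull s)).setArr 10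
          ((eval D findPull (eval D findUnderfull s)).var 61)
          ((eval D findUnderfull s).var 57) := by
        simp [s', pullStep, h1.one, a54, h2.one, b59, g57]
      have e10 : s'.arr 10 = Function.update (s.arr 10)
          ((eval D findPull (eval D findUnderfull s)).var 61)
          ((eval D findUnderfull s).var 57) := by
        rw [e]; simp [g10]
      have e13 : s'.arr 13 = s.arr 13 := by rw [e]; simp [g13]
      rw [e10, e13]
      have hmove := inv.move hx ak abad hA hh
      exact ⟨fun x hxX => Function.update_of_ne (by rintro rfl; exact hxX hx) _ _,
        .inr ⟨hmove.1, hmove.2, _, ak, abad, ah⟩⟩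
    · have e : s' = (((eval D findPull (eval D findUnderfull s)).setVar 58
          (s.arr 13 ((eval D findUnderfull s).var 57) + 1)).setArr 13
            ((eval D findUnderfull s).var 57)
            (s.arr 13 ((eval D findUnderfull s).var 57) + 1)) := by
        simp [s', pullStep, h1.one, a54, h2.one, b59, b58, g57]
      have e10 : s'.arr 10 = s.arr 10 := by rw [e]; simp [g10]
      have e13 : s'.arr 13 = Function.update (s.arr 13) ((eval D findUnderfull s).var 57)
          (s.arr 13 ((eval D findUnderfull s).var 57) + 1) := by
        rw [e]; simp [g13]
      rw [e10, e13]
      have hup := inv.relabel ak abad ah hno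
      exact ⟨fun _ _ => rfl, .inr ⟨hup.1, hup.2, _, ak, abad, ah⟩⟩
  · have e : s' = eval D findUnderfull s := by simp [s', pullStep, h1.one, a54]
    rw [hlo] at hfull
    rw [e, f10, f13]
    exact ⟨fun _ _ => rfl, .inl ⟨rfl, rfl, hfull⟩⟩

/-- Move clients until no label is overfull. -/
def pushPhase : Cmd := resetHeights ;; loop 63 9 pushStep

/-- Move clients until no label is underfull. -/
def pullPhase : Cmd := resetHeights ;; loop 63 9 pullStep

/-- The number of rounds is fixed in advance. The invariant says that the potential is at most the
number of remaining rounds, or that the stopping condition holds. At the end a zero potential also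
gives the stopping condition, since a label below height `k` makes the potential positive. -/
theorem pushPhase_spec {lo hi O' : ℕ → ℕ} (h : G.Holds s) (hR : G.k * (G.k * (G.n + 1)) ≤ G.R)
    (hhi : s.arr 12 = hi) (hO : Assigned G.X G.k (G.Adm D) (s.arr 10))
    (hcnt : ∀ j < G.k, lo j ≤ labelCount G.X (s.arr 10) j)
    (hO' : Assigned G.X G.k (G.Adm D) O')
    (hlo' : ∀ j < G.k, lo j ≤ labelCount G.X O' j)
    (hhi' : ∀ j < G.k, labelCount G.X O' j ≤ hi j) :
    let s' := eval D pushPhase s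
    (∀ x ∉ G.X, s'.arr 10 x = s.arr 10 x) ∧ Assigned G.X G.k (G.Adm D) (s'.arr 10) ∧
      ∀ j < G.k, lo j ≤ labelCount G.X (s'.arr 10) j ∧ labelCount G.X (s'.arr 10) j ≤ hi j := by
  intro s'
  have h1 : G.Holds (eval D resetHeights s) := h.eval rfl
  have e10 : (eval D resetHeights s).arr 10 = s.arr 10 := eval_arr rfl
  have h13 := eval_resetHeights (D := D) h
  have key := loop_induction' (D := D) (i := 63) (N := 9) (p := pushStep)
    (s := eval D resetHeights s)
    (P := fun m σ => (∀ x ∉ G.X, σ.arr 10 x = s.arr 10 x) ∧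
      PushInv G.X G.k (G.Adm D) lo hi (σ.arr 10) (σ.arr 13) ∧
      (pushMeasure G.X G.k (σ.arr 10) (σ.arr 13) ≤ m ∨
        ∀ i < G.k, hi i < labelCount G.X (σ.arr 10) i → G.k ≤ σ.arr 13 i))
    (fun _ _ _ h => h) ?_ ?_
  · obtain ⟨k1, k2, k3⟩ := key
    refine ⟨k1, k2.assigned, fun j hj => ⟨k2.lower j hj, k2.final ?_ hO' hhi' j hj⟩⟩
    rcases k3 with k3 | k3
    · intro i hi _
      by_contra! hlt
      have := pushMeasure_pos (X := G.X)
        (O := (eval D (loop 63 9 pushStep) (eval D resetHeights s)).arr 10) hi hlt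
      omega
    · exact k3
  · rw [e10, h1.hR]
    exact ⟨fun _ _ => rfl, .init hO h13 hcnt,
      .inl ((pushMeasure_init_le GroupData.card_X_le hO h13).trans hR)⟩
  · rintro m hm σ ha - ⟨k1, k2, k3⟩
    have hσ : G.Holds σ := h1.agree rfl ha
    have e12 : σ.arr 12 = hi := ((ha.2 12 rfl).trans (eval_arr rfl)).trans hhi
    obtain ⟨l1, l2⟩ := pushStep_spec (D := D) hσ e12 (fun j hj => (hlo' j hj).trans (hhi' j hj)) k2
    refine ⟨fun x hx => (l1 x hx).trans (k1 x hx), ?_⟩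
    rcases l2 with ⟨l2, l3, l4⟩ | ⟨l2, l3, i, hik, hbad, hlt⟩
    · rw [l2, l3]
      exact ⟨k2, .inr l4⟩
    · refine ⟨l2, .inl ?_⟩
      rcases k3 with k3 | k3
      · omega
      · exact absurd hlt (k3 i hik hbad).not_gt

theorem pullPhase_spec {lo O' : ℕ → ℕ} (h : G.Holds s) (hR : G.k * (G.k * (G.n + 1)) ≤ G.R)
    (hk : 0 < G.k) (hlo : s.arr 11 = lo) (hO : Assigned G.X G.k (G.Adm D) (s.arr 10))
    (hO' : Assigned G.X G.k (G.Adm D) O')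
    (hlo' : ∀ j < G.k, lo j ≤ labelCount G.X O' j) :
    let s' := eval D pullPhase s
    (∀ x ∉ G.X, s'.arr 10 x = s.arr 10 x) ∧ Assigned G.X G.k (G.Adm D) (s'.arr 10) ∧
      ∀ j < G.k, lo j ≤ labelCount G.X (s'.arr 10) j := by
  intro s'
  have h1 : G.Holds (eval D resetHeights s) := h.eval rfl
  have e10 : (eval D resetHeights s).arr 10 = s.arr 10 := eval_arr rfl
  have h13 := eval_resetHeights (D := D) h
  have key := loop_induction' (D := D) (i := 63) (N := 9) (p := pullStep)
    (s := eval D resetHeights s)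
    (P := fun m σ => (∀ x ∉ G.X, σ.arr 10 x = s.arr 10 x) ∧
      PullInv G.X G.k (G.Adm D) lo (σ.arr 10) (σ.arr 13) ∧
      (pullMeasure G.X G.k (σ.arr 10) (σ.arr 13) ≤ m ∨
        ∀ i < G.k, labelCount G.X (σ.arr 10) i < lo i → G.k ≤ σ.arr 13 i))
    (fun _ _ _ h => h) ?_ ?_
  · obtain ⟨k1, k2, k3⟩ := key
    refine ⟨k1, k2.assigned, k2.final ?_ hO' hlo'⟩
    rcases k3 with k3 | k3
    · intro i hi _
      by_contra! hlt
      have := pullMeasure_pos (X := G.X)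
        (O := (eval D (loop 63 9 pullStep) (eval D resetHeights s)).arr 10) hi hlt
      omega
    · exact k3
  · rw [e10, h1.hR]
    exact ⟨fun _ _ => rfl, .init hO h13,
      .inl ((pullMeasure_init_le GroupData.card_X_le hk).trans hR)⟩
  · rintro m hm σ ha - ⟨k1, k2, k3⟩
    have hσ : G.Holds σ := h1.agree rfl ha
    have e11 : σ.arr 11 = lo := ((ha.2 11 rfl).trans (eval_arr rfl)).trans hlo
    obtain ⟨l1, l2⟩ := pullStep_spec (D := D) hσ e11 k2
    refine ⟨fun x hx => (l1 x hx).trans (k1 x hx), ?_⟩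
    rcases l2 with ⟨l2, l3, l4⟩ | ⟨l2, l3, i, hik, hbad, hlt⟩
    · rw [l2, l3]
      exact ⟨k2, .inr l4⟩
    · refine ⟨l2, .inl ?_⟩
      rcases k3 with k3 | k3
      · omega
      · exact absurd hlt (k3 i hik hbad).not_gt

end Cmd

/-! ### Several groups: solving them independently and checking the result -/

/-- The bounds on the number of clients of a group with a label, as functions of the input: a
constant, the entry for the label in array `2` or `3`, the entry for the group in array `3`, or the
number of points. -/
inductive Bound where
  | const (c : ℕ)
  | labelA
  | labelB
  | groupB
  | numPoints

namespace Bound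

/-- The value of a bound for group `g` and label `i`. -/
def val (n : ℕ) (a b : ℕ → ℕ) (g i : ℕ) : Bound → ℕ
  | const c => c
  | labelA => a i
  | labelB => b i
  | groupB => b g
  | numPoints => n

/-- Load the bound for the group in variable `42` and the label in variable `43`. -/
def cmd : Bound → Cmd
  | const c => .const 48 c
  | labelA => .load 48 2 43
  | labelB => .load 48 3 43
  | groupB => .load 48 3 42
  | numPoints => .copy 48 0

theorem eval_cmd (β : Bound) (D : ℕ → ℕ → ℝ≥0) (s : Store) : β.cmd.eval D s =
    s.setVar 48 (β.val (s.var 0) (s.arr 2) (s.arr 3) (s.var 42) (s.var 43)) := by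
  cases β <;> rfl

theorem writesVar_cmd (β : Bound) (x : ℕ) : β.cmd.writesVar x = (x == 48) := by
  cases β <;> rfl

theorem writesArr_cmd (β : Bound) (A : ℕ) : β.cmd.writesArr A = false := by
  cases β <;> rfl

end Bound

namespace GroupData

variable {G : GroupData} {D : ℕ → ℕ → ℝ≥0} {s : Store}

/-- The same data for another group. -/
def withKey (G : GroupData) (g : ℕ) : GroupData := { G with g := g }

/-- The parameters that do not depend on the current group. -/
structure HoldsBase (G : GroupData) (s : Store) : Prop where
  hn : s.var 0 = G.n
  hk : s.var 1 = G.k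
  one : s.var 4 = 1
  zero : s.var 5 = 0
  hR : s.var 9 = G.R
  hu : s.var 14 = G.u
  hv : s.var 15 = G.v
  hc : s.arr 0 = G.c
  hF : s.arr 9 = G.F
  hkey : s.arr 14 = G.key

theorem HoldsBase.withKey (h : G.HoldsBase s) {g : ℕ} (hg : s.var 42 = g) :
    (G.withKey g).Holds s :=
  ⟨h.hn, h.hk, h.one, h.zero, h.hR, h.hu, h.hv, hg, h.hc, h.hF, h.hkey⟩

/-- The program does not write the parameters that do not depend on the group. -/
def keepsBase (p : Cmd) : Bool :=
  [0, 1, 4, 5, 9, 14, 15].all (fun x => !p.writesVar x) &&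
    [0, 9, 14].all fun A => !p.writesArr A

theorem HoldsBase.agree {p : Cmd} {s' : Store} (h : G.HoldsBase s) (hp : keepsBase p = true)
    (ha : p.Agree s s') : G.HoldsBase s' := by
  simp only [keepsBase, List.all_cons, List.all_nil, Bool.and_true, Bool.and_eq_true,
    Bool.not_eq_true'] at hp
  obtain ⟨⟨h0, h1, h4, h5, h9, h14, h15⟩, ha0, ha9, ha14⟩ := hp
  exact ⟨(ha.1 _ h0).trans h.hn, (ha.1 _ h1).trans h.hk, (ha.1 _ h4).trans h.one,
    (ha.1 _ h5).trans h.zero, (ha.1 _ h9).trans h.hR, (ha.1 _ h14).trans h.hu,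
    (ha.1 _ h15).trans h.hv, (ha.2 _ ha0).trans h.hc,
    (ha.2 _ ha9).trans h.hF, (ha.2 _ ha14).trans h.hkey⟩

theorem HoldsBase.eval {p : Cmd} (h : G.HoldsBase s) (hp : keepsBase p = true) :
    G.HoldsBase (p.eval D s) :=
  h.agree hp (Cmd.eval_frame p s)

/-- The labels satisfy the bounds in the groups of all points. -/
def Balanced (G : GroupData) (lo hi : ℕ → ℕ → ℕ) (O : ℕ → ℕ) : Prop :=
  ∀ y < G.n, ∀ i < G.k, lo (G.key y) i ≤ labelCount (G.withKey (G.key y)).X O i ∧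
    labelCount (G.withKey (G.key y)).X O i ≤ hi (G.key y) i

/-- All clients have admissible labels. -/
def AllAssigned (G : GroupData) (D : ℕ → ℕ → ℝ≥0) (O : ℕ → ℕ) : Prop :=
  ∀ x < G.n, 1 ≤ G.c x → O x < G.k ∧ G.Adm D x (O x)

theorem AllAssigned.assigned {O : ℕ → ℕ} (h : G.AllAssigned D O) (g : ℕ) :
    Assigned (G.withKey g).X G.k (G.Adm D) O := fun x hx =>
  h x (mem_X.1 hx).1 (mem_X.1 hx).2.1

end GroupData

namespace Cmd

variable {G : GroupData} {D : ℕ → ℕ → ℝ≥0} {s : Store}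

open Classical in
/-- The number `v`, reset to zero unless `Q` holds. -/
noncomputable def keepIf (Q : Prop) (v : ℕ) : ℕ := if Q then v else 0

theorem keepIf_pos {Q : Prop} (h : Q) (v : ℕ) : keepIf Q v = v := if_pos h

theorem keepIf_neg {Q : Prop} (h : ¬ Q) (v : ℕ) : keepIf Q v = 0 := if_neg h

/-- A loop whose body resets a flag for every index outside `Q`. -/
theorem check_loop {i N c : ℕ} {p : Cmd} {s : Store} (Q : ℕ → Prop)
    (hc : c ≠ i) (hbody : ∀ m < s.var N, ∀ s', Agree (loop i N p) s s' → s'.var i = m →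
      (eval D p s').var c = keepIf (Q m) (s'.var c)) :
    (eval D (loop i N p) s).var c = keepIf (∀ m < s.var N, Q m) (s.var c) := by
  have := loop_induction' (D := D) (i := i) (N := N) (p := p) (s := s)
    (P := fun m s' => s'.var c = keepIf (∀ l < s.var N, m ≤ l → Q l) (s.var c))
    (fun m s' v h => by simpa [hc] using h)
    (by rw [keepIf_pos]; intro l h1 h2; omega) fun m hm s' ha hi h => by
      rw [hbody m hm s' ha hi, h]
      by_cases hQ : Q m
      · rw [keepIf_pos hQ]
        congr 1
        refine propext ⟨fun h' l hl hml => ?_, fun h' l hl hml => h' l hl (by omega)⟩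
        rcases hml.eq_or_lt with rfl | hlt
        · exact hQ
        · exact h' l hl hlt
      · rw [keepIf_neg hQ, keepIf_neg fun h' => hQ (h' m hm le_rfl)]
  simpa using this

/-- Give the client in variable `44` an admissible label, if there is one. -/
def chooseLabel : Cmd :=
  loop 43 1 (load 53 9 43 ;; ite (.distLe 44 53 14 15) (store 10 44 43) skip)

/-- Give all clients of the group admissible labels. -/
def chooseLabels : Cmd := loop 44 0 (ifMember chooseLabel)

theorem chooseLabel_spec (h : G.Holds s) (hex : ∃ j < G.k, G.Adm D (s.var 44) j) :
    let s' := eval D chooseLabel s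
    (∀ x ≠ s.var 44, s'.arr 10 x = s.arr 10 x) ∧
      s'.arr 10 (s.var 44) < G.k ∧ G.Adm D (s.var 44) (s'.arr 10 (s.var 44)) := by
  have := loop_induction' (D := D) (i := 43) (N := 1) (s := s)
    (p := load 53 9 43 ;; ite (.distLe 44 53 14 15) (store 10 44 43) skip)
    (P := fun m σ => (∀ x ≠ s.var 44, σ.arr 10 x = s.arr 10 x) ∧
      ((∃ j < G.k, m ≤ j ∧ G.Adm D (s.var 44) j) →
        σ.arr 10 (s.var 44) < G.k ∧ G.Adm D (s.var 44) (σ.arr 10 (s.var 44))))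
    (fun _ _ _ h => h)
    ⟨fun _ _ => rfl, fun ⟨j, h1, h2, _⟩ => by rw [h.hk] at h2; omega⟩ ?_
  · obtain ⟨j, hj, hA⟩ := hex
    exact ⟨this.1, this.2 ⟨j, hj, Nat.zero_le _, hA⟩⟩
  · rintro m hm σ ha hi ⟨k1, k2⟩
    have hσ : G.Holds σ := h.agree rfl ha
    have e44 : σ.var 44 = s.var 44 := ha.1 44 rfl
    rw [h.hk] at hm
    by_cases hA : G.Adm D (s.var 44) m
    · have hA' := hA
      simp only [GroupData.Adm] at hA'
      have e : (eval D (load 53 9 43 ;; ite (.distLe 44 53 14 15) (store 10 44 43) skip) σ).arr 10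
          = Function.update (σ.arr 10) (s.var 44) m := by
        simp [hi, hσ.hF, hσ.hu, hσ.hv, e44, hA']
      rw [e]
      refine ⟨fun x hx => by rw [Function.update_of_ne hx, k1 x hx], fun _ => ?_⟩
      simpa using ⟨hm, hA⟩
    · have hA' := hA
      simp only [GroupData.Adm] at hA'
      have e : (eval D (load 53 9 43 ;; ite (.distLe 44 53 14 15) (store 10 44 43) skip) σ).arr 10
          = σ.arr 10 := by
        simp [hi, hσ.hF, hσ.hu, hσ.hv, e44, hA']
      rw [e]
      refine ⟨k1, fun ⟨j, hj, hmj, hAj⟩ => k2 ⟨j, hj, ?_, hAj⟩⟩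
      rcases hmj.eq_or_lt with rfl | hlt
      · exact absurd hAj hA
      · exact hlt

theorem chooseLabels_spec (h : G.Holds s) (hex : ∀ x ∈ G.X, ∃ j < G.k, G.Adm D x j) :
    let s' := eval D chooseLabels s
    (∀ x ∉ G.X, s'.arr 10 x = s.arr 10 x) ∧ Assigned G.X G.k (G.Adm D) (s'.arr 10) := by
  have := loop_induction' (D := D) (i := 44) (N := 0) (s := s) (p := ifMember chooseLabel)
    (P := fun m σ => (∀ x ∉ G.X, σ.arr 10 x = s.arr 10 x) ∧
      ∀ x ∈ G.X, m ≤ x → σ.arr 10 x < G.k ∧ G.Adm D x (σ.arr 10 x))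
    (fun _ _ _ h => h) ⟨fun _ _ => rfl, fun x hx hx' => ?_⟩ ?_
  · exact ⟨this.1, fun x hx => this.2 x hx (Nat.zero_le _)⟩
  · have := (GroupData.mem_X.1 hx).1
    rw [h.hn] at hx'
    omega
  · rintro m hm σ ha hi ⟨k1, k2⟩
    have hσ : G.Holds σ := h.agree rfl ha
    rw [h.hn] at hm
    by_cases hmX : m ∈ G.X
    · set τ := eval D (load 50 0 44 ;; load 51 14 44) σ with hτ
      have hτG : G.Holds τ := hσ.eval rfl
      have τ44 : τ.var 44 = m := (eval_var (p := load 50 0 44 ;; load 51 14 44)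
        (s := σ) rfl).trans hi
      have hrun : eval D (ifMember chooseLabel) σ = eval D chooseLabel τ := by
        have := GroupData.mem_X.1 hmX
        simp [ifMember, hi, hσ.hc, hσ.one, hσ.hkey, hσ.hg, this, hτ]
      have τ10 : τ.arr 10 = σ.arr 10 := rfl
      have := chooseLabel_spec (D := D) hτG (by rw [τ44]; exact hex m hmX)
      rw [τ44, τ10] at this
      rw [hrun]
      refine ⟨fun x hx => ?_, fun x hx hmx => ?_⟩
      · rw [this.1 x (by rintro rfl; exact hx hmX), k1 x hx]
      · by_cases hxm : x = m
        · rw [hxm]; exact this.2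
        · rw [this.1 x hxm]
          exact k2 x hx (by omega)
    · have e : (eval D (ifMember chooseLabel) σ).arr 10 = σ.arr 10 := by
        rw [GroupData.mem_X] at hmX
        simp only [ifMember, eval_seq, eval_load, eval_ite_le, eval_ifEq, Store.setVar_var,
          Store.setVar_arr, hi, hσ.hc, hσ.one, hσ.hkey, hσ.hg, eval_skip, ↓reduceIte,
          Nat.reduceEqDiff]
        split_ifs with h1 h2
        · exact absurd ⟨hm, h1, h2⟩ hmX
        all_goals rfl
      rw [e]
      refine ⟨k1, fun x hx hmx => k2 x hx ?_⟩
      have : x ≠ m := by rintro rfl; exact hmX hx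
      omega

/-- Load the bounds for the current group. -/
def loadBounds (lo hi : Bound) : Cmd :=
  loop 43 1 (lo.cmd ;; store 11 43 48 ;; hi.cmd ;; store 12 43 48)

theorem writesVar_loadBounds (lo hi : Bound) (x : ℕ) :
    (loadBounds lo hi).writesVar x = (x == 43 || x == 48) := by
  simp [loadBounds, writesVar, Bound.writesVar_cmd]

theorem writesArr_loadBounds (lo hi : Bound) (A : ℕ) :
    (loadBounds lo hi).writesArr A = (A == 11 || A == 12) := by
  simp [loadBounds, writesArr, Bound.writesArr_cmd]

theorem loadBounds_spec (lo hi : Bound) :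
    let s' := eval D (loadBounds lo hi) s
    ∀ i < s.var 1, s'.arr 11 i = lo.val (s.var 0) (s.arr 2) (s.arr 3) (s.var 42) i ∧
      s'.arr 12 i = hi.val (s.var 0) (s.arr 2) (s.arr 3) (s.var 42) i := by
  intro s' i hi'
  have hframe : ∀ σ, Agree (loadBounds lo hi) s σ → σ.var 0 = s.var 0 ∧ σ.var 42 = s.var 42 ∧
      σ.arr 2 = s.arr 2 ∧ σ.arr 3 = s.arr 3 := fun σ ha =>
    ⟨ha.1 0 (by rw [writesVar_loadBounds]; rfl), ha.1 42 (by rw [writesVar_loadBounds]; rfl),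
      ha.2 2 (by rw [writesArr_loadBounds]; rfl), ha.2 3 (by rw [writesArr_loadBounds]; rfl)⟩
  refine ⟨fill_loop (fun i => lo.val (s.var 0) (s.arr 2) (s.arr 3) (s.var 42) i) ?_ i hi',
    fill_loop (fun i => hi.val (s.var 0) (s.arr 2) (s.arr 3) (s.var 42) i) ?_ i hi'⟩
  all_goals
    intro m hm σ ha hi _
    obtain ⟨h0, h42, h2, h3⟩ := hframe σ ha
    simp [Bound.eval_cmd, hi, h0, h42, h2, h3]

end Cmd

namespace Cmd

variable {G : GroupData} {D : ℕ → ℕ → ℝ≥0} {s : Store}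

/-- Find labels for the group of the point in variable `41`. -/
def solveGroup (lo hi : Bound) : Cmd :=
  load 42 14 41 ;; loadBounds lo hi ;; chooseLabels ;; pullPhase ;; pushPhase

/-- Copy the keys of the points. -/
def loadKeys (K : ℕ) : Cmd := loop 44 0 (load 50 K 44 ;; store 14 44 50)

/-- Check the bounds for the group of the point in variable `41`. -/
def checkGroup (lo hi : Bound) : Cmd :=
  load 42 14 41 ;; loadBounds lo hi ;; loop 43 1 (countLabel ;; load 55 11 43 ;;
    ite (.le 55 46) skip (const 40 0) ;; load 55 12 43 ;; ite (.le 46 55) skip (const 40 0))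

/-- Check that all clients have admissible labels. -/
def checkLabels : Cmd :=
  loop 44 0 (load 50 0 44 ;; ite (.le 4 50) (load 52 10 44 ;; ite (.le 1 52) (const 40 0)
    (load 53 9 52 ;; ite (.distLe 44 53 14 15) skip (const 40 0))) skip)

/-- Set variable `40` to one and write a feasible assignment to array `10`, if there is one;
otherwise set variable `40` to zero. -/
def assign (K : ℕ) (lo hi : Bound) : Cmd :=
  loadKeys K ;; loop 41 0 (solveGroup lo hi) ;; const 40 1 ;; loop 41 0 (checkGroup lo hi) ;;
    checkLabels

theorem keeps_loadBounds (lo hi : Bound) : GroupData.keeps (loadBounds lo hi) = true := by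
  cases lo <;> cases hi <;> rfl

theorem keepsBase_solveGroup (lo hi : Bound) :
    GroupData.keepsBase (loop 41 0 (solveGroup lo hi)) = true := by
  cases lo <;> cases hi <;> rfl

theorem keepsBase_checkGroup (lo hi : Bound) :
    GroupData.keepsBase (loop 41 0 (checkGroup lo hi)) = true := by
  cases lo <;> cases hi <;> rfl

/-- The reference assignment `O'` only certifies that the cut arguments cannot apply. Pulling comes
first so that the lower bounds are available as part of the invariant of the push phase. -/
theorem solveGroup_spec {lo hi : Bound} {O' : ℕ → ℕ} (h : G.HoldsBase s)
    (hR : G.k * (G.k * (G.n + 1)) ≤ G.R) (hk : 0 < G.k) {g : ℕ} (hg : G.key (s.var 41) = g)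
    (hO' : Assigned (G.withKey g).X G.k (G.Adm D) O')
    (hb : ∀ i < G.k, lo.val G.n (s.arr 2) (s.arr 3) g i ≤ labelCount (G.withKey g).X O' i ∧
      labelCount (G.withKey g).X O' i ≤ hi.val G.n (s.arr 2) (s.arr 3) g i) :
    let s' := eval D (solveGroup lo hi) s
    (∀ x ∉ (G.withKey g).X, s'.arr 10 x = s.arr 10 x) ∧
      ∀ i < G.k, lo.val G.n (s.arr 2) (s.arr 3) g i ≤
          labelCount (G.withKey g).X (s'.arr 10) i ∧
        labelCount (G.withKey g).X (s'.arr 10) i ≤ hi.val G.n (s.arr 2) (s.arr 3) g i ∧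
        Assigned (G.withKey g).X G.k (G.Adm D) (s'.arr 10) := by
  intro s'
  set s₁ := eval D (load 42 14 41) s with hs₁
  have h1 : (G.withKey g).Holds s₁ :=
    GroupData.HoldsBase.withKey (h.eval rfl) (by simp [h.hkey, hg])
  set s₂ := eval D (loadBounds lo hi) s₁ with hs₂
  have h2 : (G.withKey g).Holds s₂ := h1.eval (keeps_loadBounds lo hi)
  set s₃ := eval D chooseLabels s₂ with hs₃
  have h3 : (G.withKey g).Holds s₃ := h2.eval rfl
  set s₄ := eval D pullPhase s₃ with hs₄
  have h4 : (G.withKey g).Holds s₄ := h3.eval rfl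
  have e : s' = eval D pushPhase s₄ := rfl
  have b : ∀ i < G.k, s₂.arr 11 i = lo.val G.n (s.arr 2) (s.arr 3) g i ∧
      s₂.arr 12 i = hi.val G.n (s.arr 2) (s.arr 3) g i := by
    have b := loadBounds_spec (D := D) (s := s₁) lo hi
    rw [h1.hk, h1.hn, h1.hg] at b
    exact b
  have e2 : s₂.arr 10 = s.arr 10 := eval_arr (by rw [writesArr_loadBounds]; rfl)
  have e311 : s₃.arr 11 = s₂.arr 11 := eval_arr rfl
  have e412 : s₄.arr 12 = s₂.arr 12 := (eval_arr rfl).trans (eval_arr rfl)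
  obtain ⟨c1, c2⟩ := chooseLabels_spec (D := D) h2 fun x hx => ⟨O' x, hO' x hx⟩
  obtain ⟨d1, d2, d3⟩ := pullPhase_spec (D := D) h3 hR hk e311 c2 hO'
    fun j hj => (b j hj).1.trans_le (hb j hj).1
  obtain ⟨f1, f2, f3⟩ := pushPhase_spec (D := D) h4 hR e412 d2 d3 hO'
    (fun j hj => (b j hj).1.trans_le (hb j hj).1) fun j hj => (hb j hj).2.trans_eq (b j hj).2.symm
  refine ⟨fun x hx => ?_, fun i hi => ?_⟩
  · rw [e, f1 x hx, d1 x hx, c1 x hx, e2]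
  · rw [e, ← (b i hi).1, ← (b i hi).2]
    exact ⟨(f3 i hi).1, (f3 i hi).2, f2⟩

/-- Solving all groups finds labels if there are any. -/
theorem solveGroups_spec {lo hi : Bound} {O' : ℕ → ℕ} (h : G.HoldsBase s)
    (hR : G.k * (G.k * (G.n + 1)) ≤ G.R) (hk : 0 < G.k) (hO' : G.AllAssigned D O')
    (hb : G.Balanced (fun g i => lo.val G.n (s.arr 2) (s.arr 3) g i)
      (fun g i => hi.val G.n (s.arr 2) (s.arr 3) g i) O') :
    let s' := eval D (loop 41 0 (solveGroup lo hi)) s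
    G.Balanced (fun g i => lo.val G.n (s.arr 2) (s.arr 3) g i)
      (fun g i => hi.val G.n (s.arr 2) (s.arr 3) g i) (s'.arr 10) ∧
      G.AllAssigned D (s'.arr 10) := by
  intro s'
  set Fine : ℕ → (ℕ → ℕ) → Prop := fun g O => ∀ i < G.k,
    lo.val G.n (s.arr 2) (s.arr 3) g i ≤ labelCount (G.withKey g).X O i ∧
    labelCount (G.withKey g).X O i ≤ hi.val G.n (s.arr 2) (s.arr 3) g i ∧
    Assigned (G.withKey g).X G.k (G.Adm D) O with hFine
  have key := loop_induction' (D := D) (i := 41) (N := 0) (s := s) (p := solveGroup lo hi)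
    (P := fun m σ => ∀ y < G.n, m ≤ y → Fine (G.key y) (σ.arr 10)) (fun _ _ _ h => h)
    (fun y hy hmy => by rw [h.hn] at hmy; omega) ?_
  · refine ⟨fun y hy i hi => ?_, fun x hx hcx => ?_⟩
    · exact ⟨(key y hy (Nat.zero_le _) i hi).1, (key y hy (Nat.zero_le _) i hi).2.1⟩
    · exact (key x hx (Nat.zero_le _) 0 hk).2.2 x (GroupData.mem_X.2 ⟨hx, hcx, rfl⟩)
  · intro m hm σ ha hi' ih
    rw [h.hn] at hm
    have hσ : G.HoldsBase σ := h.agree (keepsBase_solveGroup lo hi) ha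
    have a2 : σ.arr 2 = s.arr 2 := ha.2 2 (by cases lo <;> cases hi <;> rfl)
    have a3 : σ.arr 3 = s.arr 3 := ha.2 3 (by cases lo <;> cases hi <;> rfl)
    have := solveGroup_spec (D := D) (lo := lo) (hi := hi) hσ hR hk (g := G.key m)
      (by rw [hi']) (hO'.assigned _) (by rw [a2, a3]; exact hb m hm)
    rw [a2, a3] at this
    intro y hy hmy
    -- A group is visited once for each point with its key. The current visit establishes the bounds
    -- for its own group, and the other groups are disjoint from it and keep their labels.
    by_cases hky : G.key y = G.key m
    · rw [hky]
      exact this.2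
    · have hlt : m + 1 ≤ y := by
        have : y ≠ m := by rintro rfl; exact hky rfl
        omega
      have hsame : ∀ x ∈ (G.withKey (G.key y)).X,
          (eval D (solveGroup lo hi) σ).arr 10 x = σ.arr 10 x := fun x hx =>
        this.1 x fun hx' => hky ((GroupData.mem_X.1 hx).2.2.symm.trans (GroupData.mem_X.1 hx').2.2)
      intro i hi
      obtain ⟨i1, i2, i3⟩ := ih y hy hlt i hi
      rw [labelCount_congr hsame]
      exact ⟨i1, i2, fun x hx => by rw [hsame x hx]; exact i3 x hx⟩

theorem checkGroup_spec {lo hi : Bound} (h : G.HoldsBase s) {g : ℕ}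
    (hg : G.key (s.var 41) = g) :
    (eval D (checkGroup lo hi) s).var 40 = keepIf (∀ i < G.k,
      lo.val G.n (s.arr 2) (s.arr 3) g i ≤ labelCount (G.withKey g).X (s.arr 10) i ∧
      labelCount (G.withKey g).X (s.arr 10) i ≤ hi.val G.n (s.arr 2) (s.arr 3) g i)
      (s.var 40) := by
  set s₁ := eval D (load 42 14 41) s with hs₁
  have h1 : (G.withKey g).Holds s₁ :=
    GroupData.HoldsBase.withKey (h.eval rfl) (by simp [h.hkey, hg])
  set s₂ := eval D (loadBounds lo hi) s₁ with hs₂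
  have h2 : (G.withKey g).Holds s₂ := h1.eval (keeps_loadBounds lo hi)
  have b : ∀ i < G.k, s₂.arr 11 i = lo.val G.n (s.arr 2) (s.arr 3) g i ∧
      s₂.arr 12 i = hi.val G.n (s.arr 2) (s.arr 3) g i := by
    have b := loadBounds_spec (D := D) (s := s₁) lo hi
    rw [h1.hk, h1.hn, h1.hg] at b
    exact b
  have e10 : s₂.arr 10 = s.arr 10 := eval_arr (by rw [writesArr_loadBounds]; rfl)
  have e40 : s₂.var 40 = s.var 40 := eval_var (by rw [writesVar_loadBounds]; rfl)
  rw [← e40, checkGroup, eval_seq, eval_seq, ← hs₁, ← hs₂, check_loop (D := D) (fun i =>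
      lo.val G.n (s.arr 2) (s.arr 3) g i ≤ labelCount (G.withKey g).X (s.arr 10) i ∧
      labelCount (G.withKey g).X (s.arr 10) i ≤ hi.val G.n (s.arr 2) (s.arr 3) g i)
      (by decide), h2.hk]
  · rfl
  · intro m hm σ ha hi'
    have hσ : (G.withKey g).Holds σ := h2.agree rfl ha
    rw [h2.hk] at hm
    have hc := eval_countLabel (D := D) hσ
    have f10 : σ.arr 10 = s.arr 10 := (ha.2 10 rfl).trans e10
    have f11 : (eval D countLabel σ).arr 11 = s₂.arr 11 := (eval_arr rfl).trans (ha.2 11 rfl)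
    have f12 : (eval D countLabel σ).arr 12 = s₂.arr 12 := (eval_arr rfl).trans (ha.2 12 rfl)
    have f43 : (eval D countLabel σ).var 43 = m := (eval_var rfl).trans hi'
    have f40 : (eval D countLabel σ).var 40 = σ.var 40 := eval_var rfl
    rw [hi', f10] at hc
    rw [← (b m hm).1, ← (b m hm).2]
    by_cases q1 : s₂.arr 11 m ≤ labelCount (G.withKey g).X (s.arr 10) m <;>
    by_cases q2 : labelCount (G.withKey g).X (s.arr 10) m ≤ s₂.arr 12 m <;>
      simp [keepIf, hc, f11, f12, f43, f40, q1, q2]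

theorem checkLabels_spec (h : G.HoldsBase s) : (eval D checkLabels s).var 40 =
    keepIf (G.AllAssigned D (s.arr 10)) (s.var 40) := by
  rw [checkLabels, check_loop (D := D) (fun x => 1 ≤ G.c x → s.arr 10 x < G.k ∧
    G.Adm D x (s.arr 10 x)) (by decide), h.hn]
  · rfl
  · intro m hm σ ha hi
    have hσ : G.HoldsBase σ := h.agree rfl ha
    have e10 : σ.arr 10 = s.arr 10 := ha.2 10 rfl
    by_cases q1 : 1 ≤ G.c m
    · by_cases q2 : s.arr 10 m < G.k
      · by_cases q3 : D m (G.F (s.arr 10 m)) ≤ D G.u G.v <;>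
        simp [keepIf, GroupData.Adm, hi, hσ.hc, hσ.one, hσ.hk, hσ.hF, hσ.hu, hσ.hv, e10, q1, q2, q3,
          q2.not_ge]
      · simp [keepIf, hi, hσ.hc, hσ.one, hσ.hk, e10, q1, q2, not_lt.1 q2]
    · simp [keepIf, hi, hσ.hc, hσ.one, q1]

/-- The flag reflects the contents of array `10`, however they arose, so the solver need not be
sound on infeasible inputs. -/
theorem checks_spec {lo hi : Bound} (h : G.HoldsBase s) (h40 : s.var 40 = 1) :
    (eval D (loop 41 0 (checkGroup lo hi) ;; checkLabels) s).var 40 =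
      keepIf (G.Balanced (fun g i => lo.val G.n (s.arr 2) (s.arr 3) g i)
        (fun g i => hi.val G.n (s.arr 2) (s.arr 3) g i) (s.arr 10) ∧
        G.AllAssigned D (s.arr 10)) 1 := by
  set s₁ := eval D (loop 41 0 (checkGroup lo hi)) s with hs₁
  have h1 : G.HoldsBase s₁ := h.eval (keepsBase_checkGroup lo hi)
  have e10 : s₁.arr 10 = s.arr 10 := eval_arr (by cases lo <;> cases hi <;> rfl)
  have e40 : s₁.var 40 = keepIf (G.Balanced (fun g i => lo.val G.n (s.arr 2) (s.arr 3) g i)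
        (fun g i => hi.val G.n (s.arr 2) (s.arr 3) g i) (s.arr 10)) 1 := by
    rw [hs₁, check_loop (D := D) (fun y => ∀ i < G.k,
      lo.val G.n (s.arr 2) (s.arr 3) (G.key y) i ≤
        labelCount (G.withKey (G.key y)).X (s.arr 10) i ∧
      labelCount (G.withKey (G.key y)).X (s.arr 10) i ≤
        hi.val G.n (s.arr 2) (s.arr 3) (G.key y) i) (by decide), h.hn, h40]
    · rfl
    · intro m hm σ ha hi'
      have hσ : G.HoldsBase σ := h.agree (keepsBase_checkGroup lo hi) ha
      have a2 : σ.arr 2 = s.arr 2 := ha.2 2 (by cases lo <;> cases hi <;> rfl)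
      have a3 : σ.arr 3 = s.arr 3 := ha.2 3 (by cases lo <;> cases hi <;> rfl)
      have a10 : σ.arr 10 = s.arr 10 := ha.2 10 (by cases lo <;> cases hi <;> rfl)
      rw [checkGroup_spec hσ (g := G.key m) (by rw [hi']), a2, a3, a10]
  rw [eval_seq, checkLabels_spec h1, e10, e40]
  by_cases q1 : G.AllAssigned D (s.arr 10) <;>
  by_cases q2 : G.Balanced (fun g i => lo.val G.n (s.arr 2) (s.arr 3) g i)
    (fun g i => hi.val G.n (s.arr 2) (s.arr 3) g i) (s.arr 10) <;>
  simp [keepIf, q1, q2]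

theorem loadKeys_spec {K : ℕ} (hK : K ≠ 14) :
    ∀ x < s.var 0, (eval D (loadKeys K) s).arr 14 x = s.arr K x := by
  refine fill_loop (fun x => s.arr K x) fun m hm σ ha hi _ => ?_
  have e : σ.arr K = s.arr K := ha.2 K (by simp [writesArr, hK])
  simp [hi, e]

end Cmd

namespace GroupData

variable {G G' : GroupData}

/-- Needed because `loadKeys` copies only the keys of actual points, so the key arrays may differ
from index `n` on. -/
theorem Balanced.congr_key {lo hi : ℕ → ℕ → ℕ} {O : ℕ → ℕ} (hn : G.n = G'.n) (hk : G.k = G'.k)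
    (hc : G.c = G'.c) (hkey : ∀ x < G.n, G.key x = G'.key x) (h : G.Balanced lo hi O) :
    G'.Balanced lo hi O := by
  intro y hy i hi'
  have hX : ∀ g, (G.withKey g).X = (G'.withKey g).X := fun g => by
    ext x
    simp only [mem_X, withKey, hn, hc]
    refine and_congr_right fun hx => ?_
    rw [hkey x (hn ▸ hx)]
  rw [← hn] at hy
  rw [← hk] at hi'
  have := h y hy i hi'
  rwa [hX, hkey y hy] at this

end GroupData

/-- Success is sound by the final checks, and failure is sound because the solver succeeds whenever
some `O` exists. The hypothesis on `s` uses the current contents of array `14` as keys, since the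
real keys have not been copied yet. -/
theorem Cmd.assign_spec {G : GroupData} {D : ℕ → ℕ → ℝ≥0} {s : Store} {K : ℕ} {lo hi : Bound}
    (hK : K < 10) (hkey : G.key = s.arr K) (h : ({G with key := s.arr 14} : GroupData).HoldsBase s)
    (hR : G.k * (G.k * (G.n + 1)) ≤ G.R) (hk : 0 < G.k) :
    let lo' := fun g i => lo.val G.n (s.arr 2) (s.arr 3) g i
    let hi' := fun g i => hi.val G.n (s.arr 2) (s.arr 3) g i
    let s' := eval D (assign K lo hi) s
    (s'.var 40 = 1 ∧ G.Balanced lo' hi' (s'.arr 10) ∧ G.AllAssigned D (s'.arr 10)) ∨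
      (s'.var 40 = 0 ∧ ∀ O, ¬ (G.Balanced lo' hi' O ∧ G.AllAssigned D O)) := by
  intro lo' hi' s'
  set s₁ := eval D (loadKeys K) s with hs₁
  have hk1 := loadKeys_spec (D := D) (s := s) (K := K) (by omega)
  rw [h.hn, ← hs₁] at hk1
  set G' : GroupData := {G with key := s₁.arr 14} with hG'
  have h1 : G'.HoldsBase s₁ := by
    have v : ∀ x, x ≠ 44 → x ≠ 50 → s₁.var x = s.var x := fun x h1 h2 =>
      eval_var (by simp [loadKeys, writesVar, h1, h2])
    have a : ∀ A, A ≠ 14 → s₁.arr A = s.arr A := fun A h1 =>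
      eval_arr (by simp [loadKeys, writesArr, h1])
    exact ⟨(v 0 (by decide) (by decide)).trans h.hn, (v 1 (by decide) (by decide)).trans h.hk,
      (v 4 (by decide) (by decide)).trans h.one, (v 5 (by decide) (by decide)).trans h.zero,
      (v 9 (by decide) (by decide)).trans h.hR, (v 14 (by decide) (by decide)).trans h.hu,
      (v 15 (by decide) (by decide)).trans h.hv, (a 0 (by decide)).trans h.hc,
      (a 9 (by decide)).trans h.hF, rfl⟩
  have a2 : s₁.arr 2 = s.arr 2 := eval_arr rfl
  have a3 : s₁.arr 3 = s.arr 3 := eval_arr rfl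
  set s₂ := eval D (loop 41 0 (solveGroup lo hi)) s₁ with hs₂
  have h2 : G'.HoldsBase s₂ := h1.eval (keepsBase_solveGroup lo hi)
  have b2 : s₂.arr 2 = s.arr 2 := (eval_arr (by cases lo <;> cases hi <;> rfl)).trans a2
  have b3 : s₂.arr 3 = s.arr 3 := (eval_arr (by cases lo <;> cases hi <;> rfl)).trans a3
  set s₃ := eval D (const 40 1) s₂ with hs₃
  have h3 : G'.HoldsBase s₃ := h2.eval rfl
  have e : s' = eval D (loop 41 0 (checkGroup lo hi) ;; checkLabels) s₃ := rfl
  have e10 : s'.arr 10 = s₂.arr 10 := by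
    rw [e]
    exact eval_arr (p := loop 41 0 (checkGroup lo hi) ;; checkLabels)
      (by cases lo <;> cases hi <;> rfl)
  have c := checks_spec (D := D) (lo := lo) (hi := hi) h3 (by simp [hs₃])
  have d2 : s₃.arr 2 = s.arr 2 := b2
  have d3 : s₃.arr 3 = s.arr 3 := b3
  have d10 : s₃.arr 10 = s₂.arr 10 := rfl
  rw [← e, d2, d3, d10] at c
  have hiff : ∀ O, G.Balanced lo' hi' O ↔ G'.Balanced lo' hi' O := fun O =>
    ⟨GroupData.Balanced.congr_key (G := G) (G' := G') rfl rfl rfl fun x hx =>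
        (congrFun hkey x).trans (hk1 x hx).symm,
      GroupData.Balanced.congr_key (G := G') (G' := G) rfl rfl rfl fun x hx =>
        (hk1 x hx).trans (congrFun hkey x).symm⟩
  rw [e10]
  by_cases hgood : G'.Balanced lo' hi' (s₂.arr 10) ∧ G'.AllAssigned D (s₂.arr 10)
  · exact .inl ⟨c.trans (keepIf_pos hgood _), (hiff _).2 hgood.1, hgood.2⟩
  · refine .inr ⟨c.trans (keepIf_neg hgood _), fun O hO => hgood ?_⟩
    have := solveGroups_spec (D := D) (lo := lo) (hi := hi) (O' := O) h1 hR hk hO.2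
      (by rw [a2, a3]; exact (hiff O).1 hO.1)
    rw [a2, a3] at this
    exact this

/-! ### The main algorithm -/

namespace Cmd

/-- Mark all clients as uncovered. -/
def initUncovered : Cmd := loop 19 0 (load 23 0 19 ;; store 7 19 23)

/-- Count the uncovered points near the facility in variable `18`. -/
def countNear : Cmd :=
  const 20 0 ;; loop 19 0 (load 23 7 19 ;; ite (.le 4 23)
    (ite (.distLe 19 18 10 11) (add 20 20 4) skip) skip)

/-- Find a facility that covers as many uncovered points as possible. -/
def bestFacility : Cmd :=
  const 21 0 ;; loop 18 0 (load 24 1 18 ;; ite (.le 4 24)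
    (countNear ;; ite (.le 21 20) (copy 21 20 ;; copy 22 18) skip) skip)

/-- Mark the points near the facility in variable `22` as covered. -/
def markCovered : Cmd := loop 19 0 (ite (.distLe 19 22 10 11) (store 7 19 5) skip)

/-- Greedy set cover by balls whose radius is the distance of the points in variables `10` and
`11`; the chosen facilities are written to array `8`. -/
def greedy : Cmd := initUncovered ;; loop 17 7 (bestFacility ;; store 8 17 22 ;; markCovered)

/-- Divide variable `26` by variable `7`, with quotient in variable `27`. -/
def divide : Cmd :=
  const 27 0 ;; loop 28 8 (ite (.le 7 26) (sub 26 26 7 ;; add 27 27 4) skip)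

/-- Write the tuple of facilities with the number in variable `16` to array `9`. -/
def decode : Cmd :=
  copy 26 16 ;; loop 25 1 (divide ;; load 24 8 26 ;; store 9 25 24 ;; copy 26 27)

end Cmd

/-! ### Greedy covering and enumeration of tuples -/

/-- The number of points near `f` that are uncovered according to `U`. -/
noncomputable def nearCount (n : ℕ) (D : ℕ → ℕ → ℝ≥0) (ρ : ℝ≥0) (U : ℕ → ℕ) (f : ℕ) : ℕ :=
  ((Finset.range n).filter fun x => 1 ≤ U x ∧ D x f ≤ ρ).card

/-- The number of uncovered points. -/
def uncoveredCount (n : ℕ) (U : ℕ → ℕ) : ℕ := ((Finset.range n).filter fun x => 1 ≤ U x).card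

/-- The parameters of the covering subroutine: numbers of points and of centers, number of greedy
steps, the two points whose distance is the radius, and the indicators of clients and facilities. -/
structure CoverData where
  n : ℕ
  k : ℕ
  m : ℕ
  a : ℕ
  b : ℕ
  c : ℕ → ℕ
  l : ℕ → ℕ

namespace CoverData

/-- The store contains the given parameters. -/
structure Holds (C : CoverData) (s : Store) : Prop where
  hn : s.var 0 = C.n
  hk : s.var 1 = C.k
  one : s.var 4 = 1
  zero : s.var 5 = 0
  hm : s.var 7 = C.m
  hM : s.var 8 = C.m ^ C.k
  ha : s.var 10 = C.a
  hb : s.var 11 = C.b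
  hc : s.arr 0 = C.c
  hl : s.arr 1 = C.l

variable {C : CoverData} {D : ℕ → ℕ → ℝ≥0} {s s' : Store}

/-- The program does not write the parameters. -/
def keeps (p : Cmd) : Bool :=
  [0, 1, 4, 5, 7, 8, 10, 11].all (fun x => !p.writesVar x) &&
    [0, 1].all fun A => !p.writesArr A

theorem Holds.agree {p : Cmd} (h : C.Holds s) (hp : keeps p = true) (ha : p.Agree s s') :
    C.Holds s' := by
  simp only [keeps, List.all_cons, List.all_nil, Bool.and_true, Bool.and_eq_true,
    Bool.not_eq_true'] at hp
  obtain ⟨⟨h0, h1, h4, h5, h7, h8, h10, h11⟩, ha0, ha1⟩ := hp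
  exact ⟨(ha.1 _ h0).trans h.hn, (ha.1 _ h1).trans h.hk, (ha.1 _ h4).trans h.one,
    (ha.1 _ h5).trans h.zero, (ha.1 _ h7).trans h.hm, (ha.1 _ h8).trans h.hM,
    (ha.1 _ h10).trans h.ha, (ha.1 _ h11).trans h.hb, (ha.2 _ ha0).trans h.hc,
    (ha.2 _ ha1).trans h.hl⟩

theorem Holds.eval {p : Cmd} (h : C.Holds s) (hp : keeps p = true) : C.Holds (p.eval D s) :=
  h.agree hp (Cmd.eval_frame p s)

/-- All clients are within the given radius of one of `k` facilities. -/
def Coverable (C : CoverData) (D : ℕ → ℕ → ℝ≥0) : Prop :=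
  ∃ F : ℕ → ℕ, (∀ i < C.k, F i < C.n ∧ 1 ≤ C.l (F i)) ∧
    ∀ x < C.n, 1 ≤ C.c x → ∃ i < C.k, D x (F i) ≤ D C.a C.b

end CoverData

/-- The `k` balls of a cover contain all uncovered points, and none contains more of them than the
best ball. -/
theorem uncoveredCount_le_mul_nearCount {C : CoverData} {D : ℕ → ℕ → ℝ≥0} {U : ℕ → ℕ} {f : ℕ}
    (hcov : C.Coverable D) (hU : ∀ x < C.n, 1 ≤ U x → 1 ≤ C.c x)
    (hf : ∀ f' < C.n, 1 ≤ C.l f' →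
      nearCount C.n D (D C.a C.b) U f' ≤ nearCount C.n D (D C.a C.b) U f) :
    uncoveredCount C.n U ≤ C.k * nearCount C.n D (D C.a C.b) U f := by
  obtain ⟨F, hF, hFcov⟩ := hcov
  calc uncoveredCount C.n U
      ≤ ((Finset.range C.k).biUnion fun i =>
          (Finset.range C.n).filter fun x => 1 ≤ U x ∧ D x (F i) ≤ D C.a C.b).card := by
        refine Finset.card_le_card fun x hx => ?_
        simp only [Finset.mem_filter, Finset.mem_range] at hx
        obtain ⟨i, hi, hd⟩ := hFcov x hx.1 (hU x hx.1 hx.2)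
        simp only [Finset.mem_biUnion, Finset.mem_filter, Finset.mem_range]
        exact ⟨i, hi, hx.1, hx.2, hd⟩
    _ ≤ ∑ i ∈ Finset.range C.k, nearCount C.n D (D C.a C.b) U (F i) := Finset.card_biUnion_le
    _ ≤ C.k * nearCount C.n D (D C.a C.b) U f := by
        have := Finset.sum_le_card_nsmul (Finset.range C.k)
          (fun i => nearCount C.n D (D C.a C.b) U (F i)) _ fun i hi =>
            hf (F i) (hF i (Finset.mem_range.1 hi)).1 (hF i (Finset.mem_range.1 hi)).2
        simpa using this

/-- For positive `m` this is `(1 + 1/m)^(m+1) ≥ 2`; `key` is Bernoulli's inequality with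
denominators cleared. -/
theorem two_mul_pow_le_succ_pow (m : ℕ) : 2 * m ^ (m + 1) ≤ (m + 1) ^ (m + 1) := by
  have key : ∀ j, m ^ j * (m + j) ≤ m * (m + 1) ^ j := by
    intro j
    induction j with
    | zero => simp
    | succ j ih =>
      calc m ^ (j + 1) * (m + (j + 1)) ≤ m ^ j * (m + j) * (m + 1) := by
            rw [pow_succ, mul_assoc, mul_assoc]
            exact Nat.mul_le_mul_left _ (by nlinarith)
        _ ≤ m * (m + 1) ^ j * (m + 1) := Nat.mul_le_mul_right _ ih
        _ = m * (m + 1) ^ (j + 1) := by ring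
  rcases Nat.eq_zero_or_pos m with rfl | hm
  · simp
  · refine Nat.le_of_mul_le_mul_left ((Eq.le ?_).trans
      ((Nat.mul_le_mul_left (m ^ (m + 1)) (show 2 * m ≤ m + (m + 1) by omega)).trans
        (key (m + 1)))) hm
    ring

/-- Every block of `k` steps halves the bound; `lg` halvings of `n < 2 ^ lg` leave less than one
point. -/
theorem eq_zero_of_greedy_bound {n k lg u : ℕ} (hk : 0 < k) (hn : n < 2 ^ lg)
    (h : k ^ (k * lg) * u ≤ (k - 1) ^ (k * lg) * n) : u = 0 := by
  obtain ⟨m, rfl⟩ : ∃ m, k = m + 1 := ⟨k - 1, by omega⟩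
  have h1 : 2 ^ lg * m ^ ((m + 1) * lg) ≤ (m + 1) ^ ((m + 1) * lg) := by
    rw [pow_mul, pow_mul, ← mul_pow]
    exact Nat.pow_le_pow_left (two_mul_pow_le_succ_pow m) lg
  by_contra hu
  have hpos : 0 < (m + 1) ^ ((m + 1) * lg) := by positivity
  rw [Nat.add_sub_cancel] at h
  have h2 : 2 ^ lg * ((m + 1) ^ ((m + 1) * lg) * u) ≤ (m + 1) ^ ((m + 1) * lg) * n :=
    calc _ ≤ 2 ^ lg * (m ^ ((m + 1) * lg) * n) := Nat.mul_le_mul_left _ h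
      _ = 2 ^ lg * m ^ ((m + 1) * lg) * n := by ring
      _ ≤ _ := Nat.mul_le_mul_right _ h1
  have h3 : (m + 1) ^ ((m + 1) * lg) * (2 ^ lg * u) ≤ (m + 1) ^ ((m + 1) * lg) * n := by
    calc _ = _ := by ring
      _ ≤ _ := h2
  have h4 := Nat.le_of_mul_le_mul_left h3 hpos
  have h5 := Nat.mul_le_mul_left (2 ^ lg) (Nat.one_le_iff_ne_zero.2 hu)
  omega

namespace Cmd

variable {C : CoverData} {D : ℕ → ℕ → ℝ≥0} {s : Store}

theorem countNear_spec (h : C.Holds s) : (eval D countNear s).var 20 =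
    nearCount C.n D (D C.a C.b) (s.arr 7) (s.var 18) := by
  rw [countNear, eval_seq, count_loop (D := D)
    (fun x => 1 ≤ s.arr 7 x ∧ D x (s.var 18) ≤ D C.a C.b) (by decide)]
  · simp [h.hn, nearCount]
  · intro m hm σ ha hi
    have hσ : C.Holds σ := (h.eval (p := const 20 0) rfl).agree rfl ha
    have e7 : σ.arr 7 = s.arr 7 := ha.2 7 rfl
    have e18 : σ.var 18 = s.var 18 := ha.1 18 rfl
    by_cases q1 : 1 ≤ s.arr 7 m <;> by_cases q2 : D m (s.var 18) ≤ D C.a C.b <;>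
      simp [hi, hσ.one, hσ.ha, hσ.hb, e7, e18, q1, q2]

theorem bestFacility_spec (h : C.Holds s) (hex : ∃ f < C.n, 1 ≤ C.l f) :
    let f := (eval D bestFacility s).var 22
    f < C.n ∧ 1 ≤ C.l f ∧ ∀ f' < C.n, 1 ≤ C.l f' →
      nearCount C.n D (D C.a C.b) (s.arr 7) f' ≤ nearCount C.n D (D C.a C.b) (s.arr 7) f := by
  set N := nearCount C.n D (D C.a C.b) (s.arr 7) with hN
  have h1 : C.Holds (eval D (const 21 0) s) := h.eval rfl
  have := loop_induction' (D := D) (i := 18) (N := 0) (s := eval D (const 21 0) s)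
    (p := load 24 1 18 ;; ite (.le 4 24)
      (countNear ;; ite (.le 21 20) (copy 21 20 ;; copy 22 18) skip) skip)
    (P := fun m σ => (∀ f', m ≤ f' → f' < C.n → 1 ≤ C.l f' → N f' ≤ σ.var 21) ∧
      (((∀ f', m ≤ f' → f' < C.n → ¬ 1 ≤ C.l f') ∧ σ.var 21 = 0) ∨
        (σ.var 22 < C.n ∧ 1 ≤ C.l (σ.var 22) ∧ σ.var 21 = N (σ.var 22))))
    (fun _ _ _ h => h) ?_ ?_
  · obtain ⟨k1, k2⟩ := this
    rcases k2 with ⟨k2, -⟩ | ⟨k2, k3, k4⟩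
    · obtain ⟨f, hf, hl⟩ := hex
      exact absurd hl (k2 f (Nat.zero_le _) hf)
    · exact ⟨k2, k3, fun f' hf' hl' => (k1 f' (Nat.zero_le _) hf' hl').trans_eq k4⟩
  · rw [h1.hn]
    exact ⟨fun f' h1 h2 => by omega, .inl ⟨fun f' h1 h2 => by omega, by simp⟩⟩
  · rintro m hm σ ha hi ⟨k1, k2⟩
    have hσ : C.Holds σ := h1.agree rfl ha
    rw [h1.hn] at hm
    by_cases hl : 1 ≤ C.l m
    · set τ := eval D countNear (eval D (load 24 1 18) σ) with hτ
      have hc := countNear_spec (D := D) (s := eval D (load 24 1 18) σ) (hσ.eval rfl)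
      have e7 : (eval D (load 24 1 18) σ).arr 7 = s.arr 7 := ha.2 7 rfl
      have e18 : (eval D (load 24 1 18) σ).var 18 = m := by simp [hi]
      rw [e7, e18, ← hN, ← hτ] at hc
      have f18 : τ.var 18 = m := (eval_var rfl).trans e18
      have f21 : τ.var 21 = σ.var 21 := (eval_var rfl).trans (eval_var rfl)
      have f22 : τ.var 22 = σ.var 22 := (eval_var rfl).trans (eval_var rfl)
      have hrun : eval D (load 24 1 18 ;; ite (.le 4 24)
          (countNear ;; ite (.le 21 20) (copy 21 20 ;; copy 22 18) skip) skip) σ =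
          eval D (ite (.le 21 20) (copy 21 20 ;; copy 22 18) skip) τ := by
        simp [hi, hσ.one, hσ.hl, hl, hτ]
      rw [hrun]
      by_cases hle : σ.var 21 ≤ N m
      · have e21 : (eval D (ite (.le 21 20) (copy 21 20 ;; copy 22 18) skip) τ).var 21 = N m := by
          simp [f21, hc, hle]
        have e22 : (eval D (ite (.le 21 20) (copy 21 20 ;; copy 22 18) skip) τ).var 22 = m := by
          simp [f21, hc, hle, f18]
        rw [e21, e22]
        refine ⟨fun f' hf' hf'n hl' => ?_, .inr ⟨hm, hl, rfl⟩⟩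
        rcases hf'.eq_or_lt with rfl | hlt
        · exact le_rfl
        · exact (k1 f' hlt hf'n hl').trans hle
      · have e : eval D (ite (.le 21 20) (copy 21 20 ;; copy 22 18) skip) τ = τ := by
          simp [f21, hc, hle]
        rw [e, f21, f22]
        refine ⟨fun f' hf' hf'n hl' => ?_, .inr ?_⟩
        · rcases hf'.eq_or_lt with rfl | hlt
          · exact (not_le.1 hle).le
          · exact k1 f' hlt hf'n hl'
        -- Candidates are recorded also on ties, so the comparison cannot fail while the best count
        -- is still zero. Hence some facility is recorded even if none covers anything new.
        · rcases k2 with ⟨-, k2⟩ | k2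
          · rw [k2] at hle
            exact absurd (Nat.zero_le _) hle
          · exact k2
    · have hrun : eval D (load 24 1 18 ;; ite (.le 4 24)
          (countNear ;; ite (.le 21 20) (copy 21 20 ;; copy 22 18) skip) skip) σ =
          σ.setVar 24 (C.l m) := by
        simp [hi, hσ.one, hσ.hl, hl]
      have e21 : (σ.setVar 24 (C.l m)).var 21 = σ.var 21 := by simp
      have e22 : (σ.setVar 24 (C.l m)).var 22 = σ.var 22 := by simp
      rw [hrun, e21, e22]
      refine ⟨fun f' hf' hf'n hl' => ?_, ?_⟩
      · rcases hf'.eq_or_lt with rfl | hlt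
        · exact absurd hl' hl
        · exact k1 f' hlt hf'n hl'
      · refine k2.imp (fun k2 => ⟨fun f' hf' hf'n => ?_, k2.2⟩) id
        rcases hf'.eq_or_lt with rfl | hlt
        · exact hl
        · exact k2.1 f' hlt hf'n

theorem markCovered_spec (h : C.Holds s) : ∀ x < C.n,
    (D x (s.var 22) ≤ D C.a C.b → (eval D markCovered s).arr 7 x = 0) ∧
    (¬ D x (s.var 22) ≤ D C.a C.b → (eval D markCovered s).arr 7 x = s.arr 7 x) := by
  have := loop_induction' (D := D) (i := 19) (N := 0) (s := s)
    (p := ite (.distLe 19 22 10 11) (store 7 19 5) skip)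
    (P := fun m σ => ∀ x < C.n,
      (m ≤ x → D x (s.var 22) ≤ D C.a C.b → σ.arr 7 x = 0) ∧
      (¬ (m ≤ x ∧ D x (s.var 22) ≤ D C.a C.b) → σ.arr 7 x = s.arr 7 x))
    (fun _ _ _ h => h) (fun x hx => ⟨fun hx' => by rw [h.hn] at hx'; omega, fun _ => rfl⟩) ?_
  · exact fun x hx => ⟨(this x hx).1 (Nat.zero_le _), fun h' => (this x hx).2 fun h => h' h.2⟩
  · intro m hm σ ha hi ih x hx
    have hσ : C.Holds σ := h.agree rfl ha
    have e22 : σ.var 22 = s.var 22 := ha.1 22 rfl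
    by_cases hd : D m (s.var 22) ≤ D C.a C.b
    · have e : (eval D (ite (.distLe 19 22 10 11) (store 7 19 5) skip) σ).arr 7 =
          Function.update (σ.arr 7) m 0 := by
        simp [hi, hσ.ha, hσ.hb, hσ.zero, e22, hd]
      rw [e]
      by_cases hxm : x = m
      · subst hxm
        exact ⟨fun _ _ => by simp, fun h1 => absurd ⟨le_rfl, hd⟩ h1⟩
      · rw [Function.update_of_ne hxm]
        exact ⟨fun h1 => (ih x hx).1 (by omega), fun h1 => (ih x hx).2 fun h2 => h1 ⟨by omega, h2.2⟩⟩
    · have e : eval D (ite (.distLe 19 22 10 11) (store 7 19 5) skip) σ = σ := by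
        simp [hi, hσ.ha, hσ.hb, e22, hd]
      rw [e]
      refine ⟨fun h1 h2 => (ih x hx).1 ?_ h2, fun h1 => (ih x hx).2 fun h2 => h1 ⟨by omega, h2.2⟩⟩
      rcases h1.eq_or_lt with rfl | hlt
      · exact absurd h2 hd
      · exact hlt

/-- The last part of the invariant expresses shrinking by the factor `1 - 1/k` per step without
division. That all listed entries are facilities is shown without assuming a cover by `k` balls,
because the search tries tuples of them for every radius. -/
theorem greedy_spec (h : C.Holds s) (hk : 0 < C.k) (hex : ∃ f < C.n, 1 ≤ C.l f) {lg : ℕ}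
    (hlg : C.n < 2 ^ lg) (hm : C.m = C.k * lg) :
    let S := (eval D greedy s).arr 8
    (∀ t < C.m, S t < C.n ∧ 1 ≤ C.l (S t)) ∧ (C.Coverable D →
      ∀ x < C.n, 1 ≤ C.c x → ∃ t < C.m, D x (S t) ≤ D C.a C.b) := by
  set s₁ := eval D initUncovered s with hs₁
  have h1 : C.Holds s₁ := h.eval rfl
  have hinit : ∀ x < C.n, s₁.arr 7 x = C.c x := by
    rw [← h.hn]
    refine fill_loop _ fun m hm σ ha hi _ => ?_
    have hσ : C.Holds σ := h.agree rfl ha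
    simp [hi, hσ.hc]
  have := loop_induction' (D := D) (i := 17) (N := 7) (s := s₁)
    (p := bestFacility ;; store 8 17 22 ;; markCovered)
    (P := fun t σ => (∀ t', t ≤ t' → t' < C.m → σ.arr 8 t' < C.n ∧ 1 ≤ C.l (σ.arr 8 t')) ∧
      (∀ x < C.n, 1 ≤ C.c x → 1 ≤ σ.arr 7 x ∨
        ∃ t', t ≤ t' ∧ t' < C.m ∧ D x (σ.arr 8 t') ≤ D C.a C.b) ∧
      (∀ x < C.n, 1 ≤ σ.arr 7 x → 1 ≤ C.c x) ∧
      (C.Coverable D → C.k ^ (C.m - t) * uncoveredCount C.n (σ.arr 7) ≤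
        (C.k - 1) ^ (C.m - t) * C.n))
    (fun _ _ _ h => h) ?_ ?_
  · obtain ⟨k1, k2, -, k4⟩ := this
    refine ⟨fun t ht => k1 t (Nat.zero_le _) ht, fun hcov x hx hcx => ?_⟩
    have h0 := k4 hcov
    rw [Nat.sub_zero, hm] at h0
    have hu := eq_zero_of_greedy_bound hk hlg h0
    rw [uncoveredCount, Finset.card_eq_zero] at hu
    rcases k2 x hx hcx with k2 | ⟨t, -, ht, hd⟩
    · have : x ∈ (∅ : Finset ℕ) := hu ▸ Finset.mem_filter.2 ⟨Finset.mem_range.2 hx, k2⟩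
      simp at this
    · exact ⟨t, ht, hd⟩
  · rw [h1.hm]
    refine ⟨fun t' h1 h2 => by omega, fun x hx hcx => .inl (by rwa [hinit x hx]),
      fun x hx hcx => by rwa [← hinit x hx], fun _ => ?_⟩
    simp only [Nat.sub_self, pow_zero, one_mul]
    exact (Finset.card_filter_le _ _).trans (by simp)
  · rintro t ht σ ha hi ⟨k1, k2, k3, k4⟩
    have hσ : C.Holds σ := h1.agree rfl ha
    rw [h1.hm] at ht
    obtain ⟨b1, b2, b3⟩ := bestFacility_spec (D := D) hσ hex
    set τ := eval D (bestFacility ;; store 8 17 22) σ with hτ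
    have hτC : C.Holds τ := hσ.eval rfl
    set f := (eval D bestFacility σ).var 22 with hf
    have τ22 : τ.var 22 = f := rfl
    have τ7 : τ.arr 7 = σ.arr 7 := eval_arr (p := bestFacility ;; store 8 17 22) rfl
    have g17 : (eval D bestFacility σ).var 17 = t := (eval_var rfl).trans hi
    have g8 : (eval D bestFacility σ).arr 8 = σ.arr 8 := eval_arr rfl
    have τ8 : τ.arr 8 = Function.update (σ.arr 8) t f := by
      simp [hτ, g17, g8, hf]
    have c := markCovered_spec (D := D) hτC
    rw [τ22, τ7] at c
    set ω := eval D markCovered τ with hω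
    have e : eval D (bestFacility ;; store 8 17 22 ;; markCovered) σ = ω := rfl
    have ω8 : ω.arr 8 = Function.update (σ.arr 8) t f := (eval_arr rfl).trans τ8
    rw [e, ω8]
    have hne : ∀ t', t + 1 ≤ t' → Function.update (σ.arr 8) t f t' = σ.arr 8 t' := fun t' h' =>
      Function.update_of_ne (by omega) _ _
    refine ⟨fun t' h1 h2 => ?_, fun x hx hcx => ?_, fun x hx hωx => ?_, fun hcov => ?_⟩
    · rcases h1.eq_or_lt with rfl | hlt
      · simp only [Function.update_self]
        exact ⟨b1, b2⟩
      · rw [hne t' hlt]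
        exact k1 t' hlt h2
    · by_cases hd : D x f ≤ D C.a C.b
      · exact .inr ⟨t, le_rfl, ht, by simpa using hd⟩
      · rw [(c x hx).2 hd]
        refine (k2 x hx hcx).imp id fun ⟨t', h1, h2, h3⟩ => ⟨t', by omega, h2, ?_⟩
        rwa [hne t' h1]
    · by_cases hd : D x f ≤ D C.a C.b
      · rw [(c x hx).1 hd] at hωx
        omega
      · rw [(c x hx).2 hd] at hωx
        exact k3 x hx hωx
    · have hcount : uncoveredCount C.n (ω.arr 7) + nearCount C.n D (D C.a C.b) (σ.arr 7) f ≤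
          uncoveredCount C.n (σ.arr 7) := by
        rw [uncoveredCount, nearCount, uncoveredCount, ← Finset.card_union_of_disjoint]
        · refine Finset.card_le_card fun x hx => ?_
          simp only [Finset.mem_union, Finset.mem_filter, Finset.mem_range] at hx ⊢
          rcases hx with hx | hx
          · refine ⟨hx.1, ?_⟩
            by_cases hd : D x f ≤ D C.a C.b
            · rw [(c x hx.1).1 hd] at hx
              omega
            · rw [← (c x hx.1).2 hd]
              exact hx.2
          · exact ⟨hx.1, hx.2.1⟩
        · rw [Finset.disjoint_left]
          intro x hx hx'
          simp only [Finset.mem_filter, Finset.mem_range] at hx hx'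
          rw [(c x hx.1).1 hx'.2.2] at hx
          omega
      have hbig := uncoveredCount_le_mul_nearCount hcov k3 b3
      -- The chosen ball removes at least a `1/k` fraction of the uncovered points.
      have hmain : C.k * uncoveredCount C.n (ω.arr 7) ≤
          (C.k - 1) * uncoveredCount C.n (σ.arr 7) := by
        have := Nat.mul_le_mul_left C.k hcount
        rw [Nat.sub_mul, mul_add] at *
        omega
      have hsub : C.m - t = C.m - (t + 1) + 1 := by omega
      rw [hsub, pow_succ, pow_succ, mul_assoc, mul_right_comm]
      calc C.k ^ (C.m - (t + 1)) * (C.k * uncoveredCount C.n (ω.arr 7))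
          ≤ C.k ^ (C.m - (t + 1)) * ((C.k - 1) * uncoveredCount C.n (σ.arr 7)) :=
            Nat.mul_le_mul_left _ hmain
        _ = C.k ^ (C.m - (t + 1)) * uncoveredCount C.n (σ.arr 7) * (C.k - 1) := by ring
        _ ≤ _ := Nat.mul_le_mul_right _ (k4 hcov)

/-- Division by repeated subtraction. The quotient is at most the dividend, hence less than `m ^ k`,
so the `m ^ k` rounds cannot run out before the remainder is small. -/
theorem divide_spec (h : C.Holds s) (hm : 0 < C.m) (hlt : s.var 26 < C.m ^ C.k) :
    let s' := eval D divide s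
    s'.var 26 = s.var 26 % C.m ∧ s'.var 27 = s.var 26 / C.m := by
  intro s'
  have h1 : C.Holds (eval D (const 27 0) s) := h.eval rfl
  have := loop_induction' (D := D) (i := 28) (N := 8) (s := eval D (const 27 0) s)
    (p := ite (.le 7 26) (sub 26 26 7 ;; add 27 27 4) skip)
    (P := fun j σ => σ.var 26 + C.m * σ.var 27 = s.var 26 ∧
      (σ.var 26 < C.m ∨ C.m ^ C.k ≤ σ.var 27 + j)) (fun _ _ _ h => h) ?_ ?_
  · obtain ⟨k1, k2⟩ := this
    change s'.var 26 + C.m * s'.var 27 = s.var 26 at k1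
    have k3 : s'.var 26 < C.m := by
      refine k2.resolve_right fun k2 => ?_
      change C.m ^ C.k ≤ s'.var 27 + 0 at k2
      have := Nat.le_mul_of_pos_left (s'.var 27) hm
      omega
    rw [← k1]
    simp [Nat.add_mul_mod_self_left, Nat.mod_eq_of_lt k3, Nat.add_mul_div_left _ _ hm,
      Nat.div_eq_of_lt k3]
  · rw [h1.hM]
    simp
  · rintro j hj σ ha - ⟨k1, k2⟩
    have hσ : C.Holds σ := h1.agree rfl ha
    by_cases hle : C.m ≤ σ.var 26
    · have e26 : (eval D (ite (.le 7 26) (sub 26 26 7 ;; add 27 27 4) skip) σ).var 26 =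
          σ.var 26 - C.m := by simp [hσ.hm, hle]
      have e27 : (eval D (ite (.le 7 26) (sub 26 26 7 ;; add 27 27 4) skip) σ).var 27 =
          σ.var 27 + 1 := by simp [hσ.hm, hσ.one, hle]
      rw [e26, e27, mul_add]
      omega
    · have e : eval D (ite (.le 7 26) (sub 26 26 7 ;; add 27 27 4) skip) σ = σ := by
        simp [hσ.hm, hle]
      rw [e]
      exact ⟨k1, .inl (not_le.1 hle)⟩

/-- The loop counts down, so the lowest digit in base `m` goes to the label `k - 1`. -/
theorem decode_spec (h : C.Holds s) (hm : 0 < C.m) (hlt : s.var 16 < C.m ^ C.k) :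
    ∀ i < C.k, (eval D decode s).arr 9 i =
      s.arr 8 (s.var 16 / C.m ^ (C.k - 1 - i) % C.m) := by
  have h1 : C.Holds (eval D (copy 26 16) s) := h.eval rfl
  have := loop_induction' (D := D) (i := 25) (N := 1) (s := eval D (copy 26 16) s)
    (p := divide ;; load 24 8 26 ;; store 9 25 24 ;; copy 26 27)
    (P := fun j σ => σ.var 26 = s.var 16 / C.m ^ (C.k - j) ∧
      ∀ i, j ≤ i → i < C.k → σ.arr 9 i = s.arr 8 (s.var 16 / C.m ^ (C.k - 1 - i) % C.m))
    (fun _ _ _ h => h) ?_ ?_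
  · exact fun i hi => this.2 i (Nat.zero_le _) hi
  · rw [h1.hk]
    exact ⟨by simp, fun i h1 h2 => by omega⟩
  · rintro j hj σ ha hi ⟨k1, k2⟩
    have hσ : C.Holds σ := h1.agree rfl ha
    rw [h1.hk] at hj
    obtain ⟨d1, d2⟩ := divide_spec (D := D) hσ hm
      (by rw [k1]; exact (Nat.div_le_self _ _).trans_lt hlt)
    have f25 : (eval D divide σ).var 25 = j := (eval_var rfl).trans hi
    have f9 : (eval D divide σ).arr 9 = σ.arr 9 := eval_arr rfl
    have f8 : (eval D divide σ).arr 8 = s.arr 8 := (eval_arr rfl).trans (ha.2 8 rfl)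
    have e26 : (eval D (divide ;; load 24 8 26 ;; store 9 25 24 ;; copy 26 27) σ).var 26 =
        σ.var 26 / C.m := by simp [d2]
    have e9 : (eval D (divide ;; load 24 8 26 ;; store 9 25 24 ;; copy 26 27) σ).arr 9 =
        Function.update (σ.arr 9) j (s.arr 8 (σ.var 26 % C.m)) := by
      simp [d1, f25, f9, f8]
    rw [e26, e9, k1, Nat.div_div_eq_div_mul, ← pow_succ]
    refine ⟨by congr 2; omega, fun i hji hik => ?_⟩
    by_cases hij : i = j
    · subst hij
      simp only [Function.update_self]
      congr 4
      omega
    · rw [Function.update_of_ne hij]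
      exact k2 i (by omega) hik

end Cmd

/-- This makes the enumeration exhaustive. The induction appends the new index as the lowest digit,
in accordance with the order used by `decode`. -/
theorem exists_digits {m k : ℕ} (g : ℕ → ℕ) (hg : ∀ i < k, g i < m) :
    ∃ e < m ^ k, ∀ i < k, e / m ^ (k - 1 - i) % m = g i := by
  induction k with
  | zero => exact ⟨0, by simp, fun i hi => by omega⟩
  | succ k ih =>
    obtain ⟨e, he, hd⟩ := ih fun i hi => hg i (by omega)
    have hk := hg k (by omega)
    have hm : 0 < m := by omega
    have hdiv : (g k + m * e) / m = e := by
      rw [Nat.add_mul_div_left _ _ hm, Nat.div_eq_of_lt hk, Nat.zero_add]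
    refine ⟨g k + m * e, ?_, fun i hi => ?_⟩
    · rw [pow_succ]
      nlinarith
    · by_cases hik : i = k
      · subst hik
        simp [Nat.mod_eq_of_lt hk]
      · have : k + 1 - 1 - i = (k - 1 - i) + 1 := by omega
        rw [this, pow_succ', ← Nat.div_div_eq_div_mul, hdiv]
        exact hd i (by omega)

/-! ### Exhaustive search over radii and tuples of centers -/

namespace Cmd

/-- Record the current solution. -/
def update : Cmd :=
  const 3 1 ;; copy 12 14 ;; copy 13 15 ;; loop 25 1 (load 24 9 25 ;; store 4 25 24) ;;
    loop 19 0 (load 24 10 19 ;; store 5 19 24)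

/-- Run the given subroutine, and record its solution if it is better than the recorded one. -/
def tryRadius (chk : Cmd) : Cmd :=
  chk ;; ite (.le 4 40) (ite (.le 4 3) (ite (.distLe 12 13 14 15) skip update) update) skip

/-- Try all radii for the current centers. -/
def tryRadii (chk : Cmd) : Cmd := loop 14 0 (loop 15 0 (tryRadius chk))

/-- Try all tuples of centers from array `8`. -/
def tryTuples (chk : Cmd) : Cmd := loop 16 8 (decode ;; tryRadii chk)

/-- Try all radii of the greedy set cover. -/
def searchAll (chk : Cmd) : Cmd := loop 10 0 (loop 11 0 (greedy ;; tryTuples chk))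

end Cmd

namespace Instance

variable (I : Instance)

/-- The store contains the input and the loop bounds. -/
structure Inputs (w : ℕ) (a b : ℕ → ℕ) (m : ℕ) (s : Store) : Prop where
  hn : s.var 0 = I.n
  hk : s.var 1 = I.k
  hw : s.var 2 = w
  one : s.var 4 = 1
  zero : s.var 5 = 0
  hm : s.var 7 = m
  hM : s.var 8 = m ^ I.k
  hR : s.var 9 = I.k * (I.k * (I.n + 1))
  hc : s.arr 0 = I.clientArr fun _ => 1
  hl : s.arr 1 = listArr fun f : Fin I.n => if f ∈ I.L then 1 else 0
  ha : s.arr 2 = a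
  hb : s.arr 3 = b
  hz : s.arr 6 = fun _ => 0

/-- The recorded solution has the property `Out` with the recorded radius. -/
def Valid (Out : I.CenterSet → ℝ≥0 → (ℕ → ℕ) → Prop) (s : Store) : Prop :=
  s.var 3 = 0 ∨ (s.var 3 = 1 ∧ ∃ F : I.CenterSet, I.WritesCenters s F ∧
    Out F (I.table (s.var 12) (s.var 13)) (s.arr 5))

/-- A solution with radius at most `τ` is recorded. -/
def Reached (τ : ℝ≥0) (s : Store) : Prop :=
  s.var 3 = 1 ∧ I.table (s.var 12) (s.var 13) ≤ τ

/-- The program writes neither the input nor the recorded solution. -/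
def keeps (p : Cmd) : Bool :=
  [0, 1, 2, 3, 4, 5, 7, 8, 9, 12, 13].all (fun x => !p.writesVar x) &&
    [0, 1, 2, 3, 4, 5, 6].all fun A => !p.writesArr A

variable {I} {w m : ℕ} {a b : ℕ → ℕ} {Good : I.CenterSet → ℝ≥0 → Prop}
  {Out : I.CenterSet → ℝ≥0 → (ℕ → ℕ) → Prop} {s s' : Store} {chk : Cmd}

theorem Inputs.of_eq (h : I.Inputs w a b m s)
    (hv : ∀ x ∈ [0, 1, 2, 4, 5, 7, 8, 9], s'.var x = s.var x)
    (ha : ∀ A ∈ [0, 1, 2, 3, 6], s'.arr A = s.arr A) : I.Inputs w a b m s' :=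
  ⟨(hv 0 (by decide)).trans h.hn, (hv 1 (by decide)).trans h.hk, (hv 2 (by decide)).trans h.hw,
    (hv 4 (by decide)).trans h.one, (hv 5 (by decide)).trans h.zero, (hv 7 (by decide)).trans h.hm,
    (hv 8 (by decide)).trans h.hM, (hv 9 (by decide)).trans h.hR, (ha 0 (by decide)).trans h.hc,
    (ha 1 (by decide)).trans h.hl, (ha 2 (by decide)).trans h.ha, (ha 3 (by decide)).trans h.hb,
    (ha 6 (by decide)).trans h.hz⟩

theorem keeps_var {p : Cmd} (hp : keeps p = true) {x : ℕ}
    (hx : x ∈ [0, 1, 2, 3, 4, 5, 7, 8, 9, 12, 13]) : p.writesVar x = false := by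
  simp only [keeps, Bool.and_eq_true, List.all_eq_true, Bool.not_eq_true'] at hp
  exact hp.1 x hx

theorem keeps_arr {p : Cmd} (hp : keeps p = true) {A : ℕ} (hA : A ∈ [0, 1, 2, 3, 4, 5, 6]) :
    p.writesArr A = false := by
  simp only [keeps, Bool.and_eq_true, List.all_eq_true, Bool.not_eq_true'] at hp
  exact hp.2 A hA

/-- Running `p` keeps the store valid, makes no recorded solution worse, and records solutions with
the radii in `R`. -/
def Improves (I : Instance) (w : ℕ) (a b : ℕ → ℕ) (m : ℕ)
    (Out : I.CenterSet → ℝ≥0 → (ℕ → ℕ) → Prop) (p : Cmd) (s : Store) (R : ℝ≥0 → Prop) : Prop :=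
  (I.Inputs w a b m (p.eval I.table s) ∧ I.Valid Out (p.eval I.table s)) ∧
    (∀ τ, I.Reached τ s → I.Reached τ (p.eval I.table s)) ∧
    ∀ τ, R τ → I.Reached τ (p.eval I.table s)

theorem Improves.mono {p : Cmd} {R R' : ℝ≥0 → Prop} (h : Improves I w a b m Out p s R)
    (hR : ∀ τ, R' τ → R τ) : Improves I w a b m Out p s R' :=
  ⟨h.1, h.2.1, fun τ hτ => h.2.2 τ (hR τ hτ)⟩

/-- Code that touches neither the input nor the record is neutral for the search; the empty set of
guaranteed radii expresses this. -/
theorem improves_of_keeps {p : Cmd} (hp : keeps p = true) (hs : I.Inputs w a b m s)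
    (hv : I.Valid Out s) : Improves I w a b m Out p s fun _ => False := by
  have v : ∀ x ∈ [0, 1, 2, 3, 4, 5, 7, 8, 9, 12, 13],
      (p.eval I.table s).var x = s.var x := fun x hx => Cmd.eval_var (keeps_var hp hx)
  have ar : ∀ A ∈ [0, 1, 2, 3, 4, 5, 6], (p.eval I.table s).arr A = s.arr A := fun x hx =>
    Cmd.eval_arr (keeps_arr hp hx)
  have v3 := v 3 (by decide)
  have v12 := v 12 (by decide)
  have v13 := v 13 (by decide)
  have a4 := ar 4 (by decide)
  have a5 := ar 5 (by decide)
  refine ⟨⟨hs.of_eq (fun x hx => v x ?_) (fun A hA => ar A ?_), ?_⟩, fun τ hτ => ?_,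
    fun _ h => h.elim⟩
  · revert x; decide
  · revert A; decide
  · simpa only [Valid, WritesCenters, v3, v12, v13, a4, a5] using hv
  · simpa only [Reached, v3, v12, v13] using hτ

theorem Improves.seq {p q : Cmd} {R : ℝ≥0 → Prop} (hp : keeps p = true)
    (hs : I.Inputs w a b m s) (hv : I.Valid Out s)
    (hq : Improves I w a b m Out q (p.eval I.table s) R) :
    Improves I w a b m Out (p ;; q) s R :=
  ⟨hq.1, fun τ hτ => hq.2.1 τ ((improves_of_keeps hp hs hv).2.1 τ hτ), hq.2.2⟩

/-- Later rounds never worsen the record, so a radius reached in one round is still reached at the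
end, and the guarantees of the rounds accumulate. -/
theorem Improves.loop {i N : ℕ} {p : Cmd} {R : ℕ → ℝ≥0 → Prop}
    (hi : i ∉ [0, 1, 2, 3, 4, 5, 7, 8, 9, 12, 13]) (hs : I.Inputs w a b m s)
    (hv : I.Valid Out s) (hbody : ∀ j < s.var N, ∀ σ, Cmd.Agree (.loop i N p) s σ → σ.var i = j →
      I.Inputs w a b m σ → I.Valid Out σ → Improves I w a b m Out p σ (R j)) :
    Improves I w a b m Out (.loop i N p) s fun τ => ∃ j < s.var N, R j τ := by
  have hset : ∀ (σ : Store) (v : ℕ), I.Inputs w a b m σ ∧ I.Valid Out σ →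
      I.Inputs w a b m (σ.setVar i v) ∧ I.Valid Out (σ.setVar i v) ∧
      ∀ τ, I.Reached τ σ → I.Reached τ (σ.setVar i v) := by
    rintro σ v ⟨h1, h2⟩
    have hne : ∀ x ∈ [0, 1, 2, 3, 4, 5, 7, 8, 9, 12, 13], (σ.setVar i v).var x = σ.var x :=
      fun x hx => by
        rw [Store.setVar_var, if_neg]
        rintro rfl
        exact hi hx
    have v3 := hne 3 (by decide)
    have v12 := hne 12 (by decide)
    have v13 := hne 13 (by decide)
    refine ⟨h1.of_eq (fun x hx => hne x ?_) fun _ _ => rfl, ?_, fun τ hτ => ?_⟩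
    · revert x; decide
    · simpa only [Valid, WritesCenters, v3, v12, v13, Store.setVar_arr] using h2
    · simpa only [Reached, v3, v12, v13] using hτ
  have hJ := Cmd.loop_preserves (D := I.table) (i := i) (N := N) (p := p) (s := s)
    (fun σ => I.Inputs w a b m σ ∧ I.Valid Out σ)
    (fun σ v h => ⟨(hset σ v h).1, (hset σ v h).2.1⟩) ⟨hs, hv⟩ fun j hj σ ha h =>
      (hbody j hj _ (ha.setVar j) (by simp) (hset σ j h).1 (hset σ j h).2.1).1
  refine ⟨hJ, fun τ hτ => ?_, fun τ hτ => ?_⟩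
  · exact (Cmd.loop_preserves (D := I.table) (i := i) (N := N) (p := p) (s := s)
      (fun σ => (I.Inputs w a b m σ ∧ I.Valid Out σ) ∧ I.Reached τ σ)
      (fun σ v h => ⟨⟨(hset σ v h.1).1, (hset σ v h.1).2.1⟩, (hset σ v h.1).2.2 τ h.2⟩)
      ⟨⟨hs, hv⟩, hτ⟩ fun j hj σ ha h => by
        have := hbody j hj _ (ha.setVar j) (by simp) (hset σ j h.1).1 (hset σ j h.1).2.1
        exact ⟨this.1, this.2.1 τ ((hset σ j h.1).2.2 τ h.2)⟩).2
  · obtain ⟨r, hr, hRr⟩ := hτ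
    refine Cmd.loop_reaches (D := I.table) (i := i) (N := N) (p := p) (s := s)
      (fun σ => I.Inputs w a b m σ ∧ I.Valid Out σ) (I.Reached τ)
      (fun σ v h => ⟨(hset σ v h).1, (hset σ v h).2.1⟩) ⟨hs, hv⟩
      (fun j hj σ ha h =>
        (hbody j hj _ (ha.setVar j) (by simp) (hset σ j h).1 (hset σ j h).2.1).1)
      (fun j hj σ ha h hτ =>
        (hbody j hj _ (ha.setVar j) (by simp) (hset σ j h).1 (hset σ j h).2.1).2.1 τ
          ((hset σ j h).2.2 τ hτ)) hr fun σ ha h =>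
        (hbody r hr _ (ha.setVar r) (by simp) (hset σ r h).1 (hset σ r h).2.1).2.2 τ hRr

/-- The subroutine decides `Good` for the centers in array `9` and the radius given by the points
in variables `14` and `15`, and finds a solution with the property `Out`. -/
structure Decides (I : Instance) (w : ℕ) (a b : ℕ → ℕ) (m : ℕ)
    (Good : I.CenterSet → ℝ≥0 → Prop) (Out : I.CenterSet → ℝ≥0 → (ℕ → ℕ) → Prop)
    (chk : Cmd) : Prop where
  writesVar : ∀ x < 40, chk.writesVar x = false
  writesArr : ∀ A < 10, chk.writesArr A = false
  congr : ∀ F τ o o', (∀ x < I.n, o x = o' x) → Out F τ o → Out F τ o'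
  spec : ∀ (s : Store) (F : I.CenterSet), I.Inputs w a b m s →
    (∀ i : Fin I.k, s.arr 9 i = ((F i).1 : ℕ)) → s.var 14 < I.n → s.var 15 < I.n →
    let τ := I.table (s.var 14) (s.var 15)
    let s' := chk.eval I.table s
    (s'.var 40 = 1 ∧ Out F τ (s'.arr 10)) ∨ (s'.var 40 = 0 ∧ ¬ Good F τ)

theorem update_spec (D : ℕ → ℕ → ℝ≥0) (hn : s.var 0 = I.n) (hk : s.var 1 = I.k) :
    let s' := Cmd.update.eval D s
    s'.var 3 = 1 ∧ s'.var 12 = s.var 14 ∧ s'.var 13 = s.var 15 ∧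
      (∀ i < I.k, s'.arr 4 i = s.arr 9 i) ∧ ∀ x < I.n, s'.arr 5 x = s.arr 10 x := by
  intro s'
  set s₁ := (Cmd.const 3 1 ;; .copy 12 14 ;; .copy 13 15).eval D s with hs₁
  set s₂ := (Cmd.loop 25 1 (.load 24 9 25 ;; .store 4 25 24)).eval D s₁ with hs₂
  have e : s' = (Cmd.loop 19 0 (.load 24 10 19 ;; .store 5 19 24)).eval D s₂ := rfl
  have h3 : s₁.var 3 = 1 := by simp [hs₁]
  have h12 : s₁.var 12 = s.var 14 := by simp [hs₁]
  have h13 : s₁.var 13 = s.var 15 := by simp [hs₁]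
  have v : ∀ x ∈ [3, 12, 13], s'.var x = s₁.var x := fun x hx => by
    rw [e, Cmd.eval_var, Cmd.eval_var]
    all_goals revert x; decide
  refine ⟨(v 3 (by decide)).trans h3, (v 12 (by decide)).trans h12, (v 13 (by decide)).trans h13,
    fun i hi => ?_, fun x hx => ?_⟩
  · rw [e, Cmd.eval_arr rfl]
    refine Cmd.fill_loop (D := D) (i := 25) (N := 1) (A := 4)
      (p := .load 24 9 25 ;; .store 4 25 24) (s := s₁) (s.arr 9) (fun j hj σ ha hj' _ => ?_) i ?_
    · have : σ.arr 9 = s.arr 9 := ha.2 9 rfl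
      simp [hj', this]
    · have : s₁.var 1 = I.k := hk
      omega
  · refine Cmd.fill_loop (D := D) (i := 19) (N := 0) (A := 5)
      (p := .load 24 10 19 ;; .store 5 19 24) (s := s₂) (s.arr 10) (fun j hj σ ha hj' _ => ?_) x ?_
    · have : σ.arr 10 = s.arr 10 := (ha.2 10 rfl).trans (Cmd.eval_arr rfl)
      simp [hj', this]
    · have : s₂.var 0 = I.n := (Cmd.eval_var rfl).trans hn
      omega

theorem Decides.keeps_chk (hd : Decides I w a b m Good Out chk) : keeps chk = true := by
  simp [keeps, hd.writesVar, hd.writesArr]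

/-- The only place where the record changes, and an existing record yields only to a strictly
smaller radius. If `Good` holds, the subroutine cannot report failure, so afterwards the recorded
radius is at most the current one. -/
theorem tryRadius_improves (hd : Decides I w a b m Good Out chk) (hs : I.Inputs w a b m s)
    (hv : I.Valid Out s) {F : I.CenterSet} (hF : ∀ i : Fin I.k, s.arr 9 i = ((F i).1 : ℕ))
    (h14 : s.var 14 < I.n) (h15 : s.var 15 < I.n) :
    Improves I w a b m Out (Cmd.tryRadius chk) s fun τ =>
      Good F (I.table (s.var 14) (s.var 15)) ∧ I.table (s.var 14) (s.var 15) ≤ τ := by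
  have hsp := hd.spec s F hs hF h14 h15
  have hch := improves_of_keeps (Out := Out) hd.keeps_chk hs hv
  set σ := chk.eval I.table s with hσ
  set ρ := I.table (s.var 14) (s.var 15) with hρ
  obtain ⟨⟨hI, hV⟩, hreach, -⟩ := hch
  have h4 : σ.var 4 = 1 := hI.one
  have e14 : σ.var 14 = s.var 14 := Cmd.eval_var (hd.writesVar 14 (by decide))
  have e15 : σ.var 15 = s.var 15 := Cmd.eval_var (hd.writesVar 15 (by decide))
  have e9 : σ.arr 9 = s.arr 9 := Cmd.eval_arr (hd.writesArr 9 (by decide))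
  have hrun : (Cmd.tryRadius chk).eval I.table s = (Cmd.ite (.le 4 40) (.ite (.le 4 3)
    (.ite (.distLe 12 13 14 15) .skip .update) .update) .skip).eval I.table σ := rfl
  have upd : (I.Inputs w a b m (Cmd.update.eval I.table σ)) ∧
      (Out F ρ (σ.arr 10) → I.Valid Out (Cmd.update.eval I.table σ)) ∧
      (Cmd.update.eval I.table σ).var 3 = 1 ∧
      I.table ((Cmd.update.eval I.table σ).var 12) ((Cmd.update.eval I.table σ).var 13) = ρ := by
    obtain ⟨u3, u12, u13, u4, u5⟩ := update_spec I.table hI.hn hI.hk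
    refine ⟨hI.of_eq (fun x hx => Cmd.eval_var ?_) (fun A hA => Cmd.eval_arr ?_),
      fun hout => .inr ⟨u3, F, fun i => ?_, ?_⟩, u3, by rw [u12, u13, e14, e15]⟩
    · revert x; decide
    · revert A; decide
    · rw [u4 i i.2, e9, hF i]
    · rw [u12, u13, e14, e15]
      exact hd.congr F ρ _ _ (fun x hx => (u5 x hx).symm) hout
  simp only [Improves, hrun]
  rcases hsp with ⟨h40, hout⟩ | ⟨h40, hbad⟩
  · by_cases h3 : σ.var 3 = 1
    · by_cases hle : I.table (σ.var 12) (σ.var 13) ≤ ρ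
      · have e : (Cmd.ite (.le 4 40) (.ite (.le 4 3) (.ite (.distLe 12 13 14 15) .skip .update)
            .update) .skip).eval I.table σ = σ := by
          simp [h4, h40, h3, e14, e15, ← hρ, hle]
        rw [e]
        exact ⟨⟨hI, hV⟩, hreach, fun τ hτ => ⟨h3, hle.trans hτ.2⟩⟩
      · have e : (Cmd.ite (.le 4 40) (.ite (.le 4 3) (.ite (.distLe 12 13 14 15) .skip .update)
            .update) .skip).eval I.table σ = Cmd.update.eval I.table σ := by
          simp [h4, h40, h3, e14, e15, ← hρ, hle]
        rw [e]
        refine ⟨⟨upd.1, upd.2.1 hout⟩, fun τ hτ => ⟨upd.2.2.1, ?_⟩,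
          fun τ hτ => ⟨upd.2.2.1, upd.2.2.2.trans_le hτ.2⟩⟩
        rw [upd.2.2.2]
        exact (not_le.1 hle).le.trans (hreach τ hτ).2
    · have h3' : σ.var 3 = 0 := hV.resolve_right fun h => h3 h.1
      have e : (Cmd.ite (.le 4 40) (.ite (.le 4 3) (.ite (.distLe 12 13 14 15) .skip .update)
            .update) .skip).eval I.table σ = Cmd.update.eval I.table σ := by
        simp [h4, h40, h3']
      rw [e]
      exact ⟨⟨upd.1, upd.2.1 hout⟩, fun τ hτ => absurd (hreach τ hτ).1 h3,
        fun τ hτ => ⟨upd.2.2.1, upd.2.2.2.trans_le hτ.2⟩⟩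
  · have e : (Cmd.ite (.le 4 40) (.ite (.le 4 3) (.ite (.distLe 12 13 14 15) .skip .update)
            .update) .skip).eval I.table σ = σ := by
      simp [h4, h40]
    rw [e]
    exact ⟨⟨hI, hV⟩, hreach, fun τ hτ => absurd hτ.1 hbad⟩

theorem tryRadii_improves (hd : Decides I w a b m Good Out chk) (hs : I.Inputs w a b m s)
    (hv : I.Valid Out s) {F : I.CenterSet} (hF : ∀ i : Fin I.k, s.arr 9 i = ((F i).1 : ℕ)) :
    Improves I w a b m Out (Cmd.tryRadii chk) s fun τ =>
      ∃ u < I.n, ∃ v < I.n, Good F (I.table u v) ∧ I.table u v ≤ τ := by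
  rw [← hs.hn]
  refine Improves.loop (by decide) hs hv fun u hu σ ha hσu hσ hσv => ?_
  have w9 : (Cmd.tryRadii chk).writesArr 9 = false := by
    simp [Cmd.tryRadii, Cmd.tryRadius, Cmd.update, Cmd.writesArr, hd.writesArr]
  have e9 : σ.arr 9 = s.arr 9 := ha.2 9 w9
  rw [hs.hn, ← hσ.hn]
  refine Improves.loop (by decide) hσ hσv fun v hv ω ha' hωv hω hωvalid => ?_
  have e9' : ω.arr 9 = σ.arr 9 := ha'.2 9 w9
  have e14 : ω.var 14 = σ.var 14 := ha'.1 14 (by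
    simp [Cmd.tryRadius, Cmd.update, Cmd.writesVar, hd.writesVar])
  have := tryRadius_improves hd hω hωvalid (F := F) (by rw [e9', e9]; exact hF)
    (by rw [e14, hσu, ← hs.hn]; exact hu) (by rw [hωv, ← hσ.hn]; exact hv)
  rwa [e14, hσu, hωv] at this

/-- The data of the covering subroutine. -/
def coverData (I : Instance) (m a b : ℕ) : CoverData where
  n := I.n
  k := I.k
  m := m
  a := a
  b := b
  c := I.clientArr fun _ => 1
  l := listArr fun f : Fin I.n => if f ∈ I.L then 1 else 0

theorem Inputs.coverData (h : I.Inputs w a b m s) {u v : ℕ} (hu : s.var 10 = u)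
    (hv : s.var 11 = v) : (I.coverData m u v).Holds s :=
  ⟨h.hn, h.hk, h.one, h.zero, h.hm, h.hM, hu, hv, h.hc, h.hl⟩

theorem one_le_clientArr {x : ℕ} :
    1 ≤ I.clientArr (fun _ => 1) x ↔ ∃ h : x < I.n, (⟨x, h⟩ : Fin I.n) ∈ I.C := by
  unfold clientArr
  split_ifs with h <;> simp [h]

theorem one_le_listArr {f : ℕ} : 1 ≤ listArr (fun f : Fin I.n => if f ∈ I.L then 1 else 0) f ↔
    ∃ h : f < I.n, (⟨f, h⟩ : Fin I.n) ∈ I.L := by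
  unfold listArr
  split_ifs with h
  · by_cases h' : (⟨f, h⟩ : Fin I.n) ∈ I.L <;> simp [h, h']
  · simp [h]

/-- `S` lists `m` facilities, which cover the clients within the radius given by the points `u` and
`v` if `k` facilities do. -/
def IsCover (I : Instance) (m u v : ℕ) (S : ℕ → ℕ) : Prop :=
  (∀ t < m, ∃ h : S t < I.n, (⟨S t, h⟩ : Fin I.n) ∈ I.L) ∧
    ((I.coverData m u v).Coverable I.table → ∀ x : Fin I.n, x ∈ I.C →
      ∃ t < m, I.table x (S t) ≤ I.table u v)

/-- Every list of facilities as above contains the members of a good tuple of centers of radius at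
most `τ`. -/
def Target (I : Instance) (m : ℕ) (Good : I.CenterSet → ℝ≥0 → Prop) (u v : ℕ) (τ : ℝ≥0) : Prop :=
  ∀ S, I.IsCover m u v S → ∃ F : I.CenterSet, (∀ i, ∃ t < m, ((F i).1 : ℕ) = S t) ∧
    ∃ u < I.n, ∃ v < I.n, Good F (I.table u v) ∧ I.table u v ≤ τ

/-- The number `e` decodes to the tuple `T e` of entries of `S`; by `exists_digits`, every
center-set with members in `S` is some `T e`. -/
theorem tryTuples_improves (hd : Decides I w a b m Good Out chk) (hs : I.Inputs w a b m s)
    (hv : I.Valid Out s) (hm : 0 < m) {u v : ℕ} (hu : s.var 10 = u) (hv' : s.var 11 = v)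
    {S : ℕ → ℕ} (hS : s.arr 8 = S)
    (hcov : ∀ t < m, ∃ h : S t < I.n, (⟨S t, h⟩ : Fin I.n) ∈ I.L) :
    Improves I w a b m Out (Cmd.tryTuples chk) s fun τ =>
      ∃ F : I.CenterSet, (∀ i, ∃ t < m, ((F i).1 : ℕ) = S t) ∧
        ∃ u < I.n, ∃ v < I.n, Good F (I.table u v) ∧ I.table u v ≤ τ := by
  set dig : ℕ → Fin I.k → ℕ := fun e i => e / m ^ (I.k - 1 - i) % m with hdig
  have hdm : ∀ e i, dig e i < m := fun e i => Nat.mod_lt _ hm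
  set T : ℕ → I.CenterSet := fun e i => ⟨⟨S (dig e i), (hcov _ (hdm e i)).1⟩,
    (hcov _ (hdm e i)).2⟩ with hT
  refine Improves.mono (R := fun τ => ∃ e < s.var 8, ∃ u < I.n, ∃ v < I.n,
    Good (T e) (I.table u v) ∧ I.table u v ≤ τ)
    (Improves.loop (by decide) hs hv fun e he σ ha hσe hσ hσv => ?_) ?_
  · refine Improves.seq rfl hσ hσv (tryRadii_improves hd
      (improves_of_keeps (p := Cmd.decode) (Out := Out) rfl hσ hσv).1.1
      (improves_of_keeps (p := Cmd.decode) rfl hσ hσv).1.2 fun i => ?_)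
    have e10 : σ.var 10 = u := (ha.1 10 (by
      simp [Cmd.tryRadii, Cmd.tryRadius, Cmd.update, Cmd.decode, Cmd.divide, Cmd.writesVar,
        hd.writesVar])).trans hu
    have e11 : σ.var 11 = v := (ha.1 11 (by
      simp [Cmd.tryRadii, Cmd.tryRadius, Cmd.update, Cmd.decode, Cmd.divide, Cmd.writesVar,
        hd.writesVar])).trans hv'
    have e8 : σ.arr 8 = S := (ha.2 8 (by
      simp [Cmd.tryRadii, Cmd.tryRadius, Cmd.update, Cmd.decode, Cmd.divide, Cmd.writesArr,
        hd.writesArr])).trans hS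
    rw [Cmd.decode_spec (hσ.coverData e10 e11) hm
      (by rw [hσe]; exact he.trans_eq hs.hM) i i.2, e8, hσe]
    rfl
  · rintro τ ⟨F, hF, hgood⟩
    choose g hg hgF using hF
    obtain ⟨e, he, hed⟩ := exists_digits (m := m) (k := I.k)
      (fun i => if h : i < I.k then g ⟨i, h⟩ else 0) fun i hi => by simp [hi, hg]
    refine ⟨e, by rw [hs.hM]; exact he, ?_⟩
    have : T e = F := by
      funext i
      refine Subtype.ext (Fin.ext ?_)
      have := hed i i.2
      simp only [i.2, dite_true, Fin.eta] at this
      simp only [hT, hdig, this, hgF]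
    rw [this]
    exact hgood

/-- Nothing but `IsCover` is known about the greedy output, which is why `Target` quantifies over
all such lists. -/
theorem searchAll_improves (hd : Decides I w a b m Good Out chk) (hs : I.Inputs w a b m s)
    (hv : I.Valid Out s) {lg : ℕ} (hlg : I.n < 2 ^ lg) (hm : m = I.k * lg) :
    Improves I w a b m Out (Cmd.searchAll chk) s fun τ =>
      ∃ u < I.n, ∃ v < I.n, I.Target m Good u v τ := by
  have hnpos : 0 < I.n := by
    obtain ⟨f, -⟩ := I.L_nonempty
    exact f.pos
  have hmpos : 0 < m := by
    rw [hm]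
    refine Nat.mul_pos I.k_pos (Nat.pos_of_ne_zero ?_)
    rintro rfl
    simp at hlg
    omega
  rw [← hs.hn]
  refine Improves.loop (by decide) hs hv fun u hu σ ha hσu hσ hσv => ?_
  rw [hs.hn, ← hσ.hn]
  refine Improves.loop (by decide) hσ hσv fun v hv ω ha' hωv hω hωvalid => ?_
  have e10 : ω.var 10 = u := (ha'.1 10 (by
    simp [Cmd.tryTuples, Cmd.tryRadii, Cmd.tryRadius, Cmd.update, Cmd.decode, Cmd.divide,
      Cmd.greedy, Cmd.initUncovered, Cmd.bestFacility, Cmd.countNear, Cmd.markCovered,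
      Cmd.writesVar, hd.writesVar])).trans hσu
  have hC := hω.coverData e10 hωv
  have hex : ∃ f < I.n, 1 ≤ listArr (fun f : Fin I.n => if f ∈ I.L then 1 else 0) f := by
    obtain ⟨f, hf⟩ := I.L_nonempty
    exact ⟨f, f.2, one_le_listArr.2 ⟨f.2, hf⟩⟩
  obtain ⟨g1, g2⟩ := Cmd.greedy_spec (D := I.table) hC I.k_pos hex hlg hm
  have hk := improves_of_keeps (p := Cmd.greedy) (Out := Out) rfl hω hωvalid
  have hS : I.IsCover m u v (((Cmd.greedy).eval I.table ω).arr 8) :=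
    ⟨fun t ht => one_le_listArr.1 (g1 t ht).2, fun hcov x hx =>
      g2 hcov x x.2 (one_le_clientArr.2 ⟨x.2, hx⟩)⟩
  refine Improves.seq rfl hω hωvalid ((tryTuples_improves hd hk.1.1 hk.1.2 hmpos
    ((Cmd.eval_var rfl).trans e10) ((Cmd.eval_var rfl).trans hωv) rfl hS.1).mono fun τ hτ => ?_)
  exact hτ _ hS

end Instance

/-! ### Loop bounds and running time -/

namespace Cmd

/-- Compute the number of greedy steps in variable `7` and the number of rounds in variable `9`. -/
def initSteps : Cmd :=
  const 23 1 ;; const 6 0 ;; loop 19 0 (ite (.le 23 0) (add 23 23 23 ;; add 6 6 4) skip) ;;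
    const 7 0 ;; loop 25 1 (add 7 7 6) ;;
    add 29 0 4 ;; const 24 0 ;; loop 25 1 (add 24 24 29) ;; const 9 0 ;; loop 25 1 (add 9 9 24)

/-- Compute the number of tuples in variable `8`. -/
def initTuples : Cmd :=
  const 8 1 ;; loop 25 1 (const 24 0 ;; loop 28 7 (add 24 24 8) ;; copy 8 24)

/-- The complete algorithm after the initialization of the constant one. -/
def whole (chk : Cmd) : Cmd := initSteps ;; initTuples ;; searchAll chk

variable {D : ℕ → ℕ → ℝ≥0} {s : Store}

theorem loop_add {i N c x : ℕ} (hci : c ≠ i) (hcx : c ≠ x) (hxi : x ≠ i) :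
    (eval D (loop i N (add c c x)) s).var c = s.var c + s.var N * s.var x := by
  have := loop_induction' (D := D) (i := i) (N := N) (p := add c c x) (s := s)
    (P := fun m σ => σ.var c + m * s.var x = s.var c + s.var N * s.var x)
    (fun m s' v h => by simpa [hci] using h) rfl fun m hm σ ha hi h => by
      have : σ.var x = s.var x := ha.1 x (by simp [writesVar, hxi, hcx.symm])
      rw [add_mul, one_mul] at h
      simp only [eval_add, Store.setVar_var, ↓reduceIte, this]
      omega
  simpa using this

/-- Doubling stops at the first power of two above `n`, which gives both estimates of `2 ^ lg`. The
`n` rounds suffice because `n < 2 ^ n`. -/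
theorem initSteps_spec (hone : s.var 4 = 1) (hn : 0 < s.var 0) : ∃ lg,
    s.var 0 < 2 ^ lg ∧ 2 ^ lg ≤ 2 * s.var 0 ∧ (eval D initSteps s).var 7 = s.var 1 * lg ∧
      (eval D initSteps s).var 9 = s.var 1 * (s.var 1 * (s.var 0 + 1)) := by
  set s₁ := eval D (const 23 1 ;; const 6 0) s with hs₁
  set s₂ := eval D (loop 19 0 (ite (.le 23 0) (add 23 23 23 ;; add 6 6 4) skip)) s₁ with hs₂
  have key := loop_induction' (D := D) (i := 19) (N := 0) (s := s₁)
    (p := ite (.le 23 0) (add 23 23 23 ;; add 6 6 4) skip)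
    (P := fun m σ => σ.var 23 = 2 ^ σ.var 6 ∧ σ.var 23 ≤ 2 * s.var 0 ∧
      (s.var 0 < σ.var 23 ∨ s.var 0 ≤ σ.var 6 + m)) (fun _ _ _ h => h) ?_ ?_
  · obtain ⟨k1, k2, k3⟩ := key
    rw [← hs₂] at k1 k2 k3
    refine ⟨s₂.var 6, ?_, k1 ▸ k2, ?_, ?_⟩
    · rw [← k1]
      rcases k3 with k3 | k3
      · exact k3
      · rw [k1]
        exact Nat.lt_of_le_of_lt k3 Nat.lt_two_pow_self
    · have e : (eval D initSteps s).var 7 =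
          (eval D (loop 25 1 (add 7 7 6)) (eval D (const 7 0) s₂)).var 7 := by
        refine eval_var (p := add 29 0 4 ;; const 24 0 ;; loop 25 1 (add 24 24 29) ;; const 9 0 ;;
          loop 25 1 (add 9 9 24)) rfl
      rw [e, loop_add (by decide) (by decide) (by decide)]
      have e1 : s₂.var 1 = s.var 1 := (eval_var rfl).trans (eval_var rfl)
      simp [e1]
    · set s₃ := eval D (loop 25 1 (add 7 7 6)) (eval D (const 7 0) s₂) with hs₃
      set s₄ := eval D (const 9 0) (eval D (loop 25 1 (add 24 24 29))
        (eval D (add 29 0 4 ;; const 24 0) s₃)) with hs₄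
      have e : eval D initSteps s = eval D (loop 25 1 (add 9 9 24)) s₄ := rfl
      have v : ∀ x ∈ [0, 1, 4], s₃.var x = s.var x := fun x hx => by
        rw [hs₃, eval_var, eval_var, hs₂, eval_var, hs₁, eval_var]
        all_goals revert x; decide
      have v1 : s₄.var 1 = s.var 1 := by
        rw [hs₄, eval_var rfl, eval_var rfl, eval_var rfl, v 1 (by decide)]
      have v24 : s₄.var 24 = s.var 1 * (s.var 0 + 1) := by
        rw [hs₄, eval_var rfl, loop_add (by decide) (by decide) (by decide)]
        simp [v, hone]
      rw [e, loop_add (by decide) (by decide) (by decide), v1, v24]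
      simp [hs₄]
  · have e0 : s₁.var 0 = s.var 0 := eval_var rfl
    rw [e0]
    simp only [hs₁, eval_seq, eval_const, Store.setVar_var, ↓reduceIte, Nat.reduceEqDiff, pow_zero,
      true_and]
    omega
  · rintro m hm σ ha - ⟨k1, k2, k3⟩
    have e0 : σ.var 0 = s.var 0 := (ha.1 0 rfl).trans (eval_var rfl)
    have e4 : σ.var 4 = 1 := ((ha.1 4 rfl).trans (eval_var rfl)).trans hone
    by_cases hle : σ.var 23 ≤ s.var 0
    · have f23 : (eval D (ite (.le 23 0) (add 23 23 23 ;; add 6 6 4) skip) σ).var 23 =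
          σ.var 23 + σ.var 23 := by simp [e0, hle]
      have f6 : (eval D (ite (.le 23 0) (add 23 23 23 ;; add 6 6 4) skip) σ).var 6 =
          σ.var 6 + 1 := by simp [e0, hle, e4]
      rw [f23, f6, pow_succ, k1]
      rw [k1] at hle k3
      omega
    · have e : eval D (ite (.le 23 0) (add 23 23 23 ;; add 6 6 4) skip) σ = σ := by
        simp [e0, hle]
      rw [e]
      exact ⟨k1, k2, .inl (not_le.1 hle)⟩

theorem initTuples_spec : (eval D initTuples s).var 8 = s.var 7 ^ s.var 1 := by
  have key := loop_induction' (D := D) (i := 25) (N := 1) (s := eval D (const 8 1) s)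
    (p := const 24 0 ;; loop 28 7 (add 24 24 8) ;; copy 8 24)
    (P := fun m σ => σ.var 8 * s.var 7 ^ m = s.var 7 ^ s.var 1) (fun _ _ _ h => h) ?_ ?_
  · rw [pow_zero, mul_one] at key
    exact key
  · simp
  · intro m hm σ ha _ ih
    have e7 : σ.var 7 = s.var 7 := (ha.1 7 rfl).trans (eval_var rfl)
    have e : (eval D (const 24 0 ;; loop 28 7 (add 24 24 8) ;; copy 8 24) σ).var 8 =
        s.var 7 * σ.var 8 := by
      simp only [eval_seq, eval_copy, Store.setVar_var, ↓reduceIte]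
      rw [loop_add (by decide) (by decide) (by decide)]
      simp [e7]
    rw [e, ← ih, pow_succ]
    ring

end Cmd

/-- `x ^ k` is at most `(x + 1) ⋯ (x + k)`, which is `k !` times a binomial coefficient. With `x =
lg`, about `log n`, this absorbs `(log n)^k` into a function of `k` times a linear factor in `n`. -/
theorem pow_le_pow_mul_two_pow (x k : ℕ) : x ^ k ≤ k ^ k * 2 ^ (x + k) := by
  have h1 : x ^ k ≤ (x + 1).ascFactorial k :=
    (Nat.pow_le_pow_left (Nat.le_succ x) k).trans (Nat.pow_succ_le_ascFactorial (x + 1) k)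
  rw [Nat.ascFactorial_eq_factorial_mul_choose] at h1
  exact h1.trans (Nat.mul_le_mul (Nat.factorial_le_pow k) (Nat.choose_le_two_pow _ _))

theorem two_pow_le_two_mul_pow {k : ℕ} (hk : 0 < k) : 2 ^ k ≤ 2 * k ^ k := by
  rcases Nat.lt_or_ge k 2 with h | h
  · have : k = 1 := by omega
    subst this
    simp
  · have := Nat.pow_le_pow_left h k
    omega

/-- The number of tuples `(k * lg) ^ k` dominates. Its three factors `k ^ k` come from `k ^ k`
itself, from `lg ^ k`, and from the remaining `2 ^ k`. -/
theorem sum_loopBounds_le {n k lg : ℕ} (hk : 0 < k) (hn : 0 < n) (hlg : 2 ^ lg ≤ 2 * n) :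
    n + k + k * lg + (k * lg) ^ k + k * (k * (n + 1)) + 1 + 1 ≤ 12 * (k ^ (3 * k) * n) := by
  have h3 : k ^ 3 ≤ k ^ (3 * k) := Nat.pow_le_pow_right hk (by omega)
  have h2 : k * k ≤ k ^ (3 * k) := le_trans (by nlinarith [Nat.mul_le_mul_left (k * k) hk]) h3
  have h1 : k ≤ k ^ (3 * k) := le_trans (Nat.le_mul_of_pos_left k hk) h2
  have h0 : 1 ≤ k ^ (3 * k) := Nat.one_le_pow _ _ hk
  have hM : (k * lg) ^ k ≤ 4 * (k ^ (3 * k) * n) :=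
    calc (k * lg) ^ k = k ^ k * lg ^ k := mul_pow _ _ _
      _ ≤ k ^ k * (k ^ k * 2 ^ (lg + k)) := Nat.mul_le_mul_left _ (pow_le_pow_mul_two_pow lg k)
      _ = k ^ k * k ^ k * (2 ^ lg * 2 ^ k) := by rw [pow_add, mul_assoc]
      _ ≤ k ^ k * k ^ k * (2 * n * (2 * k ^ k)) :=
        Nat.mul_le_mul_left _ (Nat.mul_le_mul hlg (two_pow_le_two_mul_pow hk))
      _ = 4 * (k ^ (3 * k) * n) := by ring
  have hlg' : lg ≤ 2 * n := Nat.lt_two_pow_self.le.trans hlg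
  have a1 : n ≤ k ^ (3 * k) * n := Nat.le_mul_of_pos_left n h0
  have a2 : k ≤ k ^ (3 * k) * n := h1.trans (Nat.le_mul_of_pos_right _ hn)
  have a3 : k * lg ≤ 2 * (k ^ (3 * k) * n) :=
    calc k * lg ≤ k ^ (3 * k) * (2 * n) := Nat.mul_le_mul h1 hlg'
      _ = _ := by ring
  have a4 : k * (k * (n + 1)) ≤ 2 * (k ^ (3 * k) * n) :=
    calc k * (k * (n + 1)) = k * k * (n + 1) := by ring
      _ ≤ k ^ (3 * k) * (2 * n) := Nat.mul_le_mul h2 (by omega)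
      _ = _ := by ring
  omega

/-- The form `k^O(k) * n^O(1)` is stable under powers; a single constant is chosen that is large
enough for the coefficient and for both exponents. -/
theorem le_fpt_bound {c n k B : ℕ} (hk : 0 < k) (hn : 0 < n)
    (hB : B + 1 ≤ 12 * (k ^ (3 * k) * n)) : 1 + c * (B + 1) ^ c ≤
      (1 + c * 12 ^ c + 3 * c) * k ^ ((1 + c * 12 ^ c + 3 * c) * k) *
        n ^ (1 + c * 12 ^ c + 3 * c) := by
  set K := 1 + c * 12 ^ c + 3 * c with hK
  have h1 : (B + 1) ^ c ≤ 12 ^ c * (k ^ (3 * c * k) * n ^ c) :=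
    (Nat.pow_le_pow_left hB c).trans_eq (by rw [mul_pow, mul_pow, ← pow_mul]; ring_nf)
  have h2 : k ^ (3 * c * k) ≤ k ^ (K * k) :=
    Nat.pow_le_pow_right hk (Nat.mul_le_mul_right k (by omega))
  have hcc : c ≤ K := by omega
  have h3 : n ^ c ≤ n ^ K := Nat.pow_le_pow_right hn hcc
  have h4 : k ^ (3 * c * k) * n ^ c ≤ k ^ (K * k) * n ^ K := Nat.mul_le_mul h2 h3
  have h5 : 1 ≤ k ^ (K * k) * n ^ K := Nat.mul_pos (pow_pos hk _) (pow_pos hn _)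
  have h6 : c * (B + 1) ^ c ≤ c * 12 ^ c * (k ^ (K * k) * n ^ K) := by
    rw [mul_assoc]
    exact Nat.mul_le_mul_left c (h1.trans (Nat.mul_le_mul_left _ h4))
  have h7 : (1 + c * 12 ^ c) * (k ^ (K * k) * n ^ K) ≤ K * (k ^ (K * k) * n ^ K) :=
    Nat.mul_le_mul_right _ (by omega)
  rw [mul_assoc]
  rw [add_mul] at h7
  omega

namespace Instance

theorem n_pos (I : Instance) : 0 < I.n := by
  obtain ⟨f, -⟩ := I.L_nonempty
  exact f.pos

/-- The algorithm that is based on the subroutine `chk`, as a machine program. -/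
def program (chk : Cmd) : Prog := .seq (.const 4 1) (Cmd.whole chk).compile

/-- The constant depends on the subroutine alone, while `Good` and `Out` may depend on the instance
and its data. `Decides` is required for all `m`, since the number of greedy steps is computed at run
time. -/
theorem program_spec (chk : Cmd) (hwf : chk.wellFormed [0, 1, 4, 7, 8, 9] = true) :
    ∃ c, ∀ (I : Instance) (w : ℕ) (a b : ℕ → ℕ) (Good : I.CenterSet → ℝ≥0 → Prop)
      (Out : I.CenterSet → ℝ≥0 → (ℕ → ℕ) → Prop), (∀ m, I.Decides w a b m Good Out chk) →
      ∃ (t : ℕ) (s : Store) (m : ℕ), Exec I.table (program chk) (I.start w a b) t s ∧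
        t ≤ c * I.k ^ (c * I.k) * I.n ^ c ∧ 0 < m ∧ I.Valid Out s ∧
        ∀ u < I.n, ∀ v < I.n, ∀ τ, I.Target m Good u v τ → I.Reached τ s := by
  obtain ⟨c, hc⟩ := Cmd.exists_cost_le (Cmd.whole chk)
  refine ⟨1 + c * 12 ^ c + 3 * c, fun I w a b Good Out hd => ?_⟩
  set D := I.table with hD
  set s₀ := (I.start w a b).setVar 4 1 with hs₀
  have z0 : s₀.var 0 = I.n := rfl
  have z1 : s₀.var 1 = I.k := rfl
  have z4 : s₀.var 4 = 1 := rfl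
  obtain ⟨lg, hlg, hlg', e7, e9⟩ := Cmd.initSteps_spec (D := D) z4 (z0 ▸ I.n_pos)
  rw [z1] at e7 e9
  rw [z0] at hlg hlg' e9
  set s₁ := Cmd.initSteps.eval D s₀ with hs₁
  have v1 : ∀ x ∈ [0, 1, 2, 3, 4, 5], s₁.var x = s₀.var x := fun x hx =>
    Cmd.eval_var (by revert x; decide)
  set s₂ := Cmd.initTuples.eval D s₁ with hs₂
  have v2 : ∀ x ∈ [0, 1, 2, 3, 4, 5, 7, 9], s₂.var x = s₁.var x := fun x hx =>
    Cmd.eval_var (by revert x; decide)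
  have e8 : s₂.var 8 = (I.k * lg) ^ I.k := by
    rw [hs₂, Cmd.initTuples_spec, e7, v1 1 (by decide), z1]
  have ar : ∀ A, s₂.arr A = s₀.arr A := fun A => (Cmd.eval_arr rfl).trans (Cmd.eval_arr rfl)
  have w0 : s₂.var 0 = I.n := ((v2 0 (by decide)).trans (v1 0 (by decide))).trans z0
  have w1 : s₂.var 1 = I.k := ((v2 1 (by decide)).trans (v1 1 (by decide))).trans z1
  have w4 : s₂.var 4 = 1 := ((v2 4 (by decide)).trans (v1 4 (by decide))).trans z4
  have w7 : s₂.var 7 = I.k * lg := (v2 7 (by decide)).trans e7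
  have w9 : s₂.var 9 = I.k * (I.k * (I.n + 1)) := (v2 9 (by decide)).trans e9
  have hIn : I.Inputs w a b (I.k * lg) s₂ :=
    ⟨w0, w1, (v2 2 (by decide)).trans (v1 2 (by decide)), w4,
      (v2 5 (by decide)).trans (v1 5 (by decide)), w7, e8, w9, ar 0, ar 1, ar 2, ar 3, ar 6⟩
  have hval : I.Valid Out s₂ := .inl ((v2 3 (by decide)).trans (v1 3 (by decide)))
  have himp := searchAll_improves (hd _) hIn hval hlg rfl
  have hmpos : 0 < I.k * lg := by
    refine Nat.mul_pos I.k_pos (Nat.pos_of_ne_zero ?_)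
    rintro rfl
    have := I.n_pos
    simp at hlg
    omega
  set B := I.n + I.k + I.k * lg + (I.k * lg) ^ I.k + I.k * (I.k * (I.n + 1)) + 1 with hB
  -- `exec_compile` needs loop bounds that are never written. The initializations compute the
  -- variables `7`, `8`, `9`, so the three stages are executed separately, each with its own list of
  -- protected variables.
  obtain ⟨t₁, x₁, c₁⟩ := Cmd.exec_compile (D := D) (V := [0, 1, 4]) (by decide) (B := B)
    Cmd.initSteps s₀ rfl z4 (by simp only [List.mem_cons, List.not_mem_nil, or_false,
      forall_eq_or_imp, forall_eq, z0, z1, z4]; omega)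
  obtain ⟨t₂, x₂, c₂⟩ := Cmd.exec_compile (D := D) (V := [1, 4, 7]) (by decide) (B := B)
    Cmd.initTuples s₁ rfl ((v1 4 (by decide)).trans z4)
    (by simp only [List.mem_cons, List.not_mem_nil, or_false,
      forall_eq_or_imp, forall_eq, v1 1 (by decide), v1 4 (by decide), z1, z4, e7]; omega)
  obtain ⟨t₃, x₃, c₃⟩ := Cmd.exec_compile (D := D) (V := [0, 1, 4, 7, 8, 9]) (by decide) (B := B)
    (Cmd.searchAll chk) s₂ (by
      simp [Cmd.searchAll, Cmd.tryTuples, Cmd.tryRadii, Cmd.tryRadius, Cmd.update, Cmd.decode,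
        Cmd.divide, Cmd.greedy, Cmd.initUncovered, Cmd.bestFacility, Cmd.countNear,
        Cmd.markCovered, Cmd.wellFormed, Cmd.writesVar, hwf, (hd 0).writesVar]) w4
    (by simp only [List.mem_cons, List.not_mem_nil, or_false,
      forall_eq_or_imp, forall_eq, w0, w1, w4, w7, e8, w9]; omega)
  refine ⟨1 + (t₁ + (t₂ + t₃)), _, I.k * lg, .seq (.const _ 4 1) (.seq x₁ (.seq x₂ x₃)), ?_, hmpos,
    himp.1.2, fun u hu v hv τ hτ => himp.2.2 τ ⟨u, hu, v, hv, hτ⟩⟩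
  have hcost := hc B
  simp only [Cmd.whole, Cmd.cost] at hcost
  refine le_trans (b := 1 + c * (B + 1) ^ c) (by omega) (le_fpt_bound (c := c) I.k_pos I.n_pos
    (sum_loopBounds_le I.k_pos I.n_pos hlg'))

end Instance

/-! ### The fault-tolerant check -/

namespace Cmd

/-- Set variable `40` to one if every client has sufficiently many of the centers in array `9`
nearby, and to zero otherwise; the required numbers are in array `2`. -/
def faultTolerantCheck : Cmd :=
  const 40 1 ;; loop 44 0 (load 50 0 44 ;; ite (.le 4 50)
    (const 46 0 ;; loop 43 1 (load 53 9 43 ;; ite (.distLe 44 53 14 15) (add 46 46 4) skip) ;;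
      load 55 2 44 ;; ite (.le 55 46) skip (const 40 0)) skip)

theorem eval_faultTolerantCheck {D : ℕ → ℕ → ℝ≥0} {s : Store} (h4 : s.var 4 = 1) :
    (eval D faultTolerantCheck s).var 40 = keepIf (∀ x < s.var 0, 1 ≤ s.arr 0 x →
      s.arr 2 x ≤ ((Finset.range (s.var 1)).filter fun j =>
        D x (s.arr 9 j) ≤ D (s.var 14) (s.var 15)).card) 1 := by
  rw [faultTolerantCheck, eval_seq, check_loop (fun x => 1 ≤ s.arr 0 x →
      s.arr 2 x ≤ ((Finset.range (s.var 1)).filter fun j =>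
        D x (s.arr 9 j) ≤ D (s.var 14) (s.var 15)).card) (by decide)]
  · simp
  intro x hx σ ha hi
  have a : ∀ A, σ.arr A = s.arr A := fun A => ha.2 A (by rfl)
  have v : ∀ y ∈ [1, 4, 14, 15], σ.var y = s.var y := fun y hy =>
    (ha.1 y (by revert y; decide)).trans (eval_var (by revert y; decide))
  have v4 : σ.var 4 = 1 := (v 4 (by decide)).trans h4
  by_cases hc : 1 ≤ s.arr 0 x
  swap
  · rw [keepIf_pos fun h => absurd h hc]
    simp [hi, a, v4, hc]
  set τ := (load 50 0 44 ;; const 46 0).eval D σ with hτ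
  set ω := (loop 43 1 (load 53 9 43 ;; ite (.distLe 44 53 14 15) (add 46 46 4) skip)).eval D τ
    with hω
  have t44 : τ.var 44 = x := by simp [hτ, hi]
  have tv : ∀ y, y ≠ 50 → y ≠ 46 → τ.var y = σ.var y := fun y h1 h2 => by simp [hτ, h1, h2]
  have ta : ∀ A, τ.arr A = s.arr A := fun A => by simp [hτ, a]
  have hcount : ω.var 46 = ((Finset.range (s.var 1)).filter fun j =>
      D x (s.arr 9 j) ≤ D (s.var 14) (s.var 15)).card := by
    rw [hω, count_loop (fun j => D x (s.arr 9 j) ≤ D (s.var 14) (s.var 15)) (by decide)]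
    · rw [tv 1 (by decide) (by decide), v 1 (by decide)]
      simp [hτ]
    · intro j hj σ' ha' hj'
      have e : ∀ y ∈ [4, 14, 15, 44], σ'.var y = τ.var y := fun y hy =>
        ha'.1 y (by revert y; decide)
      have e9 : σ'.arr 9 = s.arr 9 := (ha'.2 9 rfl).trans (ta 9)
      have e4 : σ'.var 4 = 1 := ((e 4 (by decide)).trans (tv 4 (by decide) (by decide))).trans v4
      have e14 : σ'.var 14 = s.var 14 :=
        ((e 14 (by decide)).trans (tv 14 (by decide) (by decide))).trans (v 14 (by decide))
      have e15 : σ'.var 15 = s.var 15 :=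
        ((e 15 (by decide)).trans (tv 15 (by decide) (by decide))).trans (v 15 (by decide))
      have e44 : σ'.var 44 = x := (e 44 (by decide)).trans t44
      simp only [eval_seq, eval_load, eval_ite_distLe, eval_add, eval_skip, Store.setVar_var,
        ↓reduceIte, Nat.reduceEqDiff, hj', e9, e4, e14, e15, e44]
      split_ifs <;> simp
  have w44 : ω.var 44 = x := (eval_var rfl).trans t44
  have w40 : ω.var 40 = σ.var 40 := (eval_var rfl).trans (tv 40 (by decide) (by decide))
  have w2 : ω.arr 2 = s.arr 2 := (eval_arr rfl).trans (ta 2)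
  have e : (eval D (load 50 0 44 ;; ite (.le 4 50)
      (const 46 0 ;; loop 43 1 (load 53 9 43 ;; ite (.distLe 44 53 14 15) (add 46 46 4) skip) ;;
      load 55 2 44 ;; ite (.le 55 46) skip (const 40 0)) skip) σ) =
      eval D (load 55 2 44 ;; ite (.le 55 46) skip (const 40 0)) ω := by
    simp only [eval_seq, eval_ite_le, hω, hτ]
    rw [if_pos]
    simp [hi, a, v4, hc]
  rw [e]
  simp only [eval_seq, eval_load, eval_ite_le, Store.setVar_var, ↓reduceIte, Nat.reduceEqDiff,
    hcount, w44, w2, eval_skip, eval_const]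
  split_ifs with h
  · rw [keepIf_pos fun _ => h]
    simp [w40]
  · rw [keepIf_neg fun h' => h (h' hc)]
    simp

end Cmd

/-! ### What the two subroutines decide about an instance -/

namespace Instance

variable {I : Instance}

theorem table_apply (x y : Fin I.n) : I.table x y = I.d x y := by simp [table]

theorem clientArr_apply (v : {x // x ∈ I.C} → ℕ) (x : {x // x ∈ I.C}) :
    I.clientArr v x.1 = v x := by
  unfold clientArr
  rw [dif_pos ⟨x.1.2, x.2⟩]

theorem listArr_apply {m : ℕ} (v : Fin m → ℕ) (i : Fin m) : listArr v i = v i := by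
  simp [listArr]

/-- Every client has as many centers as it demands within distance `τ`. -/
def Satisfies (I : Instance) (l : {x // x ∈ I.C} → ℕ) (F : I.CenterSet) (τ : ℝ≥0) : Prop :=
  ∀ x : {x // x ∈ I.C}, l x ≤ (Finset.univ.filter fun i : Fin I.k => I.d x.1 (F i).1 ≤ τ).card

/-- The centers alone are the solution here, so `Out` ignores the labels and coincides with `Good`.
-/
theorem decides_faultTolerantCheck (l : {x // x ∈ I.C} → ℕ) (w m : ℕ) (b : ℕ → ℕ) :
    I.Decides w (I.clientArr l) b m (I.Satisfies l) (fun F τ _ => I.Satisfies l F τ)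
      Cmd.faultTolerantCheck := by
  refine ⟨by decide, by decide, fun _ _ _ _ _ h => h, fun s F hs hF _ _ => ?_⟩
  intro τ s'
  have key := Cmd.eval_faultTolerantCheck (D := I.table) hs.one
  have hcard : ∀ x : Fin I.n, ((Finset.range (s.var 1)).filter fun j =>
      I.table x (s.arr 9 j) ≤ I.table (s.var 14) (s.var 15)).card =
      (Finset.univ.filter fun i : Fin I.k => I.d x (F i).1 ≤ τ).card := fun x => by
    rw [hs.hk]
    symm
    refine Finset.card_bij (fun i _ => (i : ℕ)) (fun i hi => ?_) (fun i _ j _ h => Fin.ext h)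
      fun j hj => ?_
    · have := (Finset.mem_filter.1 hi).2
      refine Finset.mem_filter.2 ⟨Finset.mem_range.2 i.2, ?_⟩
      rwa [hF i, table_apply]
    · obtain ⟨h1, h2⟩ := Finset.mem_filter.1 hj
      refine ⟨⟨j, Finset.mem_range.1 h1⟩, Finset.mem_filter.2 ⟨Finset.mem_univ _, ?_⟩, rfl⟩
      rw [← table_apply, ← hF]
      exact h2
  have hiff : (∀ x < s.var 0, 1 ≤ s.arr 0 x →
      s.arr 2 x ≤ ((Finset.range (s.var 1)).filter fun j =>
        I.table x (s.arr 9 j) ≤ I.table (s.var 14) (s.var 15)).card) ↔ I.Satisfies l F τ := by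
    refine ⟨fun h x => ?_, fun h x hx hxc => ?_⟩
    · have := h x.1 (x.1.2.trans_eq hs.hn.symm)
        (by rw [hs.hc]; exact one_le_clientArr.2 ⟨x.1.2, x.2⟩)
      rwa [hcard, hs.ha, clientArr_apply] at this
    · rw [hs.hc] at hxc
      obtain ⟨h1, h2⟩ := one_le_clientArr.1 hxc
      have := h ⟨⟨x, h1⟩, h2⟩
      rw [← hcard, ← clientArr_apply l, ← hs.ha] at this
      exact this
  by_cases hg : I.Satisfies l F τ
  · exact .inl ⟨key.trans (Cmd.keepIf_pos (hiff.2 hg) 1), hg⟩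
  · exact .inr ⟨key.trans (Cmd.keepIf_neg (fun h => hg (hiff.1 h)) 1), hg⟩

/-- The parameters of the assignment subroutine. -/
def groupData (I : Instance) (u v : ℕ) (F key : ℕ → ℕ) : GroupData where
  n := I.n
  k := I.k
  R := I.k * (I.k * (I.n + 1))
  u := u
  v := v
  g := 0
  c := I.clientArr fun _ => 1
  F := F
  key := key

theorem labelCount_groupData (u v g : ℕ) (F key o : ℕ → ℕ) (O : I.Clustering)
    (hO : ∀ x : {x // x ∈ I.C}, o x.1 = O x) (i : Fin I.k) :
    labelCount ((I.groupData u v F key).withKey g).X o i =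
      ((I.cluster O i).filter fun x => key x.1 = g).card := by
  symm
  refine Finset.card_bij (fun x _ => (x.1 : ℕ)) (fun x hx => ?_)
    (fun x _ y _ h => Subtype.ext (Fin.ext h)) fun x hx => ?_
  · simp only [cluster, Finset.mem_filter, Finset.mem_univ, true_and] at hx
    refine Finset.mem_filter.2 ⟨GroupData.mem_X.2 ⟨x.1.2, one_le_clientArr.2 ⟨x.1.2, x.2⟩, hx.2⟩, ?_⟩
    rw [hO, hx.1]
  · obtain ⟨h1, h2⟩ := Finset.mem_filter.1 hx
    obtain ⟨h3, h4, h5⟩ := GroupData.mem_X.1 h1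
    obtain ⟨h6, h7⟩ := one_le_clientArr.1 h4
    refine ⟨⟨⟨x, h6⟩, h7⟩, ?_, rfl⟩
    simp only [cluster, Finset.mem_filter, Finset.mem_univ, true_and]
    exact ⟨Fin.ext ((hO _).symm.trans h2), h5⟩

/-- There is a clustering with property `P` that assigns all clients to centers within distance
`τ`. -/
def Assignable (I : Instance) (P : I.Clustering → Prop) (F : I.CenterSet) (τ : ℝ≥0) : Prop :=
  ∃ O, P O ∧ ∀ x, I.d x.1 (F (O x)).1 ≤ τ

/-- The labels `o` are such a clustering. -/
def AssignedBy (I : Instance) (P : I.Clustering → Prop) (F : I.CenterSet) (τ : ℝ≥0)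
    (o : ℕ → ℕ) : Prop :=
  ∃ O : I.Clustering, (∀ x, o x.1 = O x) ∧ P O ∧ ∀ x, I.d x.1 (F (O x)).1 ≤ τ

/-- The keys are either the first input array, which holds colours or classes, or array `6`, which
is identically zero and puts all clients into one group. -/
theorem decides_assign {w m K : ℕ} {a b key : ℕ → ℕ} {lo hi : Bound} {P : I.Clustering → Prop}
    (hK : K = 2 ∧ key = a ∨ K = 6 ∧ key = fun _ => 0)
    (hP : ∀ O, P O ↔ ∀ y < I.n, ∀ i : Fin I.k,
      lo.val I.n a b (key y) i ≤ ((I.cluster O i).filter fun x => key x.1 = key y).card ∧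
      ((I.cluster O i).filter fun x => key x.1 = key y).card ≤ hi.val I.n a b (key y) i) :
    I.Decides w a b m (I.Assignable P) (I.AssignedBy P) (Cmd.assign K lo hi) := by
  refine ⟨fun x hx => ?_, fun A hA => ?_, ?_, fun s F hs hF _ _ => ?_⟩
  -- The write set is independent of `K` and the bounds, so it can be decided on a closed instance.
  · have : (Cmd.assign K lo hi).writesVar x = (Cmd.assign 0 (.const 0) (.const 0)).writesVar x := by
      cases lo <;> cases hi <;> rfl
    rw [this]
    clear this
    revert x
    decide
  · have : (Cmd.assign K lo hi).writesArr A = (Cmd.assign 0 (.const 0) (.const 0)).writesArr A := by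
      cases lo <;> cases hi <;> rfl
    rw [this]
    clear this
    revert A
    decide
  · rintro F τ o o' h ⟨O, h1, h2⟩
    exact ⟨O, fun x => (h x.1 x.1.2).symm.trans (h1 x), h2⟩
  intro τ s'
  have hkey : key = s.arr K := by
    rcases hK with ⟨rfl, rfl⟩ | ⟨rfl, rfl⟩
    · exact hs.ha.symm
    · exact hs.hz.symm
  set G := I.groupData (s.var 14) (s.var 15) (s.arr 9) key with hG
  have key_iff : ∀ (o : ℕ → ℕ) (O : I.Clustering), (∀ x : {x // x ∈ I.C}, o x.1 = O x) →
      ((G.Balanced (fun g i => lo.val G.n (s.arr 2) (s.arr 3) g i)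
        (fun g i => hi.val G.n (s.arr 2) (s.arr 3) g i) o ∧ G.AllAssigned I.table o) ↔
      (P O ∧ ∀ x, I.d x.1 (F (O x)).1 ≤ τ)) := fun o O hO => by
    refine and_congr ?_ ?_
    · rw [hP, hs.ha, hs.hb]
      refine forall_congr' fun y => imp_congr Iff.rfl ⟨fun h i => ?_, fun h i hi' => ?_⟩
      · have := h i i.2
        rwa [labelCount_groupData _ _ _ _ _ _ O hO i] at this
      · have := h ⟨i, hi'⟩
        rwa [← labelCount_groupData (s.var 14) (s.var 15) _ (s.arr 9) key o O hO ⟨i, hi'⟩] at this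
    · refine ⟨fun h x => ?_, fun h x hx hxc => ?_⟩
      · have := (h x.1 x.1.2 (one_le_clientArr.2 ⟨x.1.2, x.2⟩)).2
        rw [hO x] at this
        have h' : I.table x.1 (s.arr 9 (O x)) ≤ τ := this
        rwa [hF, table_apply] at h'
      · obtain ⟨h1, h2⟩ := one_le_clientArr.1 hxc
        have hOx := hO ⟨⟨x, h1⟩, h2⟩
        have := h ⟨⟨x, h1⟩, h2⟩
        rw [← table_apply, ← hF, ← hOx] at this
        exact ⟨hOx.trans_lt (O _).2, this⟩
  rcases Cmd.assign_spec (D := I.table) (G := G) (s := s) (K := K) (lo := lo) (hi := hi)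
    (by omega) hkey ⟨hs.hn, hs.hk, hs.one, hs.zero, hs.hR, rfl, rfl, hs.hc, rfl, rfl⟩ le_rfl I.k_pos
    with ⟨h40, hbal⟩ | ⟨h40, hno⟩
  · have hlt : ∀ x : {x // x ∈ I.C}, s'.arr 10 x.1 < I.k := fun x =>
      (hbal.2 x.1 x.1.2 (one_le_clientArr.2 ⟨x.1.2, x.2⟩)).1
    exact .inl ⟨h40, fun x => ⟨_, hlt x⟩, fun x => rfl,
      (key_iff _ (fun x => ⟨_, hlt x⟩) fun x => rfl).1 hbal⟩
  · refine .inr ⟨h40, ?_⟩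
    rintro ⟨O, hO⟩
    exact hno (I.clientArr fun x => O x)
      ((key_iff _ O fun x => clientArr_apply _ x).2 hO)

end Instance

/-! ### Replacing optimal centers by covering facilities: the factors three and two -/

namespace Instance

variable {I : Instance}

theorem d_self (x : Fin I.n) : I.d x x = 0 := by
  let := I.metric
  exact nndist_self x

theorem d_comm (x y : Fin I.n) : I.d x y = I.d y x := by
  let := I.metric
  exact nndist_comm x y

theorem d_triangle (x y w : Fin I.n) : I.d x w ≤ I.d x y + I.d y w := by
  let := I.metric
  exact nndist_triangle x y w

/-- The largest distance between two points that is at most `r`. -/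
theorem exists_max_d_le (I : Instance) (r : ℝ≥0) :
    ∃ u v : Fin I.n, I.d u v ≤ r ∧ ∀ x y, I.d x y ≤ r → I.d x y ≤ I.d u v := by
  obtain ⟨f, -⟩ := I.L_nonempty
  obtain ⟨p, hp, hmax⟩ := Finset.exists_max_image
    (Finset.univ.filter fun p : Fin I.n × Fin I.n => I.d p.1 p.2 ≤ r) (fun p => I.d p.1 p.2)
    ⟨(f, f), by simp [d_self]⟩
  exact ⟨p.1, p.2, (Finset.mem_filter.1 hp).2, fun x y h => hmax (x, y) (by simpa using h)⟩

/-- `hgood` says that goodness survives any change of centers and radius that keeps every client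
near the labels it was near. This lets the centers be replaced one by one, each by a listed
facility. -/
theorem target_of_forall {m : ℕ} {Good : I.CenterSet → ℝ≥0 → Prop} {F' : I.CenterSet}
    {u v : Fin I.n} {τ : ℝ≥0} (hcov : ∀ x ∈ I.C, ∃ i, I.d x (F' i).1 ≤ I.d u v)
    (hgood : ∀ F τ, (∀ x ∈ I.C, ∀ i, I.d x (F' i).1 ≤ I.d u v → I.d x (F i).1 ≤ τ) → Good F τ)
    (hnear : ∀ S : ℕ → ℕ, (∀ t < m, ∃ h : S t < I.n, (⟨S t, h⟩ : Fin I.n) ∈ I.L) →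
      (∀ x ∈ I.C, ∃ t < m, I.table x (S t) ≤ I.d u v) → ∀ i, ∃ t < m,
        ∀ x ∈ I.C, I.d x (F' i).1 ≤ I.d u v → I.table x (S t) ≤ τ) :
    I.Target m Good u v τ := by
  rintro S ⟨hS, hcovS⟩
  choose hSn hSL using hS
  choose t htm ht using hnear S (fun t ht => ⟨hSn t ht, hSL t ht⟩) fun x hx => by
    rw [← table_apply]
    refine hcovS ⟨fun i => if h : i < I.k then (F' ⟨i, h⟩).1 else 0, fun i hi => ?_,
      fun x hx hxc => ?_⟩ x hx
    · have hi : i < I.k := hi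
      simp only [hi, dite_true]
      exact ⟨(F' ⟨i, hi⟩).1.2, one_le_listArr.2 ⟨(F' ⟨i, hi⟩).1.2, (F' ⟨i, hi⟩).2⟩⟩
    · obtain ⟨h1, h2⟩ := one_le_clientArr.1 hxc
      obtain ⟨i, hi⟩ := hcov _ h2
      refine ⟨i, i.2, ?_⟩
      simp only [i.2, dite_true]
      rwa [← table_apply, ← table_apply] at hi
  set F : I.CenterSet := fun i => ⟨⟨S (t i), hSn _ (htm i)⟩, hSL _ (htm i)⟩ with hF
  -- `τ` need not be a distance; the largest distance below it admits the same pairs of points and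
  -- is among the radii that are tried.
  obtain ⟨u', v', hle, hmax⟩ := I.exists_max_d_le τ
  refine ⟨F, fun i => ⟨t i, htm i, rfl⟩, u', u'.2, v', v'.2, ?_, by rwa [table_apply]⟩
  refine hgood F _ fun x hx i hi => ?_
  rw [table_apply]
  refine hmax _ _ ?_
  rw [← table_apply]
  exact ht i x hx hi

/-- A client reaches the new center through the old one and another client near the old one: three
legs of length at most `d u v`. -/
theorem target_three {m : ℕ} (hm : 0 < m) {Good : I.CenterSet → ℝ≥0 → Prop} {F' : I.CenterSet}
    {u v : Fin I.n} (hcov : ∀ x ∈ I.C, ∃ i, I.d x (F' i).1 ≤ I.d u v)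
    (hgood : ∀ F τ, (∀ x ∈ I.C, ∀ i, I.d x (F' i).1 ≤ I.d u v → I.d x (F i).1 ≤ τ) →
      Good F τ) :
    I.Target m Good u v (3 * I.d u v) := by
  refine target_of_forall hcov hgood fun S hS hcovS i => ?_
  by_cases h : ∃ y ∈ I.C, I.d y (F' i).1 ≤ I.d u v
  · obtain ⟨y, hy, hyi⟩ := h
    obtain ⟨t, htm, ht⟩ := hcovS y hy
    obtain ⟨hSn, -⟩ := hS t htm
    refine ⟨t, htm, fun x hx hxi => ?_⟩
    have e : ∀ x : Fin I.n, I.table x (S t) = I.d x ⟨S t, hSn⟩ := fun x =>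
      table_apply x ⟨S t, hSn⟩
    rw [e] at ht ⊢
    calc I.d x ⟨S t, hSn⟩ ≤ I.d x (F' i).1 + I.d (F' i).1 ⟨S t, hSn⟩ := d_triangle _ _ _
      _ ≤ I.d x (F' i).1 + (I.d y (F' i).1 + I.d y ⟨S t, hSn⟩) := by
        rw [d_comm y (F' i).1]
        gcongr
        exact d_triangle _ _ _
      _ ≤ I.d u v + (I.d u v + I.d u v) := by gcongr
      _ = 3 * I.d u v := by ring
  -- No client is near this center, so any listed facility may replace it; `0 < m` supplies one.
  · exact ⟨0, hm, fun x hx hxi => absurd ⟨x, hx, hxi⟩ h⟩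

/-- The old center is itself a client and hence covered directly, which saves the leg through
another client. -/
theorem target_two {m : ℕ} {Good : I.CenterSet → ℝ≥0 → Prop} {F' : I.CenterSet}
    {u v : Fin I.n} (hLC : I.L = I.C) (hcov : ∀ x ∈ I.C, ∃ i, I.d x (F' i).1 ≤ I.d u v)
    (hgood : ∀ F τ, (∀ x ∈ I.C, ∀ i, I.d x (F' i).1 ≤ I.d u v → I.d x (F i).1 ≤ τ) →
      Good F τ) :
    I.Target m Good u v (2 * I.d u v) := by
  refine target_of_forall hcov hgood fun S hS hcovS i => ?_
  obtain ⟨t, htm, ht⟩ := hcovS (F' i).1 (hLC ▸ (F' i).2)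
  obtain ⟨hSn, -⟩ := hS t htm
  refine ⟨t, htm, fun x hx hxi => ?_⟩
  have e : ∀ x : Fin I.n, I.table x (S t) = I.d x ⟨S t, hSn⟩ := fun x =>
    table_apply x ⟨S t, hSn⟩
  rw [e] at ht ⊢
  calc I.d x ⟨S t, hSn⟩ ≤ I.d x (F' i).1 + I.d (F' i).1 ⟨S t, hSn⟩ := d_triangle _ _ _
    _ ≤ I.d u v + I.d u v := by gcongr
    _ = 2 * I.d u v := by ring

/-! ### Costs and radii -/

/-- The center with the label of the cluster is one candidate in the minimum. -/
theorem psi_le {z : ℝ} (hz : 0 < z) {F : I.CenterSet} {O : I.Clustering} {τ : ℝ≥0}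
    (h : ∀ x, I.d x.1 (F (O x)).1 ≤ τ) : I.psi z F O ≤ τ ^ z := by
  refine Finset.sup_le fun i _ => (ciInf_le (OrderBot.bddBelow _) i).trans
    (Finset.sup_le fun x hx => NNReal.rpow_le_rpow ?_ hz.le)
  have := h x
  rwa [(Finset.mem_filter.1 hx).2] at this

/-- Each cluster picks its best center from `F`. As repetitions are allowed, the picks form a
center-set again, now indexed by the labels of the clusters they serve. -/
theorem exists_le_psi_rpow {z : ℝ} (hz : 0 < z) (F : I.CenterSet) (O : I.Clustering) :
    ∃ F' : I.CenterSet, ∀ x, I.d x.1 (F' (O x)).1 ≤ I.psi z F O ^ z⁻¹ := by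
  have : Nonempty (Fin I.k) := ⟨⟨0, I.k_pos⟩⟩
  choose j hj using fun i : Fin I.k => exists_eq_ciInf_of_finite
    (f := fun j : Fin I.k => (I.cluster O i).sup fun x => I.d x.1 (F j).1 ^ z)
  refine ⟨fun i => F (j i), fun x => (NNReal.le_rpow_inv_iff hz).2 ?_⟩
  calc I.d x.1 (F (j (O x))).1 ^ z
      ≤ (I.cluster O (O x)).sup fun y => I.d y.1 (F (j (O x))).1 ^ z :=
        Finset.le_sup (f := fun y : {x // x ∈ I.C} => I.d y.1 (F (j (O x))).1 ^ z)
          (by simp [cluster])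
    _ = ⨅ j : Fin I.k, (I.cluster O (O x)).sup fun y => I.d y.1 (F j).1 ^ z := hj (O x)
    _ ≤ I.psi z F O := Finset.le_sup (f := fun i : Fin I.k =>
      ⨅ j : Fin I.k, (I.cluster O i).sup fun x => I.d x.1 (F j).1 ^ z) (Finset.mem_univ _)

theorem exists_psi_eq_psiStar (z : ℝ) (O : I.Clustering) : ∃ F, I.psi z F O = I.psiStar z O := by
  obtain ⟨f, hf⟩ := I.L_nonempty
  have : Nonempty I.CenterSet := ⟨fun _ => ⟨f, hf⟩⟩
  exact exists_eq_ciInf_of_finite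

/-- The infimum is attained because the count jumps only at the finitely many distances from `x` to
the centers. If the count were too small at the infimum `s`, all radii in the set would be at least
the smallest distance exceeding `s`. -/
theorem le_card_lthDist (F : I.CenterSet) (x : Fin I.n) {l : ℕ} (hl : l ≤ I.k) :
    l ≤ (Finset.univ.filter fun i : Fin I.k => I.d x (F i).1 ≤ I.lthDist F x l).card := by
  by_contra! hlt
  set s := I.lthDist F x l with hs
  have hex : ∀ ρ : ℝ≥0, l ≤ (Finset.univ.filter fun i : Fin I.k => I.d x (F i).1 ≤ ρ).card →
      ∃ i, s < I.d x (F i).1 ∧ I.d x (F i).1 ≤ ρ := fun ρ hρ => by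
    by_contra! h
    refine absurd (hρ.trans (Finset.card_le_card fun i hi => ?_)) (not_le.2 hlt)
    have hi := (Finset.mem_filter.1 hi).2
    refine Finset.mem_filter.2 ⟨Finset.mem_univ _, ?_⟩
    by_contra! hsi
    exact absurd hi (not_le.2 (h i hsi))
  -- By `l ≤ k` the largest distance belongs to the set, which is therefore nonempty; the infimum of
  -- the empty set would be the default `0`.
  have hne : l ≤ (Finset.univ.filter fun i : Fin I.k =>
      I.d x (F i).1 ≤ Finset.univ.sup fun i => I.d x (F i).1).card := by
    rw [Finset.filter_true_of_mem fun i _ =>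
      Finset.le_sup (f := fun i => I.d x (F i).1) (Finset.mem_univ i)]
    simpa using hl
  obtain ⟨i, hi, -⟩ := hex _ hne
  obtain ⟨i₀, hi₀, hmin⟩ := Finset.exists_min_image
    (Finset.univ.filter fun i : Fin I.k => s < I.d x (F i).1) (fun i => I.d x (F i).1)
    ⟨i, by simpa using hi⟩
  have : I.d x (F i₀).1 ≤ s := le_csInf ⟨_, hne⟩ fun ρ hρ => by
    obtain ⟨j, hj, hjρ⟩ := hex ρ hρ
    exact (hmin j (by simpa using hj)).trans hjρ
  exact absurd (Finset.mem_filter.1 hi₀).2 (not_lt.2 this)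

theorem Satisfies.mono {l : {x // x ∈ I.C} → ℕ} {F F' : I.CenterSet} {ρ τ : ℝ≥0}
    (h : I.Satisfies l F ρ)
    (hF : ∀ x ∈ I.C, ∀ i, I.d x (F i).1 ≤ ρ → I.d x (F' i).1 ≤ τ) : I.Satisfies l F' τ :=
  fun x => (h x).trans (Finset.card_le_card (Finset.monotone_filter_right _
    fun i _ hi => hF x.1 x.2 i hi))

theorem ftCost_le {l : {x // x ∈ I.C} → ℕ} {z : ℝ} (hz : 0 < z) {F : I.CenterSet} {τ : ℝ≥0}
    (h : I.Satisfies l F τ) : I.ftCost l z F ≤ τ ^ z :=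
  Finset.sup_le fun x _ => NNReal.rpow_le_rpow (csInf_le (OrderBot.bddBelow _) (h x)) hz.le

theorem satisfies_ftCost_rpow {l : {x // x ∈ I.C} → ℕ} (hl : ∀ x, l x ≤ I.k) {z : ℝ} (hz : 0 < z)
    (F : I.CenterSet) : I.Satisfies l F (I.ftCost l z F ^ z⁻¹) := fun x =>
  (le_card_lthDist F x.1 (hl x)).trans (Finset.card_le_card (Finset.monotone_filter_right _
    fun _ _ hi => hi.trans ((NNReal.le_rpow_inv_iff hz).2
      (Finset.le_sup (f := fun x : {x // x ∈ I.C} => I.lthDist F x.1 (l x) ^ z)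
        (Finset.mem_univ x)))))

theorem mul_rpow_le {z : ℝ} (hz : 0 < z) {q τ ρ A : ℝ≥0} (hτ : τ ≤ q * ρ) (hρ : ρ ≤ A ^ z⁻¹) :
    τ ^ z ≤ q ^ z * A :=
  calc τ ^ z ≤ (q * ρ) ^ z := NNReal.rpow_le_rpow hτ hz.le
    _ = q ^ z * ρ ^ z := NNReal.mul_rpow
    _ ≤ q ^ z * A := by
      gcongr
      exact (NNReal.le_rpow_inv_iff hz).1 hρ

end Instance

/-! ### The six problems -/

open Instance

/-- The radius `ρ` in `hbound` depends on `z` and `O'`, but the final store does not; this is how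
one output serves all exponents. -/
theorem ConstrainedProblem.hasFPTApprox_of_bounds (P : ConstrainedProblem) (K : ℕ) (lo hi : Bound)
    (hwf : (Cmd.assign K lo hi).wellFormed [0, 1, 4, 7, 8, 9] = true)
    (hP : ∀ (I : Instance) (D : P.Data I), ∃ key : ℕ → ℕ,
      (K = 2 ∧ key = P.arr₁ I D ∨ K = 6 ∧ key = fun _ => 0) ∧
      ∀ O, P.Feasible I D O ↔ ∀ y < I.n, ∀ i : Fin I.k,
        lo.val I.n (P.arr₁ I D) (P.arr₂ I D) (key y) i ≤
          ((I.cluster O i).filter fun x => key x.1 = key y).card ∧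
        ((I.cluster O i).filter fun x => key x.1 = key y).card ≤
          hi.val I.n (P.arr₁ I D) (P.arr₂ I D) (key y) i) :
    P.HasFPTApprox := by
  obtain ⟨c, hc⟩ := Instance.program_spec (Cmd.assign K lo hi) hwf
  refine ⟨Instance.program (Cmd.assign K lo hi), c, fun I D => ?_⟩
  obtain ⟨key, hkey, hfeas⟩ := hP I D
  obtain ⟨t, s, m, hexec, ht, hm, hvalid, hreach⟩ := hc I (P.num I D) _ _
    (I.Assignable (P.Feasible I D)) (I.AssignedBy (P.Feasible I D))
    fun m => decides_assign hkey hfeas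
  refine ⟨t, s, hexec, ht, ?_⟩
  have hbound : ∀ z : ℝ, 0 < z → ∀ O', P.Feasible I D O' → ∃ ρ ≤ I.psiStar z O' ^ z⁻¹,
      I.Reached (3 * ρ) s ∧ (I.L = I.C → I.Reached (2 * ρ) s) := fun z hz O' hO' => by
    obtain ⟨F₀, hF₀⟩ := exists_psi_eq_psiStar z O'
    obtain ⟨F', hF'⟩ := exists_le_psi_rpow hz F₀ O'
    rw [hF₀] at hF'
    -- Rounding down to a distance keeps all clients near their centers and yields a radius that the
    -- greedy search tries.
    obtain ⟨u, v, hle, hmax⟩ := I.exists_max_d_le (I.psiStar z O' ^ z⁻¹)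
    have hcov : ∀ x ∈ I.C, ∃ i, I.d x (F' i).1 ≤ I.d u v := fun x hx =>
      ⟨_, hmax _ _ (hF' ⟨x, hx⟩)⟩
    have hgood : ∀ F τ, (∀ x ∈ I.C, ∀ i, I.d x (F' i).1 ≤ I.d u v → I.d x (F i).1 ≤ τ) →
        I.Assignable (P.Feasible I D) F τ := fun F τ h =>
      ⟨O', hO', fun x => h x.1 x.2 _ (hmax _ _ (hF' x))⟩
    exact ⟨_, hle, hreach u u.2 v v.2 _ (target_three hm hcov hgood), fun hLC =>
      hreach u u.2 v v.2 _ (target_two hLC hcov hgood)⟩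
  rcases hvalid with h3 | ⟨h3, F, hF, O, hO, hfO, hd⟩
  · refine .inl ⟨h3, fun O' hO' => ?_⟩
    -- Any exponent would do: a feasible clustering forces a recorded solution.
    obtain ⟨ρ, -, hr, -⟩ := hbound 1 one_pos O' hO'
    exact absurd (h3.symm.trans hr.1) (by decide)
  · refine .inr ⟨h3, F, O, hF, hO, hfO, fun z hz O' hO' => ?_⟩
    obtain ⟨ρ, hρ, hr, hr'⟩ := hbound z hz O' hO'
    exact ⟨(psi_le hz hd).trans (mul_rpow_le hz hr.2 hρ), fun hLC =>
      (psi_le hz hd).trans (mul_rpow_le hz (hr' hLC).2 hρ)⟩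

/-- By `1 ≤ l x` every client has a center within the radius of `F'`, so `F'` yields a cover; by `l
x ≤ k` the distances `lthDist` are attained. Every center-set is a solution, so an empty record is
impossible. -/
theorem faultTolerantHasFPTApprox : FaultTolerantHasFPTApprox := by
  obtain ⟨c, hc⟩ := Instance.program_spec Cmd.faultTolerantCheck (by decide)
  refine ⟨Instance.program Cmd.faultTolerantCheck, c, fun I l hl => ?_⟩
  obtain ⟨t, s, m, hexec, ht, hm, hvalid, hreach⟩ := hc I 0 (I.clientArr l) (fun _ => 0)
    (I.Satisfies l) (fun F τ _ => I.Satisfies l F τ)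
    fun m => decides_faultTolerantCheck l 0 m _
  refine ⟨t, s, hexec, ht, ?_⟩
  have hbound : ∀ z : ℝ, 0 < z → ∀ F', ∃ ρ ≤ I.ftCost l z F' ^ z⁻¹,
      I.Reached (3 * ρ) s ∧ (I.L = I.C → I.Reached (2 * ρ) s) := fun z hz F' => by
    obtain ⟨u, v, hle, hmax⟩ := I.exists_max_d_le (I.ftCost l z F' ^ z⁻¹)
    have hsat : I.Satisfies l F' (I.d u v) :=
      (satisfies_ftCost_rpow (fun x => (hl x).2) hz F').mono fun x _ i hi => hmax _ _ hi
    have hcov : ∀ x ∈ I.C, ∃ i, I.d x (F' i).1 ≤ I.d u v := fun x hx => by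
      obtain ⟨i, hi⟩ := Finset.card_pos.1 ((hl ⟨x, hx⟩).1.trans (hsat ⟨x, hx⟩))
      exact ⟨i, (Finset.mem_filter.1 hi).2⟩
    have hgood : ∀ F τ, (∀ x ∈ I.C, ∀ i, I.d x (F' i).1 ≤ I.d u v → I.d x (F i).1 ≤ τ) →
        I.Satisfies l F τ := fun F τ h => hsat.mono h
    exact ⟨_, hle, hreach u u.2 v v.2 _ (target_three hm hcov hgood), fun hLC =>
      hreach u u.2 v v.2 _ (target_two hLC hcov hgood)⟩
  rcases hvalid with h3 | ⟨h3, F, hF, hsat⟩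
  · obtain ⟨f, hf⟩ := I.L_nonempty
    obtain ⟨ρ, -, hr, -⟩ := hbound 1 one_pos fun _ => ⟨f, hf⟩
    exact absurd (h3.symm.trans hr.1) (by decide)
  · refine ⟨F, hF, fun z hz F' => ?_⟩
    obtain ⟨ρ, hρ, hr, hr'⟩ := hbound z hz F'
    exact ⟨(ftCost_le hz hsat).trans (mul_rpow_le hz hr.2 hρ), fun hLC =>
      (ftCost_le hz hsat).trans (mul_rpow_le hz (hr' hLC).2 hρ)⟩

theorem Instance.card_cluster_le {I : Instance} (O : I.Clustering) (i : Fin I.k) :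
    (I.cluster O i).card ≤ I.n :=
  (Finset.card_le_univ _).trans (by
    rw [Fintype.card_coe]
    exact (Finset.card_le_univ _).trans (by simp))

/-- A single group; the upper bound `n` is vacuous. -/
theorem rGather_hasFPTApprox : rGather.HasFPTApprox := by
  refine rGather.hasFPTApprox_of_bounds 6 .labelA .numPoints (by decide) fun I r =>
    ⟨_, .inr ⟨rfl, rfl⟩, fun O => ?_⟩
  simp only [Finset.filter_true, Bound.val, card_cluster_le, and_true]
  exact ⟨fun h y _ i => (listArr_apply r i).trans_le (h i), fun h i =>
    (listArr_apply r i).symm.trans_le (h 0 I.n_pos i)⟩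

theorem rCapacity_hasFPTApprox : rCapacity.HasFPTApprox := by
  refine rCapacity.hasFPTApprox_of_bounds 6 (.const 0) .labelA (by decide) fun I r =>
    ⟨_, .inr ⟨rfl, rfl⟩, fun O => ?_⟩
  simp only [Finset.filter_true, Bound.val, Nat.zero_le, true_and]
  exact ⟨fun h y _ i => (h i).trans_eq (listArr_apply r i).symm, fun h i =>
    (h 0 I.n_pos i).trans_eq (listArr_apply r i)⟩

theorem balanced_hasFPTApprox : balanced.HasFPTApprox := by
  refine balanced.hasFPTApprox_of_bounds 6 .labelA .labelB (by decide) fun I D =>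
    ⟨_, .inr ⟨rfl, rfl⟩, fun O => ?_⟩
  simp only [Finset.filter_true, Bound.val]
  exact ⟨fun h y _ i => ⟨(listArr_apply D.1 i).trans_le (h i).1,
    (h i).2.trans_eq (listArr_apply D.2 i).symm⟩, fun h i =>
    ⟨(listArr_apply D.1 i).symm.trans_le (h 0 I.n_pos i).1,
      (h 0 I.n_pos i).2.trans_eq (listArr_apply D.2 i)⟩⟩

/-- The groups are the colour classes, with at most one client per label. Points outside `C` have
key `0`, and the bound for colour `0` that this adds holds in every feasible clustering. -/
theorem chromatic_hasFPTApprox : chromatic.HasFPTApprox := by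
  refine chromatic.hasFPTApprox_of_bounds 2 (.const 0) (.const 1) (by decide) fun I col =>
    ⟨_, .inl ⟨rfl, rfl⟩, fun O => ?_⟩
  simp only [Bound.val, Nat.zero_le, true_and, Finset.card_le_one, Finset.mem_filter]
  refine ⟨fun h y _ i x hx x' hx' => h i x hx.1 x' hx'.1 ?_, fun h i x hx x' hx' e =>
    h x.1 x.1.2 i x ⟨hx, rfl⟩ x' ⟨hx', ?_⟩⟩
  · rw [← clientArr_apply col x, ← clientArr_apply col x']
    exact hx.2.trans hx'.2.symm
  · exact (clientArr_apply col x').trans (e.symm.trans (clientArr_apply col x).symm)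

/-- The groups are the classes. Surjectivity of `cls` makes each class the key of some client, so
that ranging over the points checks all classes. -/
theorem stronglyPrivate_hasFPTApprox : stronglyPrivate.HasFPTApprox := by
  refine stronglyPrivate.hasFPTApprox_of_bounds 2 .groupB .numPoints (by decide) fun I D =>
    ⟨_, .inl ⟨rfl, rfl⟩, fun O => ?_⟩
  have hcount : ∀ (y : ℕ) (j : Fin D.ω), (j : ℕ) = I.clientArr (fun x => (D.cls x : ℕ)) y →
      ∀ i, ((I.cluster O i).filter fun x => I.clientArr (fun x => (D.cls x : ℕ)) x.1 =
        I.clientArr (fun x => (D.cls x : ℕ)) y) =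
      (I.cluster O i).filter fun x => D.cls x = j := fun y j hj i => by
    refine Finset.filter_congr fun x _ => ?_
    rw [← hj, clientArr_apply, Fin.ext_iff]
  simp only [Bound.val]
  refine ⟨fun h y _ i => ⟨?_, (Finset.card_filter_le _ _).trans (card_cluster_le O i)⟩,
    fun h i j => ?_⟩
  · by_cases hy : I.clientArr (fun x => (D.cls x : ℕ)) y < D.ω
    · exact (listArr_apply D.l ⟨_, hy⟩).trans_le
        ((h i ⟨_, hy⟩).trans_eq (congrArg Finset.card (hcount y ⟨_, hy⟩ rfl i).symm))
    -- Only possible for `ω = 0`: the default key `0` of a point outside `C` is then out of range,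
    -- and the bound read for it is the default `0`.
    · exact (dif_neg hy).trans_le (Nat.zero_le _)
  · obtain ⟨x, rfl⟩ := D.cls_surjective j
    have hx : (D.cls x : ℕ) = I.clientArr (fun x => (D.cls x : ℕ)) x.1 :=
      (clientArr_apply (fun x => (D.cls x : ℕ)) x).symm
    exact ((listArr_apply D.l (D.cls x)).symm.trans (congrArg (listArr D.l) hx)).trans_le
      ((h x.1 x.1.2 i).1.trans_eq (congrArg Finset.card (hcount x.1 (D.cls x) hx i)))

theorem theorem1 :
    rGather.HasFPTApprox ∧ rCapacity.HasFPTApprox ∧ balanced.HasFPTApprox ∧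
    chromatic.HasFPTApprox ∧ FaultTolerantHasFPTApprox ∧ stronglyPrivate.HasFPTApprox :=
  ⟨rGather_hasFPTApprox, rCapacity_hasFPTApprox, balanced_hasFPTApprox, chromatic_hasFPTApprox,
    faultTolerantHasFPTApprox, stronglyPrivate_hasFPTApprox⟩
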